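/- Let $k$ be a field of characteristic $0$. A commutative quadratic-linear-constant (QLC) datum over $k$ is a vector space $V$ (concentrated in degree $0$) together with a subspace $R\subset k\oplus V\oplus \mathrm{Sym}^2(V)$ of $\mathrm{Sym}(V)$ such that $R\cap(k\oplus V)=0$ and $(R)\cap(k\oplus V\oplus \mathrm{Sym}^2(V))=R$; it presents the commutative QLC algebra $A=\mathrm{Sym}(V)/(R)$. A morphism $(V,R)\to(V',R')$ is a linear map $V\to V'$ whose induced map $\mathrm{Sym}(V)\to\mathrm{Sym}(V')$ sends $R$ into $R'$. Let $qR\subset \mathrm{Sym}^2(V)$ be the projection of $R$ onto its quadratic part, let $p:T(V)\to\mathrm{Sym}(V)$ be the canonical projection, and let $sV$ be $V$ placed in degree $1$. Let $\mathtt{GrCoAlg}_k$ be the category of $\mathbb Z$-graded coassociative counital coalgebras and $\mathtt{GrLieCoAlg}_k$ the category of $\mathbb Z$-graded Lie coalgebras over $k$. Let $\mathcal{L}ie^c:\mathtt{GrCoAlg}_k\to\mathtt{GrLieCoAlg}_k$ send $(C,\Delta)$ to $C$ with the cobracket $\Delta-\tau_{(12)}\circ\Delta$, where $\tau_{(12)}(x\otimes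 y)=(-1)^{|x||y|}y\otimes x$. The universal coenveloping coalgebra functor $\mathcal U^c:\mathtt{GrLieCoAlg}_k\to\mathtt{GrCoAlg}_k$ is the right adjoint of $\mathcal{L}ie^c$. Let $T^c(sV)$ be the tensor coalgebra (with deconcatenation) and $L^c(sV)$ the cofree (conilpotent) graded Lie coalgebra on $sV$, that is, the quotient of $\mathcal{L}ie^c(T^c(sV))$ by the unit and by all signed shuffle products of two tensors of positive weight; let $\pi:\mathcal{L}ie^c(T^c(sV))\to L^c(sV)$ be the projection. The Koszul dual Lie coalgebra $(qA)^¡$ is the largest graded Lie subcoalgebra $\mathfrak G\subset L^c(sV)$ for which the composite $\mathfrak G\to L^c(sV)\to L^c(sV)_{2}/s^2qR$ is zero, where $L^c(sV)_2=\wedge^2(sV)\cong s^2\mathrm{Sym}^2(V)$ is the weight two part. The Koszul dual coalgebra $(qA^+)^¡$ of $A$, viewed as the associative QLC algebra $T(V)/(R')$ with $R'=p^{-1}(R)\cap(k\oplus V\oplus V^{\otimes 2})$, is the largest graded subcoalgebra $C\subset T^c(sV)$ for which the composite $C\to T^c(sV)\to (sV)^{\otimes 2}/s^2qR'$ is zero,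 where $qR'\subset V^{\otimes 2}$ is the projection of $R'$. Theorem. There is an isomorphism of graded coalgebras $$\alpha_A:\ \mathcal U^c\big((qA)^¡\big)\;\xrightarrow{\ \cong\ }\;(qA^+)^¡,$$ natural in the commutative QLC datum $(V,R)$. It is compatible with the canonical maps to $L^c(sV)$: if $i_{\mathit{Ass}}:(qA^+)^¡\to T^c(sV)$ and $i_{\mathit{Lie}}:(qA)^¡\to L^c(sV)$ are the inclusions and $\varepsilon:\mathcal{L}ie^c(\mathcal U^c((qA)^¡))\to(qA)^¡$ is the counit of the adjunction, then $\pi\circ\mathcal{L}ie^c(i_{\mathit{Ass}}\circ\alpha_A)=i_{\mathit{Lie}}\circ\varepsilon$. -/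

import Mathlib

open scoped TensorProduct DirectSum
open CategoryTheory

universe u

namespace QLC

noncomputable section

section Graded

variable {k : Type u} [Field k] {M N P : Type u} [AddCommGroup M] [Module k M]
  [AddCommGroup N] [Module k N] [AddCommGroup P] [Module k P]

/-- The Koszul sign `(-1)^(i * j)`, as an element of `k`. -/
def ksign (k : Type u) [Field k] (i j : ℤ) : k := (((-1 : ℤˣ) ^ (i * j) : ℤˣ) : ℤ)

lemma ksign_comm (i j : ℤ) : ksign k i j = ksign k j i := by
  simp [ksign, mul_comm]

lemma ksign_mul_self (i j : ℤ) : ksign k i j * ksign k i j = 1 := by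
  unfold ksign
  rcases Int.units_eq_one_or ((-1 : ℤˣ) ^ (i * j)) with h | h <;> simp [h]

lemma ksign_add_left (i j l : ℤ) : ksign k (i + j) l = ksign k i l * ksign k j l := by
  unfold ksign
  rw [add_mul, uzpow_add]
  push_cast
  rfl

lemma ksign_add_right (i j l : ℤ) : ksign k l (i + j) = ksign k l i * ksign k l j := by
  rw [ksign_comm, ksign_add_left, ksign_comm i, ksign_comm j]

/-- The degree `n` part of the tensor product of two graded vector spaces. -/
def tensDeg (𝒜 : ℤ → Submodule k M) (ℬ : ℤ → Submodule k N) (n : ℤ) :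
    Submodule k (M ⊗[k] N) :=
  ⨆ i : ℤ, Submodule.map₂ (TensorProduct.mk k M N) (𝒜 i) (ℬ (n - i))

lemma tmul_mem_tensDeg {𝒜 : ℤ → Submodule k M} {ℬ : ℤ → Submodule k N} {i j n : ℤ} {x : M} {y : N}
    (hx : x ∈ 𝒜 i) (hy : y ∈ ℬ j) (h : i + j = n) : x ⊗ₜ[k] y ∈ tensDeg 𝒜 ℬ n := by
  subst h
  refine Submodule.mem_iSup_of_mem i (Submodule.apply_mem_map₂ _ hx ?_)
  simpa using hy

lemma tensDeg_le {𝒜 : ℤ → Submodule k M} {ℬ : ℤ → Submodule k N} {n : ℤ}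
    {Q : Submodule k (M ⊗[k] N)}
    (h : ∀ i j x y, x ∈ 𝒜 i → y ∈ ℬ j → i + j = n → x ⊗ₜ[k] y ∈ Q) : tensDeg 𝒜 ℬ n ≤ Q := by
  refine iSup_le fun i => Submodule.map₂_le.2 fun x hx y hy => ?_
  exact h i (n - i) x y hx hy (by ring)

lemma map_mem_tensDeg {M' N' : Type u} [AddCommGroup M'] [Module k M'] [AddCommGroup N']
    [Module k N'] {𝒜 : ℤ → Submodule k M} {ℬ : ℤ → Submodule k N}
    {𝒜' : ℤ → Submodule k M'} {ℬ' : ℤ → Submodule k N'} {f : M →ₗ[k] M'} {g : N →ₗ[k] N'}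
    (hf : ∀ i, ∀ x ∈ 𝒜 i, f x ∈ 𝒜' i) (hg : ∀ i, ∀ x ∈ ℬ i, g x ∈ ℬ' i) {n : ℤ}
    {t : M ⊗[k] N} (ht : t ∈ tensDeg 𝒜 ℬ n) : TensorProduct.map f g t ∈ tensDeg 𝒜' ℬ' n := by
  have : tensDeg 𝒜 ℬ n ≤ (tensDeg 𝒜' ℬ' n).comap (TensorProduct.map f g) :=
    tensDeg_le fun i j x y hx hy h => by
      simpa using tmul_mem_tensDeg (hf i x hx) (hg j y hy) h
  exact this ht

lemma isInternal_of_proj (𝒜 : ℤ → Submodule k M) (p : ℤ → M →ₗ[k] M) (h1 : ∀ i, ∀ x ∈ 𝒜 i, p i x = x)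
    (h2 : ∀ i j, i ≠ j → ∀ x ∈ 𝒜 j, p i x = 0) (h3 : ∀ x, x ∈ ⨆ i, 𝒜 i) :
    DirectSum.IsInternal 𝒜 := by
  rw [DirectSum.isInternal_submodule_iff_iSupIndep_and_iSup_eq_top]
  refine ⟨fun i => ?_, eq_top_iff.2 fun x _ => h3 x⟩
  rw [Submodule.disjoint_def]
  intro x hx hx'
  have : (⨆ j, ⨆ (_ : j ≠ i), 𝒜 j) ≤ LinearMap.ker (p i) :=
    iSup₂_le fun j hj y hy => h2 i j hj.symm y hy
  rw [← h1 i x hx]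
  exact this hx'

variable (𝒜 : ℤ → Submodule k M) [DirectSum.Decomposition 𝒜]

lemma ext_hom {f g : M →ₗ[k] P} (h : ∀ i, ∀ x ∈ 𝒜 i, f x = g x) : f = g := by
  ext x
  induction x using DirectSum.Decomposition.inductionOn 𝒜 with
  | zero => simp
  | homogeneous m => exact h _ _ m.2
  | add a b ha hb => simp [ha, hb]

lemma ext_hom₂ {f g : M ⊗[k] M →ₗ[k] P}
    (h : ∀ i j x y, x ∈ 𝒜 i → y ∈ 𝒜 j → f (x ⊗ₜ y) = g (x ⊗ₜ y)) : f = g := by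
  refine TensorProduct.ext (ext_hom 𝒜 fun i x hx => ext_hom 𝒜 fun j y hy => ?_)
  exact h i j x y hx hy

lemma ext_hom₃ {f g : (M ⊗[k] M) ⊗[k] M →ₗ[k] P}
    (h : ∀ i j l x y z, x ∈ 𝒜 i → y ∈ 𝒜 j → z ∈ 𝒜 l →
      f ((x ⊗ₜ y) ⊗ₜ z) = g ((x ⊗ₜ y) ⊗ₜ z)) : f = g := by
  refine TensorProduct.ext (ext_hom₂ 𝒜 fun i j x y hx hy => ext_hom 𝒜 fun l z hz => ?_)
  exact h i j l x y z hx hy hz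

/-- The transposition `x ⊗ y ↦ (-1)^(|x||y|) y ⊗ x` of a graded vector space. -/
def gswap : M ⊗[k] M →ₗ[k] M ⊗[k] M :=
  (TensorProduct.congr (DirectSum.decomposeLinearEquiv 𝒜)
      (DirectSum.decomposeLinearEquiv 𝒜) ≪≫ₗ
    TensorProduct.gradedComm k (fun i => 𝒜 i) (fun i => 𝒜 i) ≪≫ₗ
    (TensorProduct.congr (DirectSum.decomposeLinearEquiv 𝒜)
      (DirectSum.decomposeLinearEquiv 𝒜)).symm).toLinearMap

lemma gswap_tmul {i j : ℤ} {x y : M} (hx : x ∈ 𝒜 i) (hy : y ∈ 𝒜 j) :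
    gswap 𝒜 (x ⊗ₜ y) = ksign k i j • (y ⊗ₜ[k] x) := by
  lift x to 𝒜 i using hx
  lift y to 𝒜 j using hy
  have := TensorProduct.gradedComm_of_tmul_of k (fun i => 𝒜 i) (fun i => 𝒜 i) i j x y
  simp only [DirectSum.lof_eq_of] at this
  simp only [gswap, LinearEquiv.coe_coe, LinearEquiv.trans_apply, TensorProduct.congr_tmul,
    DirectSum.decomposeLinearEquiv_apply, DirectSum.decompose_coe, this]
  rw [Units.smul_def, ← Int.cast_smul_eq_zsmul k, LinearEquiv.map_smul]
  simp [TensorProduct.congr_symm_tmul, ksign, mul_comm, DirectSum.decomposeLinearEquiv_symm_apply]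

/-- The cyclic permutation `x ⊗ y ⊗ z ↦ ± y ⊗ z ⊗ x`, with its Koszul sign. -/
def gcyc : (M ⊗[k] M) ⊗[k] M →ₗ[k] (M ⊗[k] M) ⊗[k] M :=
  (TensorProduct.assoc k M M M).symm.toLinearMap ∘ₗ (gswap 𝒜).lTensor M ∘ₗ
    (TensorProduct.assoc k M M M).toLinearMap ∘ₗ (gswap 𝒜).rTensor M

lemma gcyc_tmul {i j l : ℤ} {x y z : M} (hx : x ∈ 𝒜 i) (hy : y ∈ 𝒜 j) (hz : z ∈ 𝒜 l) :
    gcyc 𝒜 ((x ⊗ₜ y) ⊗ₜ z) = (ksign k i j * ksign k i l) • ((y ⊗ₜ[k] z) ⊗ₜ[k] x) := by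
  simp [gcyc, gswap_tmul 𝒜 hx hy, gswap_tmul 𝒜 hx hz, ← TensorProduct.smul_tmul', mul_smul,
    TensorProduct.tmul_smul]

lemma gswap_gswap : gswap 𝒜 ∘ₗ gswap 𝒜 = LinearMap.id := by
  refine ext_hom₂ 𝒜 fun i j x y hx hy => ?_
  simp [gswap_tmul 𝒜 hx hy, gswap_tmul 𝒜 hy hx, smul_smul, ksign_comm (k := k) j i, ksign_mul_self]

lemma gcyc_cube : gcyc 𝒜 ∘ₗ gcyc 𝒜 ∘ₗ gcyc 𝒜 = LinearMap.id := by
  refine ext_hom₃ 𝒜 fun i j l x y z hx hy hz => ?_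
  simp only [LinearMap.comp_apply, gcyc_tmul 𝒜 hx hy hz, gcyc_tmul 𝒜 hy hz hx,
    gcyc_tmul 𝒜 hz hx hy, map_smul, smul_smul, LinearMap.id_apply]
  convert one_smul k _
  have h1 := ksign_mul_self (k := k) i j
  have h2 := ksign_mul_self (k := k) i l
  have h3 := ksign_mul_self (k := k) j l
  rw [ksign_comm j i, ksign_comm l i, ksign_comm l j]
  linear_combination h1 * (ksign k i l * ksign k i l * ksign k j l * ksign k j l) +
    h2 * (ksign k j l * ksign k j l) + h3

lemma gswap_gcyc : (gswap 𝒜).rTensor M ∘ₗ gcyc 𝒜 =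
    gcyc 𝒜 ∘ₗ gcyc 𝒜 ∘ₗ (gswap 𝒜).rTensor M := by
  refine ext_hom₃ 𝒜 fun i j l x y z hx hy hz => ?_
  simp only [LinearMap.comp_apply, gcyc_tmul 𝒜 hx hy hz, gcyc_tmul 𝒜 hy hx hz,
    gcyc_tmul 𝒜 hx hz hy, map_smul, smul_smul, LinearMap.rTensor_tmul, gswap_tmul 𝒜 hx hy,
    gswap_tmul 𝒜 hy hz, ← TensorProduct.smul_tmul']
  congr 1
  have h1 := ksign_mul_self (k := k) i j
  rw [ksign_comm j i]
  linear_combination - h1 * (ksign k i l * ksign k i j * ksign k j l)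

lemma gcyc_assoc {i n : ℤ} {x : M} (hx : x ∈ 𝒜 i) {t : M ⊗[k] M} (ht : t ∈ tensDeg 𝒜 𝒜 n) :
    gcyc 𝒜 ((TensorProduct.assoc k M M M).symm (x ⊗ₜ t)) = ksign k i n • (t ⊗ₜ[k] x) := by
  have : tensDeg 𝒜 𝒜 n ≤ LinearMap.eqLocus
      (gcyc 𝒜 ∘ₗ (TensorProduct.assoc k M M M).symm.toLinearMap ∘ₗ TensorProduct.mk k M _ x)
      (ksign k i n • (TensorProduct.mk k (M ⊗[k] M) M).flip x) := by
    refine tensDeg_le fun p q y z hy hz h => ?_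
    simp [LinearMap.mem_eqLocus, gcyc_tmul 𝒜 hx hy hz, ← h, ksign_add_right]
  exact this ht

lemma rTensor_comp_gswap {Δ : M →ₗ[k] M ⊗[k] M} (hΔ : ∀ n, ∀ x ∈ 𝒜 n, Δ x ∈ tensDeg 𝒜 𝒜 n) :
    Δ.rTensor M ∘ₗ gswap 𝒜 =
      gcyc 𝒜 ∘ₗ (TensorProduct.assoc k M M M).symm.toLinearMap ∘ₗ Δ.lTensor M := by
  refine ext_hom₂ 𝒜 fun i j x y hx hy => ?_
  simp [gswap_tmul 𝒜 hx hy, gcyc_assoc 𝒜 hx (hΔ j y hy)]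

lemma gswap_mem_tensDeg {n : ℤ} {t : M ⊗[k] M} (ht : t ∈ tensDeg 𝒜 𝒜 n) :
    gswap 𝒜 t ∈ tensDeg 𝒜 𝒜 n := by
  have : tensDeg 𝒜 𝒜 n ≤ (tensDeg 𝒜 𝒜 n).comap (gswap 𝒜) :=
    tensDeg_le fun i j x y hx hy h => by
      simpa [gswap_tmul 𝒜 hx hy] using
        Submodule.smul_mem _ _ (tmul_mem_tensDeg hy hx ((add_comm _ _).trans h))
  exact this ht

lemma gswap_map {ℬ : ℤ → Submodule k N} [DirectSum.Decomposition ℬ] {f : M →ₗ[k] N}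
    (hf : ∀ i, ∀ x ∈ 𝒜 i, f x ∈ ℬ i) :
    gswap ℬ ∘ₗ TensorProduct.map f f = TensorProduct.map f f ∘ₗ gswap 𝒜 := by
  refine ext_hom₂ 𝒜 fun i j x y hx hy => ?_
  simp [gswap_tmul 𝒜 hx hy, gswap_tmul ℬ (hf i x hx) (hf j y hy)]

lemma gcyc_map {ℬ : ℤ → Submodule k N} [DirectSum.Decomposition ℬ] {f : M →ₗ[k] N}
    (hf : ∀ i, ∀ x ∈ 𝒜 i, f x ∈ ℬ i) :
    gcyc ℬ ∘ₗ TensorProduct.map (TensorProduct.map f f) f =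
      TensorProduct.map (TensorProduct.map f f) f ∘ₗ gcyc 𝒜 := by
  refine ext_hom₃ 𝒜 fun i j l x y z hx hy hz => ?_
  simp [gcyc_tmul 𝒜 hx hy hz, gcyc_tmul ℬ (hf i x hx) (hf j y hy) (hf l z hz)]

/-- The left-hand side `(id + τ + τ²) ∘ (δ ⊗ id) ∘ δ` of the co-Jacobi identity. -/
def coJacobiator (δ : M →ₗ[k] M ⊗[k] M) : M →ₗ[k] (M ⊗[k] M) ⊗[k] M :=
  (LinearMap.id + gcyc 𝒜 + gcyc 𝒜 ∘ₗ gcyc 𝒜) ∘ₗ δ.rTensor M ∘ₗ δ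

lemma coJacobiator_comul {Δ : M →ₗ[k] M ⊗[k] M} (hΔ : ∀ n, ∀ x ∈ 𝒜 n, Δ x ∈ tensDeg 𝒜 𝒜 n)
    (hassoc : (TensorProduct.assoc k M M M).toLinearMap ∘ₗ Δ.rTensor M ∘ₗ Δ = Δ.lTensor M ∘ₗ Δ) :
    coJacobiator 𝒜 (Δ - gswap 𝒜 ∘ₗ Δ) = 0 := by
  ext x
  set D := Δ.rTensor M (Δ x) with hD
  have e1 : Δ.rTensor M (gswap 𝒜 (Δ x)) = gcyc 𝒜 D := by
    have := LinearMap.congr_fun (rTensor_comp_gswap 𝒜 hΔ) (Δ x)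
    simp only [LinearMap.comp_apply] at this
    rw [this]
    have h2 := LinearMap.congr_fun hassoc x
    simp only [LinearMap.comp_apply, LinearEquiv.coe_coe] at h2
    rw [← h2]
    simp [hD]
  have ac : ∀ t, (gswap 𝒜).rTensor M (gcyc 𝒜 t) = gcyc 𝒜 (gcyc 𝒜 ((gswap 𝒜).rTensor M t)) :=
    fun t => LinearMap.congr_fun (gswap_gcyc 𝒜) t
  have ccc : ∀ t, gcyc 𝒜 (gcyc 𝒜 (gcyc 𝒜 t)) = t := fun t => LinearMap.congr_fun (gcyc_cube 𝒜) t
  have e2 : ((Δ - gswap 𝒜 ∘ₗ Δ).rTensor M) ((Δ - gswap 𝒜 ∘ₗ Δ) x) =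
      D - gcyc 𝒜 D - (gswap 𝒜).rTensor M D + gcyc 𝒜 (gcyc 𝒜 ((gswap 𝒜).rTensor M D)) := by
    rw [LinearMap.rTensor_sub, LinearMap.rTensor_comp]
    simp only [LinearMap.sub_apply, LinearMap.comp_apply, map_sub, e1, ← hD, ac]
    abel
  simp only [coJacobiator, LinearMap.comp_apply, e2, LinearMap.add_apply, map_add, map_sub, ccc,
    LinearMap.id_apply, LinearMap.zero_apply]
  abel

/-- The projection of a graded vector space onto its degree `n` part. -/
def gproj (n : ℤ) : M →ₗ[k] M :=
  (𝒜 n).subtype ∘ₗ DirectSum.component k ℤ (fun i => 𝒜 i) n ∘ₗ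
    (DirectSum.decomposeLinearEquiv 𝒜).toLinearMap

lemma gproj_apply (n : ℤ) (x : M) : gproj 𝒜 n x = (DirectSum.decompose 𝒜 x n : M) := rfl

lemma gproj_mem (n : ℤ) (x : M) : gproj 𝒜 n x ∈ 𝒜 n := by
  rw [gproj_apply]; exact (DirectSum.decompose 𝒜 x n).2

lemma gproj_same {n : ℤ} {x : M} (hx : x ∈ 𝒜 n) : gproj 𝒜 n x = x :=
  DirectSum.decompose_of_mem_same 𝒜 hx

lemma gproj_ne {m n : ℤ} {x : M} (hx : x ∈ 𝒜 m) (h : m ≠ n) : gproj 𝒜 n x = 0 :=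
  DirectSum.decompose_of_mem_ne 𝒜 hx h

/-- If all homogeneous components of `x` lie in a submodule, so does `x`. -/
lemma mem_of_gproj_mem {S : Submodule k M} {x : M} (h : ∀ n, gproj 𝒜 n x ∈ S) : x ∈ S := by
  classical
  rw [← DirectSum.sum_support_decompose 𝒜 x]
  exact Submodule.sum_mem _ fun i _ => h i

lemma gproj_map {ℬ : ℤ → Submodule k N} [DirectSum.Decomposition ℬ] {f : M →ₗ[k] N}
    (hf : ∀ i, ∀ x ∈ 𝒜 i, f x ∈ ℬ i) (n : ℤ) (x : M) : gproj ℬ n (f x) = f (gproj 𝒜 n x) := by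
  have : gproj ℬ n ∘ₗ f = f ∘ₗ gproj 𝒜 n := by
    refine ext_hom 𝒜 fun i x hx => ?_
    by_cases h : i = n
    · subst h
      simp [gproj_same 𝒜 hx, gproj_same ℬ (hf _ x hx)]
    · simp [gproj_ne 𝒜 hx h, gproj_ne ℬ (hf _ x hx) h]
  exact LinearMap.congr_fun this x

/-- The projection of `M ⊗ M` onto its degree `n` part. -/
def tproj (n : ℤ) : M ⊗[k] M →ₗ[k] M ⊗[k] M :=
  DirectSum.toModule k (ℤ × ℤ) (M ⊗[k] M) (fun ij =>
      if ij.1 + ij.2 = n then TensorProduct.mapIncl (𝒜 ij.1) (𝒜 ij.2) else 0) ∘ₗ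
    (TensorProduct.directSum k k (fun i => 𝒜 i) (fun i => 𝒜 i)).toLinearMap ∘ₗ
    TensorProduct.map (DirectSum.decomposeLinearEquiv 𝒜).toLinearMap
      (DirectSum.decomposeLinearEquiv 𝒜).toLinearMap

lemma tproj_tmul {n i j : ℤ} {x y : M} (hx : x ∈ 𝒜 i) (hy : y ∈ 𝒜 j) :
    tproj 𝒜 n (x ⊗ₜ y) = if i + j = n then x ⊗ₜ[k] y else 0 := by
  lift x to 𝒜 i using hx
  lift y to 𝒜 j using hy
  have := TensorProduct.directSum_lof_tmul_lof (R := k) (S := k) (M₁ := fun i => 𝒜 i)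
    (M₂ := fun i => 𝒜 i) i x j y
  simp only [DirectSum.lof_eq_of] at this
  simp only [tproj, LinearMap.comp_apply, TensorProduct.map_tmul, LinearEquiv.coe_coe,
    DirectSum.decomposeLinearEquiv_apply, DirectSum.decompose_coe, this]
  rw [← DirectSum.lof_eq_of k, DirectSum.toModule_lof]
  split_ifs <;> simp [TensorProduct.mapIncl]

lemma tproj_mem (n : ℤ) (t : M ⊗[k] M) : tproj 𝒜 n t ∈ tensDeg 𝒜 𝒜 n := by
  have : (tensDeg 𝒜 𝒜 n).mkQ ∘ₗ tproj 𝒜 n = 0 := by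
    refine ext_hom₂ 𝒜 fun i j x y hx hy => ?_
    simp only [LinearMap.comp_apply, tproj_tmul 𝒜 hx hy, LinearMap.zero_apply,
      Submodule.mkQ_apply, Submodule.Quotient.mk_eq_zero]
    split_ifs with h
    · exact tmul_mem_tensDeg hx hy h
    · exact Submodule.zero_mem _
  have h := LinearMap.congr_fun this t
  simpa using h

lemma tproj_same {n : ℤ} {t : M ⊗[k] M} (ht : t ∈ tensDeg 𝒜 𝒜 n) : tproj 𝒜 n t = t := by
  have : tensDeg 𝒜 𝒜 n ≤ LinearMap.eqLocus (tproj 𝒜 n) LinearMap.id :=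
    tensDeg_le fun i j x y hx hy h => by
      simp [LinearMap.mem_eqLocus, tproj_tmul 𝒜 hx hy, h]
  exact this ht

/-- A tensor whose image under an injective graded map is homogeneous is homogeneous. -/
lemma mem_tensDeg_of_map {ℬ : ℤ → Submodule k N} [DirectSum.Decomposition ℬ] {f : M →ₗ[k] N}
    (hf : ∀ i, ∀ x ∈ 𝒜 i, f x ∈ ℬ i) (hinj : Function.Injective f) {n : ℤ} {t : M ⊗[k] M}
    (ht : TensorProduct.map f f t ∈ tensDeg ℬ ℬ n) : t ∈ tensDeg 𝒜 𝒜 n := by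
  have key : tproj ℬ n ∘ₗ TensorProduct.map f f = TensorProduct.map f f ∘ₗ tproj 𝒜 n := by
    refine ext_hom₂ 𝒜 fun i j x y hx hy => ?_
    simp only [LinearMap.comp_apply, TensorProduct.map_tmul, tproj_tmul 𝒜 hx hy,
      tproj_tmul ℬ (hf i x hx) (hf j y hy)]
    split_ifs <;> simp
  have h := LinearMap.congr_fun key t
  simp only [LinearMap.comp_apply, tproj_same ℬ ht] at h
  have h' := TensorProduct.map_injective_of_flat_flat f f hinj hinj h
  rw [h']
  exact tproj_mem 𝒜 n t

/-- A homogeneous subspace `S` with `δ(S) ⊆ S ⊗ S`: for `δ` a comultiplication this says that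
`S` is a graded subcoalgebra, for `δ` a Lie cobracket that it is a graded Lie subcoalgebra. -/
structure IsGrSub (δ : M →ₗ[k] M ⊗[k] M) (S : Submodule k M) : Prop where
  homogeneous : ∀ n, ∀ x ∈ S, gproj 𝒜 n x ∈ S
  map_mem : ∀ x ∈ S, δ x ∈ LinearMap.range (TensorProduct.map S.subtype S.subtype)

/-- The largest graded sub(-Lie-)coalgebra contained in the subspace `Q`. -/
def largestSub (δ : M →ₗ[k] M ⊗[k] M) (Q : Submodule k M) : Submodule k M :=
  sSup {S | IsGrSub 𝒜 δ S ∧ S ≤ Q}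

lemma range_map_subtype_mono {S T : Submodule k M} (h : S ≤ T) :
    LinearMap.range (TensorProduct.map S.subtype S.subtype) ≤
      LinearMap.range (TensorProduct.map T.subtype T.subtype) := by
  rintro _ ⟨t, rfl⟩
  refine ⟨TensorProduct.map (Submodule.inclusion h) (Submodule.inclusion h) t, ?_⟩
  rw [← LinearMap.comp_apply, ← TensorProduct.map_comp]
  rfl

lemma isGrSub_largestSub (δ : M →ₗ[k] M ⊗[k] M) (Q : Submodule k M) :
    IsGrSub 𝒜 δ (largestSub 𝒜 δ Q) := by
  constructor
  · intro n
    have : largestSub 𝒜 δ Q ≤ (largestSub 𝒜 δ Q).comap (gproj 𝒜 n) :=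
      sSup_le fun S hS x hx => le_sSup hS (hS.1.homogeneous n x hx)
    exact fun x hx => this hx
  · have : largestSub 𝒜 δ Q ≤ (LinearMap.range (TensorProduct.map (largestSub 𝒜 δ Q).subtype
        (largestSub 𝒜 δ Q).subtype)).comap δ :=
      sSup_le fun S hS x hx =>
        range_map_subtype_mono (S := S) (T := largestSub 𝒜 δ Q) (le_sSup hS) (hS.1.map_mem x hx)
    exact fun x hx => this hx

lemma largestSub_le (δ : M →ₗ[k] M ⊗[k] M) (Q : Submodule k M) : largestSub 𝒜 δ Q ≤ Q :=
  sSup_le fun _ hS => hS.2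

lemma le_largestSub {δ : M →ₗ[k] M ⊗[k] M} {Q S : Submodule k M} (h : IsGrSub 𝒜 δ S)
    (hQ : S ≤ Q) : S ≤ largestSub 𝒜 δ Q := le_sSup ⟨h, hQ⟩

/-- The image of a graded sub(-Lie-)coalgebra under a morphism. -/
lemma IsGrSub.map {ℬ : ℤ → Submodule k N} [DirectSum.Decomposition ℬ] {f : M →ₗ[k] N}
    (hf : ∀ i, ∀ x ∈ 𝒜 i, f x ∈ ℬ i) {δ : M →ₗ[k] M ⊗[k] M} {δ' : N →ₗ[k] N ⊗[k] N}
    (hδ : ∀ x, δ' (f x) = TensorProduct.map f f (δ x)) {S : Submodule k M}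
    (hS : IsGrSub 𝒜 δ S) : IsGrSub ℬ δ' (S.map f) := by
  constructor
  · rintro n _ ⟨x, hx, rfl⟩
    rw [gproj_map 𝒜 hf]
    exact ⟨_, hS.homogeneous n x hx, rfl⟩
  · rintro _ ⟨x, hx, rfl⟩
    obtain ⟨t, ht⟩ := hS.map_mem x hx
    rw [hδ, ← ht]
    refine ⟨TensorProduct.map (f.submoduleMap S) (f.submoduleMap S) t, ?_⟩
    rw [← LinearMap.comp_apply, ← TensorProduct.map_comp, ← LinearMap.comp_apply,
      ← TensorProduct.map_comp]
    rfl

lemma map_largestSub_le {ℬ : ℤ → Submodule k N} [DirectSum.Decomposition ℬ] {f : M →ₗ[k] N}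
    (hf : ∀ i, ∀ x ∈ 𝒜 i, f x ∈ ℬ i) {δ : M →ₗ[k] M ⊗[k] M} {δ' : N →ₗ[k] N ⊗[k] N}
    (hδ : ∀ x, δ' (f x) = TensorProduct.map f f (δ x)) {Q : Submodule k M} {Q' : Submodule k N}
    (hQ : ∀ x ∈ Q, f x ∈ Q') : ∀ x ∈ largestSub 𝒜 δ Q, f x ∈ largestSub ℬ δ' Q' := by
  intro x hx
  refine le_largestSub ℬ ((isGrSub_largestSub 𝒜 δ Q).map 𝒜 hf hδ) ?_ ⟨x, hx, rfl⟩
  rintro _ ⟨y, hy, rfl⟩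
  exact hQ y (largestSub_le 𝒜 δ Q hy)

/-- The grading induced on a subspace. -/
def subDeg (S : Submodule k M) (n : ℤ) : Submodule k S := (𝒜 n).comap S.subtype

lemma subDeg_isInternal {S : Submodule k M} (hS : ∀ n, ∀ x ∈ S, gproj 𝒜 n x ∈ S) :
    DirectSum.IsInternal (subDeg 𝒜 S) := by
  refine isInternal_of_proj _ (fun n => (gproj 𝒜 n).restrict (hS n)) ?_ ?_ ?_
  · intro i x hx
    exact Subtype.ext (gproj_same 𝒜 hx)
  · intro i j hij x hx
    exact Subtype.ext (gproj_ne 𝒜 hx hij.symm)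
  · rintro ⟨x, hx⟩
    classical
    have e : (⟨x, hx⟩ : S) = ∑ i ∈ (DirectSum.decompose 𝒜 x).support,
        ⟨gproj 𝒜 i x, hS i x hx⟩ := by
      refine Subtype.ext ?_
      rw [AddSubmonoidClass.coe_finsetSum]
      exact (DirectSum.sum_support_decompose 𝒜 x).symm
    rw [e]
    exact Submodule.sum_mem _ fun i _ => Submodule.mem_iSup_of_mem i (gproj_mem 𝒜 i x)

lemma map_subtype_injective (S : Submodule k M) :
    Function.Injective (TensorProduct.map S.subtype S.subtype) :=
  TensorProduct.map_injective_of_flat_flat _ _ S.injective_subtype S.injective_subtype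

/-- The comultiplication (or cobracket) restricted to a subspace `S` with `δ(S) ⊆ S ⊗ S`. -/
def subMap {δ : M →ₗ[k] M ⊗[k] M} {S : Submodule k M}
    (hS : ∀ x ∈ S, δ x ∈ LinearMap.range (TensorProduct.map S.subtype S.subtype)) :
    S →ₗ[k] S ⊗[k] S :=
  (LinearEquiv.ofInjective _ (map_subtype_injective S)).symm.toLinearMap ∘ₗ
    (δ ∘ₗ S.subtype).codRestrict _ fun x => hS x x.2

lemma map_subMap {δ : M →ₗ[k] M ⊗[k] M} {S : Submodule k M}
    (hS : ∀ x ∈ S, δ x ∈ LinearMap.range (TensorProduct.map S.subtype S.subtype)) (x : S) :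
    TensorProduct.map S.subtype S.subtype (subMap hS x) = δ x := by
  have := LinearEquiv.apply_symm_apply (LinearEquiv.ofInjective _ (map_subtype_injective S))
    ((δ ∘ₗ S.subtype).codRestrict _ (fun x => hS x x.2) x)
  exact congrArg Subtype.val this

lemma coJacobiator_map {ℬ : ℤ → Submodule k N} [DirectSum.Decomposition ℬ] {f : M →ₗ[k] N}
    (hf : ∀ i, ∀ x ∈ 𝒜 i, f x ∈ ℬ i) {δ : M →ₗ[k] M ⊗[k] M} {δ' : N →ₗ[k] N ⊗[k] N}
    (hδ : ∀ x, δ' (f x) = TensorProduct.map f f (δ x)) (x : M) :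
    coJacobiator ℬ δ' (f x) =
      TensorProduct.map (TensorProduct.map f f) f (coJacobiator 𝒜 δ x) := by
  have hc : ∀ t, gcyc ℬ (TensorProduct.map (TensorProduct.map f f) f t) =
      TensorProduct.map (TensorProduct.map f f) f (gcyc 𝒜 t) :=
    fun t => LinearMap.congr_fun (gcyc_map 𝒜 hf) t
  have hr : ∀ t, δ'.rTensor N (TensorProduct.map f f t) =
      TensorProduct.map (TensorProduct.map f f) f (δ.rTensor M t) := by
    intro t
    induction t using TensorProduct.induction_on with
    | zero => simp
    | tmul a b => simp [hδ]
    | add a b ha hb => simp only [map_add, ha, hb]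
  simp only [coJacobiator, LinearMap.comp_apply, LinearMap.add_apply, LinearMap.id_apply, hδ, hr,
    hc, map_add]

end Graded


/-! ### Graded coalgebras and graded Lie coalgebras -/

/-- A graded (coassociative, counital) coalgebra over `k`, graded by `ℤ`. -/
structure GrCoalg (k : Type u) [Field k] where
  carrier : Type u
  [addCommGroup : AddCommGroup carrier]
  [module : Module k carrier]
  [coalgebra : Coalgebra k carrier]
  deg : ℤ → Submodule k carrier
  [decomposition : DirectSum.Decomposition deg]
  comul_mem : ∀ n, ∀ x ∈ deg n, Coalgebra.comul (R := k) x ∈ tensDeg deg deg n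
  counit_eq_zero : ∀ n, n ≠ 0 → ∀ x ∈ deg n, Coalgebra.counit (R := k) x = 0

attribute [instance] GrCoalg.addCommGroup GrCoalg.module GrCoalg.coalgebra GrCoalg.decomposition

/-- A morphism of graded coalgebras. -/
@[ext]
structure GrCoalg.Hom {k : Type u} [Field k] (C D : GrCoalg k) where
  toCoalgHom : C.carrier →ₗc[k] D.carrier
  map_deg : ∀ n, ∀ x ∈ C.deg n, toCoalgHom x ∈ D.deg n

instance (k : Type u) [Field k] : Category (GrCoalg k) where
  Hom := GrCoalg.Hom
  id C := ⟨CoalgHom.id k C.carrier, fun _ _ hx => hx⟩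
  comp f g := ⟨g.toCoalgHom.comp f.toCoalgHom, fun n x hx => g.map_deg n _ (f.map_deg n x hx)⟩

/-- A graded Lie coalgebra over `k`, graded by `ℤ`. -/
structure GrLieCoalg (k : Type u) [Field k] where
  carrier : Type u
  [addCommGroup : AddCommGroup carrier]
  [module : Module k carrier]
  deg : ℤ → Submodule k carrier
  [decomposition : DirectSum.Decomposition deg]
  /-- The Lie cobracket. -/
  cobr : carrier →ₗ[k] carrier ⊗[k] carrier
  cobr_mem : ∀ n, ∀ x ∈ deg n, cobr x ∈ tensDeg deg deg n
  gswap_cobr : gswap deg ∘ₗ cobr = -cobr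
  coJacobi : coJacobiator deg cobr = 0

attribute [instance] GrLieCoalg.addCommGroup GrLieCoalg.module GrLieCoalg.decomposition

/-- A morphism of graded Lie coalgebras. -/
@[ext]
structure GrLieCoalg.Hom {k : Type u} [Field k] (G H : GrLieCoalg k) where
  toLinearMap : G.carrier →ₗ[k] H.carrier
  map_deg : ∀ n, ∀ x ∈ G.deg n, toLinearMap x ∈ H.deg n
  map_cobr : ∀ x, H.cobr (toLinearMap x) = TensorProduct.map toLinearMap toLinearMap (G.cobr x)

instance (k : Type u) [Field k] : Category (GrLieCoalg k) where
  Hom := GrLieCoalg.Hom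
  id G := ⟨LinearMap.id, fun _ _ hx => hx, fun x => by simp⟩
  comp f g := ⟨g.toLinearMap ∘ₗ f.toLinearMap, fun n x hx => g.map_deg n _ (f.map_deg n x hx),
    fun x => by
      rw [TensorProduct.map_comp]
      simp [f.map_cobr, g.map_cobr]⟩

section Functors

variable {k : Type u} [Field k]

@[ext]
lemma GrCoalg.hom_ext {C D : GrCoalg k} {f g : C ⟶ D}
    (h : ∀ x, f.toCoalgHom x = g.toCoalgHom x) : f = g :=
  GrCoalg.Hom.ext (CoalgHom.ext h)

@[ext]
lemma GrLieCoalg.hom_ext {G H : GrLieCoalg k} {f g : G ⟶ H}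
    (h : ∀ x, f.toLinearMap x = g.toLinearMap x) : f = g :=
  GrLieCoalg.Hom.ext (LinearMap.ext h)

@[simp] lemma GrCoalg.id_apply (C : GrCoalg k) (x : C.carrier) :
    GrCoalg.Hom.toCoalgHom (𝟙 C) x = x := rfl

@[simp] lemma GrCoalg.comp_apply {C D E : GrCoalg k} (f : C ⟶ D) (g : D ⟶ E) (x : C.carrier) :
    (f ≫ g).toCoalgHom x = g.toCoalgHom (f.toCoalgHom x) := rfl

@[simp] lemma GrLieCoalg.id_apply (G : GrLieCoalg k) (x : G.carrier) :
    GrLieCoalg.Hom.toLinearMap (𝟙 G) x = x := rfl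

@[simp] lemma GrLieCoalg.comp_apply {G H K : GrLieCoalg k} (f : G ⟶ H) (g : H ⟶ K)
    (x : G.carrier) : (f ≫ g).toLinearMap x = g.toLinearMap (f.toLinearMap x) := rfl

lemma GrCoalg.map_comul {C D : GrCoalg k} (f : C ⟶ D) (x : C.carrier) :
    Coalgebra.comul (R := k) (f.toCoalgHom x) =
      TensorProduct.map f.toCoalgHom.toLinearMap f.toCoalgHom.toLinearMap
        (Coalgebra.comul (R := k) x) :=
  (LinearMap.congr_fun f.toCoalgHom.map_comp_comul x).symm

/-- The graded Lie coalgebra of a graded coalgebra: the cobracket is `Δ - τ ∘ Δ`. -/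
def lieObj (C : GrCoalg k) : GrLieCoalg k where
  carrier := C.carrier
  deg := C.deg
  cobr := Coalgebra.comul - gswap C.deg ∘ₗ Coalgebra.comul
  cobr_mem n x hx :=
    Submodule.sub_mem _ (C.comul_mem n x hx) (gswap_mem_tensDeg C.deg (C.comul_mem n x hx))
  gswap_cobr := by
    rw [LinearMap.comp_sub, ← LinearMap.comp_assoc, gswap_gswap, LinearMap.id_comp, neg_sub]
  coJacobi := coJacobiator_comul C.deg C.comul_mem Coalgebra.coassoc

/-- The functor `𝓛ie^c` from graded coalgebras to graded Lie coalgebras. -/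
def lieFunctor (k : Type u) [Field k] : GrCoalg k ⥤ GrLieCoalg k where
  obj := lieObj
  map {C D} f :=
    { toLinearMap := f.toCoalgHom.toLinearMap
      map_deg := f.map_deg
      map_cobr := fun (x : C.carrier) => by
        have h := LinearMap.congr_fun (gswap_map C.deg (ℬ := D.deg)
          (f := f.toCoalgHom.toLinearMap) f.map_deg) (Coalgebra.comul x)
        simp only [LinearMap.comp_apply] at h
        have h' := GrCoalg.map_comul f x
        change Coalgebra.comul (R := k) (f.toCoalgHom x) - gswap D.deg (Coalgebra.comul (R := k)
          (f.toCoalgHom x)) = TensorProduct.map _ _ (Coalgebra.comul (R := k) x -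
            gswap C.deg (Coalgebra.comul (R := k) x))
        rw [h', map_sub, h] }
  map_id _ := rfl
  map_comp _ _ := rfl

/-- The graded coalgebra structure on a graded subcoalgebra. -/
def GrCoalg.sub (C : GrCoalg k) (S : Submodule k C.carrier)
    (hS : IsGrSub C.deg Coalgebra.comul S) : GrCoalg k :=
  have hι : Function.Injective S.subtype := S.injective_subtype
  letI : DirectSum.Decomposition (subDeg C.deg S) :=
    (subDeg_isInternal C.deg hS.homogeneous).chooseDecomposition
  have hd : ∀ i, ∀ x ∈ subDeg C.deg S i, S.subtype x ∈ C.deg i := fun _ _ hx => hx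
  have hc := map_subMap hS.map_mem
  have hc' : TensorProduct.map S.subtype S.subtype ∘ₗ subMap hS.map_mem =
    Coalgebra.comul (R := k) ∘ₗ S.subtype := LinearMap.ext hc
  letI : Coalgebra k S :=
    { comul := subMap hS.map_mem
      counit := Coalgebra.counit ∘ₗ S.subtype
      coassoc := by
        have hinj : Function.Injective
            (TensorProduct.map S.subtype (TensorProduct.map S.subtype S.subtype)) :=
          TensorProduct.map_injective_of_flat_flat _ _ hι (map_subtype_injective S)
        refine LinearMap.ext fun x => hinj ?_
        have e1 : ∀ t, TensorProduct.map S.subtype (TensorProduct.map S.subtype S.subtype)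
            (TensorProduct.assoc k S S S ((subMap hS.map_mem).rTensor S t)) =
            TensorProduct.assoc k _ _ _ ((Coalgebra.comul (R := k)).rTensor C.carrier
              (TensorProduct.map S.subtype S.subtype t)) := by
          intro t
          rw [TensorProduct.map_map_assoc]
          congr 1
          simp only [LinearMap.rTensor, ← LinearMap.comp_apply, ← TensorProduct.map_comp, hc',
            LinearMap.comp_id, LinearMap.id_comp]
        have e2 : ∀ t, TensorProduct.map S.subtype (TensorProduct.map S.subtype S.subtype)
            ((subMap hS.map_mem).lTensor S t) = (Coalgebra.comul (R := k)).lTensor C.carrier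
              (TensorProduct.map S.subtype S.subtype t) := by
          intro t
          simp only [LinearMap.lTensor, ← LinearMap.comp_apply, ← TensorProduct.map_comp, hc',
            LinearMap.comp_id, LinearMap.id_comp]
        simp only [LinearMap.comp_apply, LinearEquiv.coe_coe, e1, e2, hc]
        exact Coalgebra.coassoc_apply _
      rTensor_counit_comp_comul := by
        have hinj : Function.Injective (S.subtype.lTensor k) :=
          Module.Flat.lTensor_preserves_injective_linearMap _ hι
        refine LinearMap.ext fun x => hinj ?_
        have e : ∀ t, S.subtype.lTensor k ((Coalgebra.counit (R := k) ∘ₗ S.subtype).rTensor S t) =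
            (Coalgebra.counit (R := k)).rTensor C.carrier
              (TensorProduct.map S.subtype S.subtype t) := by
          intro t
          simp only [LinearMap.lTensor, LinearMap.rTensor, ← LinearMap.comp_apply,
            ← TensorProduct.map_comp, LinearMap.comp_id, LinearMap.id_comp]
        simp only [LinearMap.comp_apply, e, hc]
        simp
      lTensor_counit_comp_comul := by
        have hinj : Function.Injective (S.subtype.rTensor k) :=
          Module.Flat.rTensor_preserves_injective_linearMap _ hι
        refine LinearMap.ext fun x => hinj ?_
        have e : ∀ t, S.subtype.rTensor k ((Coalgebra.counit (R := k) ∘ₗ S.subtype).lTensor S t) =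
            (Coalgebra.counit (R := k)).lTensor C.carrier
              (TensorProduct.map S.subtype S.subtype t) := by
          intro t
          simp only [LinearMap.lTensor, LinearMap.rTensor, ← LinearMap.comp_apply,
            ← TensorProduct.map_comp, LinearMap.comp_id, LinearMap.id_comp]
        simp only [LinearMap.comp_apply, e, hc]
        simp }
  { carrier := S
    deg := subDeg C.deg S
    comul_mem := fun n x hx => mem_tensDeg_of_map _ hd hι (by
      have := C.comul_mem n x hx
      rwa [← hc] at this)
    counit_eq_zero := fun n hn x hx => C.counit_eq_zero n hn _ hx }

/-- The graded Lie coalgebra structure on a graded Lie subcoalgebra. -/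
def GrLieCoalg.sub (G : GrLieCoalg k) (S : Submodule k G.carrier)
    (hS : IsGrSub G.deg G.cobr S) : GrLieCoalg k :=
  have hι : Function.Injective S.subtype := S.injective_subtype
  letI : DirectSum.Decomposition (subDeg G.deg S) :=
    (subDeg_isInternal G.deg hS.homogeneous).chooseDecomposition
  have hd : ∀ i, ∀ x ∈ subDeg G.deg S i, S.subtype x ∈ G.deg i := fun _ _ hx => hx
  have hc := map_subMap hS.map_mem
  { carrier := S
    deg := subDeg G.deg S
    cobr := subMap hS.map_mem
    cobr_mem := fun n x hx => mem_tensDeg_of_map _ hd hι (by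
      have := G.cobr_mem n x hx
      rwa [← hc] at this)
    gswap_cobr := by
      refine LinearMap.ext fun x => map_subtype_injective S ?_
      have h := LinearMap.congr_fun (gswap_map (subDeg G.deg S) hd) (subMap hS.map_mem x)
      simp only [LinearMap.comp_apply] at h
      rw [LinearMap.comp_apply, ← h, hc, LinearMap.neg_apply, map_neg, hc]
      exact LinearMap.congr_fun G.gswap_cobr x
    coJacobi := by
      have hinj : Function.Injective
          (TensorProduct.map (TensorProduct.map S.subtype S.subtype) S.subtype) :=
        TensorProduct.map_injective_of_flat_flat _ _ (map_subtype_injective S) hι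
      refine LinearMap.ext fun x => hinj ?_
      rw [← coJacobiator_map (subDeg G.deg S) hd (fun x => (hc x).symm), G.coJacobi]
      simp }

/-- The inclusion of a graded subcoalgebra. -/
def GrCoalg.incl (C : GrCoalg k) (S : Submodule k C.carrier)
    (hS : IsGrSub C.deg Coalgebra.comul S) : C.sub S hS ⟶ C :=
  GrCoalg.Hom.mk (C := C.sub S hS)
    { toLinearMap := S.subtype
      counit_comp := rfl
      map_comp_comul := LinearMap.ext (map_subMap hS.map_mem) }
    (fun _ _ hx => hx)

/-- The inclusion of a graded Lie subcoalgebra. -/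
def GrLieCoalg.incl (G : GrLieCoalg k) (S : Submodule k G.carrier)
    (hS : IsGrSub G.deg G.cobr S) : G.sub S hS ⟶ G :=
  GrLieCoalg.Hom.mk (G := G.sub S hS) S.subtype (fun _ _ hx => hx)
    (fun x => (map_subMap hS.map_mem x).symm)

/-- A morphism of graded coalgebras restricted to graded subcoalgebras. -/
def GrCoalg.subHom {C D : GrCoalg k} (f : C ⟶ D) {S : Submodule k C.carrier}
    {T : Submodule k D.carrier} (hS : IsGrSub C.deg Coalgebra.comul S)
    (hT : IsGrSub D.deg Coalgebra.comul T) (h : ∀ x ∈ S, f.toCoalgHom x ∈ T) :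
    C.sub S hS ⟶ D.sub T hT :=
  GrCoalg.Hom.mk (C := C.sub S hS) (D := D.sub T hT)
    { toLinearMap := f.toCoalgHom.toLinearMap.restrict h
      counit_comp := LinearMap.ext fun (x : S) =>
        LinearMap.congr_fun f.toCoalgHom.counit_comp (x : C.carrier)
      map_comp_comul := LinearMap.ext fun (x : S) => map_subtype_injective T (by
        have e : ∀ t : S ⊗[k] S, TensorProduct.map T.subtype T.subtype (TensorProduct.map
            (f.toCoalgHom.toLinearMap.restrict h) (f.toCoalgHom.toLinearMap.restrict h) t) =
            TensorProduct.map f.toCoalgHom.toLinearMap f.toCoalgHom.toLinearMap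
              (TensorProduct.map S.subtype S.subtype t) := by
          intro t
          simp only [← LinearMap.comp_apply, ← TensorProduct.map_comp]
          rfl
        refine (e _).trans ?_
        refine ((congrArg _ (map_subMap hS.map_mem x)).trans ?_).trans
          (map_subMap hT.map_mem _).symm
        exact (GrCoalg.map_comul f _).symm) }
    (fun n (x : S) hx => f.map_deg n x hx)

/-- A morphism of graded Lie coalgebras restricted to graded Lie subcoalgebras. -/
def GrLieCoalg.subHom {G H : GrLieCoalg k} (f : G ⟶ H) {S : Submodule k G.carrier}
    {T : Submodule k H.carrier} (hS : IsGrSub G.deg G.cobr S)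
    (hT : IsGrSub H.deg H.cobr T) (h : ∀ x ∈ S, f.toLinearMap x ∈ T) :
    G.sub S hS ⟶ H.sub T hT :=
  GrLieCoalg.Hom.mk (G := G.sub S hS) (H := H.sub T hT) (f.toLinearMap.restrict h)
    (fun n (x : S) hx => f.map_deg n x hx)
    (fun (x : S) => map_subtype_injective T (by
      have e : ∀ t : S ⊗[k] S, TensorProduct.map T.subtype T.subtype (TensorProduct.map
          (f.toLinearMap.restrict h) (f.toLinearMap.restrict h) t) =
          TensorProduct.map f.toLinearMap f.toLinearMap
            (TensorProduct.map S.subtype S.subtype t) := by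
        intro t
        simp only [← LinearMap.comp_apply, ← TensorProduct.map_comp]
        rfl
      refine (map_subMap hT.map_mem _).trans ?_
      refine Eq.trans ?_ (e _).symm
      exact (f.map_cobr _).trans (congrArg _ (map_subMap hS.map_mem x).symm)))

end Functors


/-! ### The cofree coalgebra and the cofree Lie coalgebra on `sV` -/

section Cofree

variable {k : Type u} [Field k] {V W : Type u} [AddCommGroup V] [Module k V]
  [AddCommGroup W] [Module k W]

open TensorAlgebra (ι)

/-- The word `v₁ ⊗ ⋯ ⊗ vₙ`. -/
def word (k : Type u) [Field k] {V : Type u} [AddCommGroup V] [Module k V] (l : List V) :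
    TensorAlgebra k V := (l.map (ι k)).prod

@[simp] lemma word_nil : word k ([] : List V) = 1 := rfl

@[simp] lemma word_cons (v : V) (l : List V) : word k (v :: l) = ι k v * word k l := by
  simp [word]

/-- Left multiplication by the letter `v`. -/
def letter (k : Type u) [Field k] {V : Type u} [AddCommGroup V] [Module k V] (v : V) :
    TensorAlgebra k V →ₗ[k] TensorAlgebra k V := LinearMap.mulLeft k (ι k v)

@[simp] lemma letter_apply (v : V) (x : TensorAlgebra k V) : letter k v x = ι k v * x := rfl

lemma span_word : Submodule.span k (Set.range (word k (V := V))) = ⊤ := by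
  rw [eq_top_iff]
  intro x _
  have key : ∀ (y : TensorAlgebra k V), ∀ z ∈ Submodule.span k (Set.range (word k (V := V))),
      y * z ∈ Submodule.span k (Set.range (word k (V := V))) := by
    intro y
    induction y using TensorAlgebra.induction with
    | algebraMap r =>
      intro z hz
      rw [← Algebra.smul_def]
      exact Submodule.smul_mem _ _ hz
    | ι v =>
      intro z hz
      have : Submodule.span k (Set.range (word k (V := V))) ≤
          (Submodule.span k (Set.range (word k (V := V)))).comap (letter k v) := by
        rw [Submodule.span_le]
        rintro _ ⟨l, rfl⟩
        exact Submodule.subset_span ⟨v :: l, by simp⟩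
      exact this hz
    | mul a b ha hb =>
      intro z hz
      rw [mul_assoc]
      exact ha _ (hb _ hz)
    | add a b ha hb =>
      intro z hz
      rw [add_mul]
      exact Submodule.add_mem _ (ha _ hz) (hb _ hz)
  have := key x 1 (Submodule.subset_span ⟨[], rfl⟩)
  rwa [mul_one] at this

lemma ext_word {P : Type u} [AddCommGroup P] [Module k P] {f g : TensorAlgebra k V →ₗ[k] P}
    (h : ∀ l : List V, f (word k l) = g (word k l)) : f = g := by
  refine LinearMap.ext fun x => ?_
  have hx : x ∈ Submodule.span k (Set.range (word k (V := V))) := by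
    rw [span_word]; trivial
  exact LinearMap.eqOn_span (s := Set.range (word k (V := V)))
    (by rintro _ ⟨l, rfl⟩; exact h l) hx

/-- The grading of `T^c(sV)`, for `V` concentrated in degree `0`: the suspension puts every letter
in degree `1`, so that a word of length `n` has degree `n`. -/
def tdeg (k : Type u) [Field k] (V : Type u) [AddCommGroup V] [Module k V] (n : ℤ) :
    Submodule k (TensorAlgebra k V) :=
  Submodule.span k {x | ∃ l : List V, (l.length : ℤ) = n ∧ word k l = x}

lemma word_mem (l : List V) : word k l ∈ tdeg k V l.length :=
  Submodule.subset_span ⟨l, rfl, rfl⟩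

lemma letter_mem (v : V) {n : ℤ} {x : TensorAlgebra k V} (hx : x ∈ tdeg k V n) :
    letter k v x ∈ tdeg k V (n + 1) := by
  have : tdeg k V n ≤ (tdeg k V (n + 1)).comap (letter k v) := by
    refine Submodule.span_le.2 ?_
    rintro _ ⟨l, hl, rfl⟩
    exact Submodule.subset_span ⟨v :: l, by simp [hl], by simp⟩
  exact this hx

lemma word_mem_pow (l : List V) :
    word k l ∈ LinearMap.range (ι k : V →ₗ[k] TensorAlgebra k V) ^ l.length := by
  induction l with
  | nil => simp
  | cons v l ih =>
    rw [word_cons, List.length_cons, pow_succ']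
    exact Submodule.mul_mem_mul ⟨v, rfl⟩ ih

lemma tdeg_isInternal : DirectSum.IsInternal (tdeg k V) := by
  let 𝒢 : ℕ → Submodule k (TensorAlgebra k V) :=
    (LinearMap.range (ι k : V →ₗ[k] TensorAlgebra k V) ^ ·)
  let p : ℕ → TensorAlgebra k V →ₗ[k] TensorAlgebra k V := fun n =>
    (𝒢 n).subtype ∘ₗ DirectSum.component k ℕ (fun i => 𝒢 i) n ∘ₗ
      (DirectSum.decomposeLinearEquiv 𝒢).toLinearMap
  refine isInternal_of_proj _ (fun n => if 0 ≤ n then p n.toNat else 0) ?_ ?_ ?_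
  · intro n x hx
    refine LinearMap.eqOn_span (g := LinearMap.id) ?_ hx
    rintro _ ⟨l, hl, rfl⟩
    have h0 : 0 ≤ n := by omega
    have h1 : n.toNat = l.length := by omega
    simp only [h0, if_true, h1]
    exact DirectSum.decompose_of_mem_same 𝒢 (word_mem_pow l)
  · intro m n hmn x hx
    refine LinearMap.eqOn_span (g := 0) ?_ hx
    rintro _ ⟨l, hl, rfl⟩
    split_ifs with h0
    · exact DirectSum.decompose_of_mem_ne 𝒢 (word_mem_pow l) (by omega)
    · rfl
  · intro x
    have hx : x ∈ Submodule.span k (Set.range (word k (V := V))) := by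
      rw [span_word]; trivial
    refine (Submodule.span_le.2 ?_) hx
    rintro _ ⟨l, rfl⟩
    exact Submodule.mem_iSup_of_mem _ (word_mem l)

instance tdegDecomposition : DirectSum.Decomposition (tdeg k V) :=
  tdeg_isInternal.chooseDecomposition

/-- Auxiliary representation of the tensor algebra that computes deconcatenation recursively. -/
def deconcatAux (k : Type u) [Field k] (V : Type u) [AddCommGroup V] [Module k V] :
    TensorAlgebra k V →ₐ[k] Module.End k
      (TensorAlgebra k V × (TensorAlgebra k V ⊗[k] TensorAlgebra k V)) :=
  TensorAlgebra.lift k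
    { toFun := fun v => LinearMap.prod (letter k v ∘ₗ LinearMap.fst k _ _)
        (TensorProduct.mk k _ _ 1 ∘ₗ letter k v ∘ₗ LinearMap.fst k _ _ +
          (letter k v).rTensor _ ∘ₗ LinearMap.snd k _ _)
      map_add' := fun v w => by
        have h : letter k (v + w) = letter k v + letter k w := by ext; simp [add_mul]
        refine LinearMap.ext fun x => Prod.ext ?_ ?_
        · simp [h]
        · simp only [h, LinearMap.prod_apply, Function.prod, LinearMap.add_apply,
            LinearMap.comp_apply, LinearMap.rTensor_add, map_add, Prod.snd_add]
          abel
      map_smul' := fun c v => by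
        have h : letter k (c • v) = c • letter k v := by ext; simp
        refine LinearMap.ext fun x => Prod.ext ?_ ?_
        · simp [h]
        · simp [h, LinearMap.rTensor_smul, smul_add] }

/-- Deconcatenation `Δ(v₁ ⊗ ⋯ ⊗ vₙ) = ∑ᵢ (v₁ ⊗ ⋯ ⊗ vᵢ) ⊗ (vᵢ₊₁ ⊗ ⋯ ⊗ vₙ)`. -/
def deconcat (k : Type u) [Field k] (V : Type u) [AddCommGroup V] [Module k V] :
    TensorAlgebra k V →ₗ[k] TensorAlgebra k V ⊗[k] TensorAlgebra k V :=
  LinearMap.snd k _ _ ∘ₗ LinearMap.applyₗ (1, 1 ⊗ₜ 1) ∘ₗ (deconcatAux k V).toLinearMap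

lemma deconcatAux_ι (v : V) (p : TensorAlgebra k V × (TensorAlgebra k V ⊗[k] TensorAlgebra k V)) :
    deconcatAux k V (ι k v) p =
      (ι k v * p.1, 1 ⊗ₜ (ι k v * p.1) + (letter k v).rTensor _ p.2) := by
  rw [deconcatAux, TensorAlgebra.lift_ι_apply]
  rfl

lemma deconcatAux_fst (x : TensorAlgebra k V) : (deconcatAux k V x (1, 1 ⊗ₜ 1)).1 = x := by
  have : LinearMap.fst k _ _ ∘ₗ LinearMap.applyₗ (1, 1 ⊗ₜ 1) ∘ₗ (deconcatAux k V).toLinearMap =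
      LinearMap.id := by
    refine ext_word fun l => ?_
    induction l with
    | nil => simp
    | cons v l ih =>
      simp only [LinearMap.comp_apply, LinearMap.applyₗ_apply_apply, AlgHom.toLinearMap_apply,
        LinearMap.fst_apply, LinearMap.id_apply] at ih ⊢
      rw [word_cons, map_mul, Module.End.mul_apply, deconcatAux_ι, ih]
  exact LinearMap.congr_fun this x

@[simp] lemma deconcat_one : deconcat k V 1 = 1 ⊗ₜ 1 := by simp [deconcat]

@[simp] lemma deconcat_ι_mul (v : V) (x : TensorAlgebra k V) :
    deconcat k V (ι k v * x) = 1 ⊗ₜ (ι k v * x) + (letter k v).rTensor _ (deconcat k V x) := by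
  simp only [deconcat, LinearMap.comp_apply, LinearMap.applyₗ_apply_apply,
    AlgHom.toLinearMap_apply, LinearMap.snd_apply, map_mul, Module.End.mul_apply, deconcatAux_ι,
    deconcatAux_fst]

/-- Deconcatenation of a word, in closed form. -/
lemma deconcat_word (l : List V) : deconcat k V (word k l) =
    ∑ i ∈ Finset.range (l.length + 1), word k (l.take i) ⊗ₜ[k] word k (l.drop i) := by
  induction l with
  | nil => simp
  | cons v l ih =>
    rw [word_cons, deconcat_ι_mul, ih, List.length_cons,
      Finset.sum_range_succ' _ (l.length + 1), add_comm, map_sum]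
    simp

lemma rTensor_letter_mem (v : V) {n : ℤ} {t : TensorAlgebra k V ⊗[k] TensorAlgebra k V}
    (ht : t ∈ tensDeg (tdeg k V) (tdeg k V) n) :
    (letter k v).rTensor _ t ∈ tensDeg (tdeg k V) (tdeg k V) (n + 1) := by
  have : tensDeg (tdeg k V) (tdeg k V) n ≤
      (tensDeg (tdeg k V) (tdeg k V) (n + 1)).comap ((letter k v).rTensor _) :=
    tensDeg_le fun i j x y hx hy h =>
      tmul_mem_tensDeg (letter_mem v hx) hy (by omega)
  exact this ht

lemma deconcat_mem (n : ℤ) (x : TensorAlgebra k V) (hx : x ∈ tdeg k V n) :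
    deconcat k V x ∈ tensDeg (tdeg k V) (tdeg k V) n := by
  have : tdeg k V n ≤ (tensDeg (tdeg k V) (tdeg k V) n).comap (deconcat k V) := by
    refine Submodule.span_le.2 ?_
    rintro _ ⟨l, rfl, rfl⟩
    change deconcat k V (word k l) ∈ tensDeg (tdeg k V) (tdeg k V) l.length
    rw [deconcat_word]
    refine Submodule.sum_mem _ fun i hi => tmul_mem_tensDeg (word_mem _) (word_mem _) ?_
    rw [Finset.mem_range] at hi
    rw [List.length_take, List.length_drop]
    omega
  exact this hx

lemma counit_letter (v : V) (x : TensorAlgebra k V) :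
    TensorAlgebra.algebraMapInv (ι k v * x) = (0 : k) := by
  simp [TensorAlgebra.algebraMapInv]

/-- The cofree (conilpotent) coalgebra `T^c(sV)`: the tensor coalgebra with deconcatenation. -/
def tensorCoalg (k : Type u) [Field k] (V : Type u) [AddCommGroup V] [Module k V] : GrCoalg k :=
  letI : Coalgebra k (TensorAlgebra k V) :=
    { comul := deconcat k V
      counit := TensorAlgebra.algebraMapInv.toLinearMap
      coassoc := by
        refine ext_word fun l => ?_
        induction l with
        | nil => simp
        | cons v l ih =>
          simp only [LinearMap.comp_apply, LinearEquiv.coe_coe] at ih ⊢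
          have e1 : ∀ t : TensorAlgebra k V ⊗[k] TensorAlgebra k V,
              TensorProduct.assoc k _ _ _ ((deconcat k V).rTensor _
              ((letter k v).rTensor _ t)) = 1 ⊗ₜ ((letter k v).rTensor _ t) +
              (letter k v).rTensor _ (TensorProduct.assoc k _ _ _
                ((deconcat k V).rTensor _ t)) := by
            intro t
            induction t using TensorProduct.induction_on with
            | zero => simp
            | tmul a b =>
              simp only [LinearMap.rTensor_tmul, letter_apply, deconcat_ι_mul,
                TensorProduct.add_tmul, map_add, TensorProduct.assoc_tmul, add_right_inj]
              generalize deconcat k V a = s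
              induction s using TensorProduct.induction_on with
              | zero => simp
              | tmul c d => simp
              | add c d hc hd => simp only [map_add, TensorProduct.add_tmul, hc, hd]
            | add a b ha hb =>
              simp only [map_add, ha, hb, TensorProduct.tmul_add]
              abel
          have e2 : ∀ t : TensorAlgebra k V ⊗[k] TensorAlgebra k V, (deconcat k V).lTensor _ ((letter k v).rTensor _ t) =
              (letter k v).rTensor _ ((deconcat k V).lTensor _ t) := by
            intro t
            simp only [LinearMap.lTensor, LinearMap.rTensor, ← LinearMap.comp_apply,
              ← TensorProduct.map_comp, LinearMap.comp_id, LinearMap.id_comp]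
          rw [word_cons, deconcat_ι_mul, map_add, map_add, map_add, e1, e2, ih]
          simp only [LinearMap.rTensor_tmul, LinearMap.lTensor_tmul, deconcat_one,
            deconcat_ι_mul, TensorProduct.assoc_tmul, TensorProduct.tmul_add]
          abel
      rTensor_counit_comp_comul := by
        refine ext_word fun l => ?_
        cases l with
        | nil => simp
        | cons v l =>
          have e : ∀ t : TensorAlgebra k V ⊗[k] TensorAlgebra k V,
              (TensorAlgebra.algebraMapInv.toLinearMap : TensorAlgebra k V →ₗ[k] k).rTensor _
                ((letter k v).rTensor _ t) = 0 := by
            intro t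
            have h0 : (TensorAlgebra.algebraMapInv.toLinearMap : TensorAlgebra k V →ₗ[k] k) ∘ₗ
                letter k v = 0 := LinearMap.ext fun x => counit_letter v x
            rw [← LinearMap.rTensor_comp_apply, h0]
            simp
          simp [e]
      lTensor_counit_comp_comul := by
        refine ext_word fun l => ?_
        induction l with
        | nil => simp
        | cons v l ih =>
          simp only [LinearMap.comp_apply] at ih ⊢
          have e2 : ∀ t : TensorAlgebra k V ⊗[k] TensorAlgebra k V, (TensorAlgebra.algebraMapInv.toLinearMap :
              TensorAlgebra k V →ₗ[k] k).lTensor _ ((letter k v).rTensor _ t) =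
              (letter k v).rTensor _ ((TensorAlgebra.algebraMapInv.toLinearMap :
              TensorAlgebra k V →ₗ[k] k).lTensor _ t) := by
            intro t
            simp only [LinearMap.lTensor, LinearMap.rTensor, ← LinearMap.comp_apply,
              ← TensorProduct.map_comp, LinearMap.comp_id, LinearMap.id_comp]
          rw [word_cons, deconcat_ι_mul, map_add, e2, ih]
          simp [counit_letter] }
  { carrier := TensorAlgebra k V
    deg := tdeg k V
    comul_mem := deconcat_mem
    counit_eq_zero := fun n hn x hx => by
      refine LinearMap.eqOn_span (g := (0 : TensorAlgebra k V →ₗ[k] k)) ?_ hx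
      rintro _ ⟨l, hl, rfl⟩
      cases l with
      | nil => simp at hl; omega
      | cons v l => exact (congrArg _ (word_cons v l)).trans (counit_letter v _) }

end Cofree


section Quotient

variable {k : Type u} [Field k]

/-- The grading induced on a quotient space. -/
def quotDeg {M : Type u} [AddCommGroup M] [Module k M] (𝒜 : ℤ → Submodule k M)
    (N : Submodule k M) (n : ℤ) : Submodule k (M ⧸ N) := (𝒜 n).map N.mkQ

lemma quotDeg_isInternal {M : Type u} [AddCommGroup M] [Module k M] (𝒜 : ℤ → Submodule k M)
    [DirectSum.Decomposition 𝒜] {N : Submodule k M} (hN : ∀ n, ∀ x ∈ N, gproj 𝒜 n x ∈ N) :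
    DirectSum.IsInternal (quotDeg 𝒜 N) := by
  refine isInternal_of_proj _ (fun n => N.mapQ N (gproj 𝒜 n) (hN n)) ?_ ?_ ?_
  · rintro i _ ⟨x, hx, rfl⟩
    simp [gproj_same 𝒜 hx]
  · rintro i j hij _ ⟨x, hx, rfl⟩
    simp [gproj_ne 𝒜 hx hij.symm]
  · intro x
    obtain ⟨x, rfl⟩ := N.mkQ_surjective x
    have : x ∈ (⨆ i, quotDeg 𝒜 N i).comap N.mkQ :=
      mem_of_gproj_mem 𝒜 fun n => Submodule.mem_iSup_of_mem n ⟨_, gproj_mem 𝒜 n x, rfl⟩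
    exact this

/-- The quotient of a graded Lie coalgebra by a graded Lie coideal. -/
def GrLieCoalg.quot (G : GrLieCoalg k) (N : Submodule k G.carrier)
    (hN : ∀ n, ∀ x ∈ N, gproj G.deg n x ∈ N)
    (hc : ∀ x ∈ N, TensorProduct.map N.mkQ N.mkQ (G.cobr x) = 0) : GrLieCoalg k :=
  letI : DirectSum.Decomposition (quotDeg G.deg N) :=
    (quotDeg_isInternal G.deg hN).chooseDecomposition
  have hd : ∀ i, ∀ x ∈ G.deg i, N.mkQ x ∈ quotDeg G.deg N i := fun i x hx => ⟨x, hx, rfl⟩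
  { carrier := G.carrier ⧸ N
    deg := quotDeg G.deg N
    cobr := N.liftQ (TensorProduct.map N.mkQ N.mkQ ∘ₗ G.cobr) hc
    cobr_mem := by
      rintro n _ ⟨x, hx, rfl⟩
      exact map_mem_tensDeg hd hd (G.cobr_mem n x hx)
    gswap_cobr := by
      refine LinearMap.ext fun x => ?_
      obtain ⟨x, rfl⟩ := N.mkQ_surjective x
      have h := LinearMap.congr_fun (gswap_map G.deg hd) (G.cobr x)
      have h' := LinearMap.congr_fun G.gswap_cobr x
      simp only [LinearMap.comp_apply] at h h'
      rw [h', LinearMap.neg_apply, map_neg] at h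
      exact h
    coJacobi := by
      refine LinearMap.ext fun x => ?_
      obtain ⟨x, rfl⟩ := N.mkQ_surjective x
      refine (coJacobiator_map G.deg hd (fun x => rfl) x).trans ?_
      rw [G.coJacobi]
      simp }

/-- The projection of a graded Lie coalgebra onto a quotient. -/
def GrLieCoalg.proj (G : GrLieCoalg k) (N : Submodule k G.carrier)
    (hN : ∀ n, ∀ x ∈ N, gproj G.deg n x ∈ N)
    (hc : ∀ x ∈ N, TensorProduct.map N.mkQ N.mkQ (G.cobr x) = 0) : G ⟶ G.quot N hN hc :=
  GrLieCoalg.Hom.mk (H := G.quot N hN hc) N.mkQ (fun _ x hx => ⟨x, hx, rfl⟩) (fun _ => rfl)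

/-- The morphism induced on quotients. -/
def GrLieCoalg.quotHom {G H : GrLieCoalg k} (f : G ⟶ H) {N : Submodule k G.carrier}
    {N' : Submodule k H.carrier} (hN : ∀ n, ∀ x ∈ N, gproj G.deg n x ∈ N)
    (hc : ∀ x ∈ N, TensorProduct.map N.mkQ N.mkQ (G.cobr x) = 0)
    (hN' : ∀ n, ∀ x ∈ N', gproj H.deg n x ∈ N')
    (hc' : ∀ x ∈ N', TensorProduct.map N'.mkQ N'.mkQ (H.cobr x) = 0)
    (h : N ≤ N'.comap f.toLinearMap) : G.quot N hN hc ⟶ H.quot N' hN' hc' :=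
  GrLieCoalg.Hom.mk (G := G.quot N hN hc) (H := H.quot N' hN' hc') (N.mapQ N' f.toLinearMap h)
    (by
      rintro n _ ⟨x, hx, rfl⟩
      exact ⟨f.toLinearMap x, f.map_deg n x hx, rfl⟩)
    (by
      intro x
      obtain ⟨x, rfl⟩ := N.mkQ_surjective x
      have e : ∀ t, TensorProduct.map (N.mapQ N' f.toLinearMap h) (N.mapQ N' f.toLinearMap h)
          (TensorProduct.map N.mkQ N.mkQ t) = TensorProduct.map N'.mkQ N'.mkQ
            (TensorProduct.map f.toLinearMap f.toLinearMap t) := by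
        intro t
        simp only [← LinearMap.comp_apply, ← TensorProduct.map_comp]
        rfl
      refine Eq.trans ?_ (e _).symm
      exact congrArg (TensorProduct.map N'.mkQ N'.mkQ) (f.map_cobr x))

end Quotient

section CofreeLie

variable {k : Type u} [Field k] {V W : Type u} [AddCommGroup V] [Module k V]
  [AddCommGroup W] [Module k W]

open TensorAlgebra (ι)

/-- The algebra homomorphism `T(V) → T(W)` induced by a linear map. -/
def tmap (f : V →ₗ[k] W) : TensorAlgebra k V →ₐ[k] TensorAlgebra k W :=
  TensorAlgebra.lift k (ι k ∘ₗ f)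

@[simp] lemma tmap_ι (f : V →ₗ[k] W) (v : V) : tmap f (ι k v) = ι k (f v) := by simp [tmap]

@[simp] lemma tmap_word (f : V →ₗ[k] W) (l : List V) :
    tmap f (word k l) = word k (l.map f) := by
  induction l with
  | nil => simp
  | cons v l ih => simp [ih]

lemma tmap_mem (f : V →ₗ[k] W) (n : ℤ) (x : TensorAlgebra k V) (hx : x ∈ tdeg k V n) :
    tmap f x ∈ tdeg k W n := by
  have : tdeg k V n ≤ (tdeg k W n).comap (tmap f).toLinearMap := by
    refine Submodule.span_le.2 ?_
    rintro _ ⟨l, hl, rfl⟩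
    refine Submodule.subset_span ⟨l.map f, by simpa using hl, ?_⟩
    simp
  exact this hx

lemma tmap_deconcat (f : V →ₗ[k] W) (x : TensorAlgebra k V) :
    TensorProduct.map (tmap f).toLinearMap (tmap f).toLinearMap (deconcat k V x) =
      deconcat k W (tmap f x) := by
  have : TensorProduct.map (tmap f).toLinearMap (tmap f).toLinearMap ∘ₗ deconcat k V =
      deconcat k W ∘ₗ (tmap f).toLinearMap := by
    refine ext_word fun l => ?_
    simp only [LinearMap.comp_apply, AlgHom.toLinearMap_apply, tmap_word, deconcat_word,
      map_sum, TensorProduct.map_tmul, List.length_map, List.map_take, List.map_drop]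
  exact LinearMap.congr_fun this x

lemma tmap_counit (f : V →ₗ[k] W) (x : TensorAlgebra k V) :
    TensorAlgebra.algebraMapInv (tmap f x) = (TensorAlgebra.algebraMapInv x : k) := by
  have : (TensorAlgebra.algebraMapInv : TensorAlgebra k W →ₐ[k] k).toLinearMap ∘ₗ
      (tmap f).toLinearMap = TensorAlgebra.algebraMapInv.toLinearMap := by
    refine ext_word fun l => ?_
    cases l with
    | nil => simp
    | cons v l => simp [counit_letter]
  exact LinearMap.congr_fun this x

/-- The morphism `T^c(sV) ⟶ T^c(sW)` induced by a linear map. -/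
def tensorCoalgMap (f : V →ₗ[k] W) : tensorCoalg k V ⟶ tensorCoalg k W :=
  GrCoalg.Hom.mk (C := tensorCoalg k V) (D := tensorCoalg k W)
    { toLinearMap := (tmap f).toLinearMap
      counit_comp := LinearMap.ext (tmap_counit f)
      map_comp_comul := LinearMap.ext (tmap_deconcat f) }
    (tmap_mem f)

/-- The signed shuffle product of two words whose letters have degree `1`. -/
def shuffle (k : Type u) [Field k] {V : Type u} [AddCommGroup V] [Module k V] :
    List V → List V → TensorAlgebra k V
  | [], v => word k v
  | a :: u, [] => word k (a :: u)
  | a :: u, b :: v => ι k a * shuffle k u (b :: v) +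
      (-1 : k) ^ (u.length + 1) • (ι k b * shuffle k (a :: u) v)
  termination_by u v => u.length + v.length

@[simp] lemma shuffle_nil_left (v : List V) : shuffle k [] v = word k v := by simp [shuffle]

@[simp] lemma shuffle_nil_right (u : List V) : shuffle k u [] = word k u := by
  cases u <;> simp [shuffle]

lemma shuffle_cons (a b : V) (u v : List V) : shuffle k (a :: u) (b :: v) =
    ι k a * shuffle k u (b :: v) + (-1 : k) ^ (u.length + 1) • (ι k b * shuffle k (a :: u) v) := by
  rw [shuffle]

/-- The span of the unit and of all products of two nonempty words under the signed shuffle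
product. -/
def decomposables (k : Type u) [Field k] (V : Type u) [AddCommGroup V] [Module k V] :
    Submodule k (TensorAlgebra k V) :=
  Submodule.span k ({1} ∪ {x | ∃ u v : List V, u ≠ [] ∧ v ≠ [] ∧ shuffle k u v = x})

lemma one_mem_decomposables : (1 : TensorAlgebra k V) ∈ decomposables k V :=
  Submodule.subset_span (Or.inl rfl)

lemma shuffle_mem_decomposables {u v : List V} (hu : u ≠ []) (hv : v ≠ []) :
    shuffle k u v ∈ decomposables k V :=
  Submodule.subset_span (Or.inr ⟨u, v, hu, hv, rfl⟩)

lemma shuffle_mem (u v : List V) : shuffle k u v ∈ tdeg k V (u.length + v.length) := by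
  induction u, v using shuffle.induct with
  | case1 v => simpa using word_mem v
  | case2 a u => simpa using word_mem (a :: u)
  | case3 a u b v h1 h2 =>
    rw [shuffle_cons]
    refine Submodule.add_mem _ ?_ (Submodule.smul_mem _ _ ?_)
    · rw [← letter_apply]
      convert letter_mem a h1 using 2
      simp; ring
    · rw [← letter_apply]
      convert letter_mem b h2 using 2
      simp; ring

lemma decomposables_homogeneous (n : ℤ) :
    ∀ x ∈ decomposables k V, gproj (tdeg k V) n x ∈ decomposables k V := by
  have key : ∀ m, ∀ x ∈ tdeg k V m, x ∈ decomposables k V →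
      gproj (tdeg k V) n x ∈ decomposables k V := by
    intro m x hx hx'
    by_cases h : m = n
    · subst h
      rwa [gproj_same _ hx]
    · rw [gproj_ne _ hx h]
      exact Submodule.zero_mem _
  have : decomposables k V ≤ (decomposables k V).comap (gproj (tdeg k V) n) := by
    refine Submodule.span_le.2 ?_
    rintro _ (rfl | ⟨u, v, hu, hv, rfl⟩)
    · exact key 0 _ (word_mem ([] : List V)) one_mem_decomposables
    · exact key _ _ (shuffle_mem u v) (shuffle_mem_decomposables hu hv)
  exact fun x hx => this hx

/-- Deconcatenation of a shuffle, with the right-hand factor taken modulo decomposables. -/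
lemma deconcat_shuffle (u v : List V) :
    (decomposables k V).mkQ.lTensor _ (deconcat k V (shuffle k u v)) =
      (∑ i ∈ Finset.range u.length, (-1 : k) ^ ((u.length - i) * v.length) •
        (shuffle k (u.take i) v ⊗ₜ[k] (decomposables k V).mkQ (word k (u.drop i)))) +
      ∑ j ∈ Finset.range v.length,
        shuffle k u (v.take j) ⊗ₜ[k] (decomposables k V).mkQ (word k (v.drop j)) := by
  have h1 : (decomposables k V).mkQ 1 = 0 := by
    simpa using one_mem_decomposables (k := k) (V := V)
  have hw : ∀ w : List V, (decomposables k V).mkQ.lTensor _ (deconcat k V (word k w)) =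
      ∑ j ∈ Finset.range w.length,
        word k (w.take j) ⊗ₜ[k] (decomposables k V).mkQ (word k (w.drop j)) := by
    intro w
    rw [deconcat_word, map_sum, Finset.sum_range_succ]
    simp only [LinearMap.lTensor_tmul, List.drop_length, word_nil, h1, TensorProduct.tmul_zero,
      add_zero]
  induction u, v using shuffle.induct with
  | case1 v => simpa using hw v
  | case2 a u => simpa using hw (a :: u)
  | case3 a u b v ih1 ih2 =>
    have hl : ∀ (c : V) (t : TensorAlgebra k V ⊗[k] TensorAlgebra k V),
        (decomposables k V).mkQ.lTensor _ ((letter k c).rTensor _ t) =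
          (letter k c).rTensor _ ((decomposables k V).mkQ.lTensor _ t) := by
      intro c t
      simp only [LinearMap.lTensor, LinearMap.rTensor, ← LinearMap.comp_apply,
        ← TensorProduct.map_comp, LinearMap.comp_id, LinearMap.id_comp]
    have h0 : (decomposables k V).mkQ (shuffle k (a :: u) (b :: v)) = 0 := by
      simpa using shuffle_mem_decomposables (k := k) (List.cons_ne_nil a u) (List.cons_ne_nil b v)
    have e : (decomposables k V).mkQ.lTensor _ (deconcat k V (shuffle k (a :: u) (b :: v))) =
        (letter k a).rTensor _
          ((decomposables k V).mkQ.lTensor _ (deconcat k V (shuffle k u (b :: v)))) +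
        (-1 : k) ^ (u.length + 1) • (letter k b).rTensor _
          ((decomposables k V).mkQ.lTensor _ (deconcat k V (shuffle k (a :: u) v))) := by
      have : deconcat k V (shuffle k (a :: u) (b :: v)) =
          1 ⊗ₜ shuffle k (a :: u) (b :: v) +
          (letter k a).rTensor _ (deconcat k V (shuffle k u (b :: v))) +
          (-1 : k) ^ (u.length + 1) •
            (letter k b).rTensor _ (deconcat k V (shuffle k (a :: u) v)) := by
        rw [shuffle_cons]
        simp only [map_add, map_smul, deconcat_ι_mul, TensorProduct.tmul_add,
          TensorProduct.tmul_smul, smul_add]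
        abel
      rw [this, map_add, map_add, map_smul, hl, hl, LinearMap.lTensor_tmul, h0]
      simp
    have p1 : (-1 : k) ^ (u.length + 1) * (-1) ^ ((u.length + 1) * v.length) =
        (-1) ^ ((u.length + 1) * (v.length + 1)) := by rw [← pow_add]; congr 1; ring
    have p2 : ∀ i ∈ Finset.range u.length, (-1 : k) ^ (u.length + 1) *
        (-1) ^ ((u.length - i) * v.length) =
        (-1) ^ ((u.length - i) * (v.length + 1)) * (-1) ^ (i + 1) := by
      intro i hi
      rw [Finset.mem_range] at hi
      rw [← pow_add, ← pow_add]
      congr 1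
      obtain ⟨d, hd⟩ := Nat.exists_eq_add_of_lt hi
      have : u.length - i = d + 1 := by omega
      rw [this, hd]
      ring
    rw [e, ih1, ih2, map_add, map_add, smul_add, add_add_add_comm]
    simp only [List.length_cons]
    congr 1
    · rw [Finset.sum_range_succ' _ u.length, Finset.sum_range_succ' _ u.length]
      simp only [map_add, map_sum, map_smul, smul_add, Finset.smul_sum, LinearMap.rTensor_tmul,
        letter_apply, List.take_succ_cons, List.drop_succ_cons, List.take_zero, List.drop_zero,
        shuffle_nil_left, Nat.sub_zero, Nat.add_sub_add_right, smul_smul, p1, ← word_cons]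
      rw [← add_assoc, ← Finset.sum_add_distrib]
      congr 1
      refine Finset.sum_congr rfl fun i hi => ?_
      have hlen : (u.take i).length = i := by
        rw [Finset.mem_range] at hi
        rw [List.length_take]
        omega
      rw [shuffle_cons, p2 i hi, TensorProduct.add_tmul, smul_add, hlen,
        ← TensorProduct.smul_tmul', smul_smul]
    · rw [Finset.sum_range_succ' _ v.length, Finset.sum_range_succ' _ v.length]
      simp only [map_add, map_sum, Finset.smul_sum, LinearMap.rTensor_tmul,
        letter_apply, List.take_succ_cons, List.drop_succ_cons, List.take_zero, List.drop_zero,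
        shuffle_nil_right, ← word_cons]
      rw [add_right_comm, ← Finset.sum_add_distrib]
      congr 1
      refine Finset.sum_congr rfl fun i hi => ?_
      rw [shuffle_cons, TensorProduct.add_tmul, ← TensorProduct.smul_tmul']

/-- The cobracket `Δ - τ ∘ Δ` of `T^c(sV)` descends to the quotient by the decomposables. -/
lemma cobr_decomposables (x : TensorAlgebra k V) (hx : x ∈ decomposables k V) :
    TensorProduct.map (decomposables k V).mkQ (decomposables k V).mkQ
      (deconcat k V x - gswap (tdeg k V) (deconcat k V x)) = 0 := by
  let _ : DirectSum.Decomposition (quotDeg (tdeg k V) (decomposables k V)) :=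
    (quotDeg_isInternal (tdeg k V) decomposables_homogeneous).chooseDecomposition
  set q := (decomposables k V).mkQ with hq
  have hd : ∀ i, ∀ x ∈ tdeg k V i, q x ∈ quotDeg (tdeg k V) (decomposables k V) i :=
    fun i x hx => ⟨x, hx, rfl⟩
  have hs : ∀ t, gswap (quotDeg (tdeg k V) (decomposables k V)) (TensorProduct.map q q t) =
      TensorProduct.map q q (gswap (tdeg k V) t) :=
    fun t => LinearMap.congr_fun (gswap_map (tdeg k V) hd) t
  have : decomposables k V ≤ LinearMap.ker (TensorProduct.map q q ∘ₗ
      (deconcat k V - gswap (tdeg k V) ∘ₗ deconcat k V)) := by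
    refine Submodule.span_le.2 ?_
    rintro _ (rfl | ⟨u, v, hu, hv, rfl⟩)
    · change TensorProduct.map q q (deconcat k V 1 - gswap (tdeg k V) (deconcat k V 1)) = 0
      have h1 : (1 : TensorAlgebra k V) ∈ tdeg k V 0 := word_mem ([] : List V)
      rw [deconcat_one, gswap_tmul (tdeg k V) h1 h1]
      simp [ksign]
    · change TensorProduct.map q q (deconcat k V (shuffle k u v) -
        gswap (tdeg k V) (deconcat k V (shuffle k u v))) = 0
      have e : TensorProduct.map q q (deconcat k V (shuffle k u v)) =
          q (word k u) ⊗ₜ q (word k v) +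
            (-1 : k) ^ (u.length * v.length) • (q (word k v) ⊗ₜ[k] q (word k u)) := by
        have h := congrArg (q.rTensor _) (deconcat_shuffle (k := k) u v)
        rw [← hq, ← LinearMap.comp_apply, LinearMap.rTensor_comp_lTensor] at h
        obtain ⟨m, hm⟩ := Nat.exists_eq_succ_of_ne_zero (List.length_pos_iff.2 hu).ne'
        obtain ⟨n, hn⟩ := Nat.exists_eq_succ_of_ne_zero (List.length_pos_iff.2 hv).ne'
        have z1 : ∀ i ∈ Finset.range m, q (shuffle k (u.take (i + 1)) v) = 0 := by
          intro i hi
          rw [hq, Submodule.mkQ_apply, Submodule.Quotient.mk_eq_zero]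
          refine shuffle_mem_decomposables ?_ hv
          simpa using hu
        have z2 : ∀ i ∈ Finset.range n, q (shuffle k u (v.take (i + 1))) = 0 := by
          intro i hi
          rw [hq, Submodule.mkQ_apply, Submodule.Quotient.mk_eq_zero]
          refine shuffle_mem_decomposables hu ?_
          simpa using hv
        rw [h, map_add, map_sum, map_sum, hm, hn, Finset.sum_range_succ', Finset.sum_range_succ',
          Finset.sum_eq_zero, Finset.sum_eq_zero]
        · simp [add_comm]
        · intro i hi
          simp [z2 i hi]
        · intro i hi
          simp [z1 i hi]
      have hk : ksign k u.length v.length = (-1 : k) ^ (u.length * v.length) := by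
        unfold ksign
        rw [← Nat.cast_mul, uzpow_natCast]
        simp
      rw [map_sub, ← hs, e, map_add, map_smul,
        gswap_tmul _ (hd _ _ (word_mem u)) (hd _ _ (word_mem v)),
        gswap_tmul _ (hd _ _ (word_mem v)) (hd _ _ (word_mem u)), smul_smul, ksign_comm
        (v.length : ℤ), hk, ← hk, ksign_mul_self, one_smul]
      abel
  exact this hx

/-- The cofree (conilpotent) graded Lie coalgebra `L^c(sV)`, for `V` concentrated in degree `0`:
the indecomposables of `T^c(sV)` with respect to the signed shuffle product, that is, the quotient
of `T^c(sV)` formally dual to the inclusion of the free Lie algebra into the tensor algebra. -/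
def cofreeLie (k : Type u) [Field k] (V : Type u) [AddCommGroup V] [Module k V] : GrLieCoalg k :=
  ((lieFunctor k).obj (tensorCoalg k V)).quot (decomposables k V) decomposables_homogeneous
    cobr_decomposables

/-- The natural morphism `π : 𝓛ie^c(T^c(sV)) ⟶ L^c(sV)`. -/
def cofreeLieProj (k : Type u) [Field k] (V : Type u) [AddCommGroup V] [Module k V] :
    (lieFunctor k).obj (tensorCoalg k V) ⟶ cofreeLie k V :=
  ((lieFunctor k).obj (tensorCoalg k V)).proj (decomposables k V) decomposables_homogeneous
    cobr_decomposables

lemma tmap_shuffle (f : V →ₗ[k] W) (u v : List V) :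
    tmap f (shuffle k u v) = shuffle k (u.map f) (v.map f) := by
  induction u, v using shuffle.induct with
  | case1 v => simp
  | case2 a u => simp
  | case3 a u b v h1 h2 => simp [shuffle_cons, h1, h2] at h1 h2 ⊢

lemma tmap_decomposables (f : V →ₗ[k] W) (x : TensorAlgebra k V) (hx : x ∈ decomposables k V) :
    tmap f x ∈ decomposables k W := by
  have : decomposables k V ≤ (decomposables k W).comap (tmap f).toLinearMap := by
    refine Submodule.span_le.2 ?_
    rintro _ (rfl | ⟨u, v, hu, hv, rfl⟩)
    · change tmap f 1 ∈ decomposables k W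
      rw [map_one]
      exact one_mem_decomposables
    · change tmap f (shuffle k u v) ∈ decomposables k W
      rw [tmap_shuffle]
      exact shuffle_mem_decomposables (by simpa using hu) (by simpa using hv)
  exact this hx

/-- The morphism `L^c(sV) ⟶ L^c(sW)` induced by a linear map. -/
def cofreeLieMap (f : V →ₗ[k] W) : cofreeLie k V ⟶ cofreeLie k W :=
  GrLieCoalg.quotHom ((lieFunctor k).map (tensorCoalgMap f)) decomposables_homogeneous
    cobr_decomposables decomposables_homogeneous cobr_decomposables (tmap_decomposables f)

end CofreeLie


/-! ### Quadratic-linear-constant data -/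

section Data

open TensorAlgebra (ι)

/-- The algebra homomorphism `Sym(V) → Sym(W)` induced by a linear map. -/
def symMap {k : Type u} [Field k] {V W : Type u} [AddCommGroup V] [Module k V] [AddCommGroup W]
    [Module k W] (f : V →ₗ[k] W) : SymmetricAlgebra k V →ₐ[k] SymmetricAlgebra k W :=
  SymmetricAlgebra.lift (SymmetricAlgebra.ι k W ∘ₗ f)

/-- The projection of `Sym(V)` onto its weight `n` part `Symⁿ(V)`. It is read off from the algebra
homomorphism `Sym(V) → Sym(V)[X]` with `v ↦ v X`, which maps `s ∈ Symⁿ(V)` to `s Xⁿ`. -/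
def symProj (k : Type u) [Field k] (V : Type u) [AddCommGroup V] [Module k V] (n : ℕ) :
    SymmetricAlgebra k V →ₗ[k] SymmetricAlgebra k V :=
  (Polynomial.lcoeff (SymmetricAlgebra k V) n).restrictScalars k ∘ₗ
    (SymmetricAlgebra.lift ((Polynomial.monomial 1).restrictScalars k ∘ₗ
      SymmetricAlgebra.ι k V)).toLinearMap

/-- A commutative quadratic-linear-constant (QLC) datum: a vector space `V` with a subspace
`R ⊆ k ⊕ V ⊕ Sym²(V)` of `Sym(V)` such that `R ∩ (k ⊕ V) = 0` and
`(R) ∩ (k ⊕ V ⊕ Sym²(V)) = R`. It presents the commutative QLC algebra `Sym(V)/(R)`. -/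
structure CommQLC (k : Type u) [Field k] where
  V : Type u
  [addCommGroup : AddCommGroup V]
  [module : Module k V]
  /-- The space `R` of relations. -/
  rel : Submodule k (SymmetricAlgebra k V)
  rel_le : rel ≤ 1 ⊔ LinearMap.range (SymmetricAlgebra.ι k V) ⊔
    LinearMap.range (SymmetricAlgebra.ι k V) ^ 2
  rel_inf : rel ⊓ (1 ⊔ LinearMap.range (SymmetricAlgebra.ι k V)) = ⊥
  ideal_inf : (Ideal.span (rel : Set (SymmetricAlgebra k V))).restrictScalars k ⊓
    (1 ⊔ LinearMap.range (SymmetricAlgebra.ι k V) ⊔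
      LinearMap.range (SymmetricAlgebra.ι k V) ^ 2) = rel

attribute [instance] CommQLC.addCommGroup CommQLC.module

/-- A morphism of commutative QLC data: a linear map of the generators that preserves the
relations. -/
@[ext]
structure CommQLC.Hom {k : Type u} [Field k] (D E : CommQLC k) where
  toLinearMap : D.V →ₗ[k] E.V
  map_rel : ∀ x ∈ D.rel, symMap toLinearMap x ∈ E.rel

/-- An (associative) QLC datum whose space of generators `V` is concentrated in degree `0`: a
subspace `R ⊆ k ⊕ V ⊕ V^{⊗2}` of `T(V)` such that `R ∩ (k ⊕ V) = 0` and
`(R) ∩ (k ⊕ V ⊕ V^{⊗2}) = R`. It presents the QLC algebra `T(V)/(R)`. -/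
structure AssocQLC (k : Type u) [Field k] where
  V : Type u
  [addCommGroup : AddCommGroup V]
  [module : Module k V]
  /-- The space `R` of relations. -/
  rel : Submodule k (TensorAlgebra k V)
  rel_le : rel ≤ 1 ⊔ LinearMap.range (ι k : V →ₗ[k] TensorAlgebra k V) ⊔
    LinearMap.range (ι k : V →ₗ[k] TensorAlgebra k V) ^ 2
  rel_inf : rel ⊓ (1 ⊔ LinearMap.range (ι k : V →ₗ[k] TensorAlgebra k V)) = ⊥
  ideal_inf : ∀ x ∈ TwoSidedIdeal.span (rel : Set (TensorAlgebra k V)),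
    x ∈ 1 ⊔ LinearMap.range (ι k : V →ₗ[k] TensorAlgebra k V) ⊔
      LinearMap.range (ι k : V →ₗ[k] TensorAlgebra k V) ^ 2 → x ∈ rel

attribute [instance] AssocQLC.addCommGroup AssocQLC.module

/-- A morphism of associative QLC data. -/
@[ext]
structure AssocQLC.Hom {k : Type u} [Field k] (D E : AssocQLC k) where
  toLinearMap : D.V →ₗ[k] E.V
  map_rel : ∀ x ∈ D.rel, tmap toLinearMap x ∈ E.rel

variable {k : Type u} [Field k]

section Maps

variable {V W X : Type u} [AddCommGroup V] [Module k V] [AddCommGroup W] [Module k W]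
  [AddCommGroup X] [Module k X]

@[simp] lemma symMap_ι (f : V →ₗ[k] W) (v : V) :
    symMap f (SymmetricAlgebra.ι k V v) = SymmetricAlgebra.ι k W (f v) := by
  simp [symMap]

lemma symMap_id : symMap (LinearMap.id : V →ₗ[k] V) = AlgHom.id k _ := by
  refine SymmetricAlgebra.algHom_ext ?_
  ext; simp

lemma symMap_comp (f : V →ₗ[k] W) (g : W →ₗ[k] X) :
    symMap (g ∘ₗ f) = (symMap g).comp (symMap f) := by
  refine SymmetricAlgebra.algHom_ext ?_
  ext; simp

lemma tmap_id : tmap (LinearMap.id : V →ₗ[k] V) = AlgHom.id k _ := by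
  refine TensorAlgebra.hom_ext ?_
  ext; simp

lemma tmap_comp (f : V →ₗ[k] W) (g : W →ₗ[k] X) :
    tmap (g ∘ₗ f) = (tmap g).comp (tmap f) := by
  refine TensorAlgebra.hom_ext ?_
  ext; simp

@[simp] lemma algHom_ι (v : V) :
    SymmetricAlgebra.algHom k V (ι k v) = SymmetricAlgebra.ι k V v := rfl

lemma symMap_algHom (f : V →ₗ[k] W) (x : TensorAlgebra k V) :
    symMap f (SymmetricAlgebra.algHom k V x) = SymmetricAlgebra.algHom k W (tmap f x) := by
  have : (symMap f).comp (SymmetricAlgebra.algHom k V) =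
      (SymmetricAlgebra.algHom k W).comp (tmap f) := by
    refine TensorAlgebra.hom_ext (LinearMap.ext fun v => ?_)
    change symMap f (SymmetricAlgebra.algHom k V (ι k v)) =
      SymmetricAlgebra.algHom k W (tmap f (ι k v))
    rw [algHom_ι, symMap_ι, tmap_ι, algHom_ι]
  exact AlgHom.congr_fun this x

lemma symProj_symMap (f : V →ₗ[k] W) (n : ℕ) (x : SymmetricAlgebra k V) :
    symProj k W n (symMap f x) = symMap f (symProj k V n x) := by
  have : (SymmetricAlgebra.lift ((Polynomial.monomial 1).restrictScalars k ∘ₗ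
        SymmetricAlgebra.ι k W)).comp (symMap f) =
      (Polynomial.mapAlgHom (symMap f)).comp (SymmetricAlgebra.lift
        ((Polynomial.monomial 1).restrictScalars k ∘ₗ SymmetricAlgebra.ι k V)) := by
    refine SymmetricAlgebra.algHom_ext ?_
    ext v : 1
    simp
  have h := AlgHom.congr_fun this x
  simp only [AlgHom.comp_apply] at h
  simp [symProj, h]

end Maps

instance (k : Type u) [Field k] : Category (CommQLC k) where
  Hom := CommQLC.Hom
  id D := ⟨LinearMap.id, fun x hx => by rw [symMap_id]; exact hx⟩
  comp f g := ⟨g.toLinearMap ∘ₗ f.toLinearMap, fun x hx => by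
    rw [symMap_comp]; exact g.map_rel _ (f.map_rel x hx)⟩

instance (k : Type u) [Field k] : Category (AssocQLC k) where
  Hom := AssocQLC.Hom
  id D := ⟨LinearMap.id, fun x hx => by rw [tmap_id]; exact hx⟩
  comp f g := ⟨g.toLinearMap ∘ₗ f.toLinearMap, fun x hx => by
    rw [tmap_comp]; exact g.map_rel _ (f.map_rel x hx)⟩

lemma algHom_mem_range {V : Type u} [AddCommGroup V] [Module k V] {x : TensorAlgebra k V}
    (n : ℕ) (hx : x ∈ LinearMap.range (ι k : V →ₗ[k] TensorAlgebra k V) ^ n) :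
    SymmetricAlgebra.algHom k V x ∈ LinearMap.range (SymmetricAlgebra.ι k V) ^ n := by
  have h : (LinearMap.range (ι k : V →ₗ[k] TensorAlgebra k V)).map
      (SymmetricAlgebra.algHom k V).toLinearMap = LinearMap.range (SymmetricAlgebra.ι k V) := by
    rw [← LinearMap.range_comp]; rfl
  rw [← h, ← Submodule.map_pow]
  exact ⟨x, hx, rfl⟩

lemma algHom_mem_one {V : Type u} [AddCommGroup V] [Module k V] {x : TensorAlgebra k V}
    (hx : x ∈ 1 ⊔ LinearMap.range (ι k : V →ₗ[k] TensorAlgebra k V)) :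
    SymmetricAlgebra.algHom k V x ∈ 1 ⊔ LinearMap.range (SymmetricAlgebra.ι k V) := by
  obtain ⟨y, hy, z, hz, rfl⟩ := Submodule.mem_sup.1 hx
  rw [map_add]
  refine Submodule.add_mem_sup ?_ ?_
  · simpa using algHom_mem_range 0 (by simpa using hy)
  · simpa using algHom_mem_range 1 (by simpa using hz)

lemma algHom_mem_two {V : Type u} [AddCommGroup V] [Module k V] {x : TensorAlgebra k V}
    (hx : x ∈ 1 ⊔ LinearMap.range (ι k : V →ₗ[k] TensorAlgebra k V) ⊔
      LinearMap.range (ι k : V →ₗ[k] TensorAlgebra k V) ^ 2) :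
    SymmetricAlgebra.algHom k V x ∈ 1 ⊔ LinearMap.range (SymmetricAlgebra.ι k V) ⊔
      LinearMap.range (SymmetricAlgebra.ι k V) ^ 2 := by
  obtain ⟨y, hy, z, hz, rfl⟩ := Submodule.mem_sup.1 hx
  rw [map_add]
  exact Submodule.add_mem_sup (algHom_mem_one hy) (algHom_mem_range 2 hz)

/-- `Sym(V) → Sym(V)` agrees with `T(V)` in weights `0` and `1`. -/
lemma eq_zero_of_algHom {V : Type u} [AddCommGroup V] [Module k V] {x : TensorAlgebra k V}
    (hx : x ∈ 1 ⊔ LinearMap.range (ι k : V →ₗ[k] TensorAlgebra k V))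
    (h : SymmetricAlgebra.algHom k V x = 0) : x = 0 := by
  obtain ⟨y, hy, z, ⟨v, rfl⟩, rfl⟩ := Submodule.mem_sup.1 hx
  obtain ⟨c, rfl⟩ := Submodule.mem_one.1 hy
  have key : ∀ φ : V →ₗ[k] k, c = 0 ∧ φ v = 0 := by
    intro φ
    let t : SymmetricAlgebra k V →ₐ[k] Polynomial k :=
      SymmetricAlgebra.lift (Polynomial.monomial 1 ∘ₗ φ)
    have h' := congrArg t h
    simp only [map_add, AlgHom.commutes, algHom_ι, map_zero, t,
      SymmetricAlgebra.lift_ι_apply] at h'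
    have h0 := congrArg (fun p => Polynomial.coeff p 0) h'
    have h1 := congrArg (fun p => Polynomial.coeff p 1) h'
    simp [Polynomial.coeff_C, Polynomial.coeff_monomial] at h0 h1
    exact ⟨h0, h1⟩
  have hv : v = 0 := (Module.forall_dual_apply_eq_zero_iff k v).1 fun φ => (key φ).2
  rw [(key 0).1, hv]
  simp

/-- A commutative QLC datum viewed as an associative one: `Sym(V)/(R) = T(V)/(p⁻¹(R))`, where
`p : T(V) → Sym(V)` is the canonical projection. -/
def CommQLC.toAssoc (k : Type u) [Field k] : CommQLC k ⥤ AssocQLC k where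
  obj D :=
    { V := D.V
      rel := (1 ⊔ LinearMap.range (ι k : D.V →ₗ[k] TensorAlgebra k D.V) ⊔
        LinearMap.range (ι k : D.V →ₗ[k] TensorAlgebra k D.V) ^ 2) ⊓
          D.rel.comap (SymmetricAlgebra.algHom k D.V).toLinearMap
      rel_le := inf_le_left
      rel_inf := by
        rw [eq_bot_iff]
        rintro x ⟨⟨_, hx⟩, hx'⟩
        refine (Submodule.mem_bot k).2 (eq_zero_of_algHom hx' ?_)
        have : SymmetricAlgebra.algHom k D.V x ∈
          D.rel ⊓ (1 ⊔ LinearMap.range (SymmetricAlgebra.ι k D.V)) := ⟨hx, algHom_mem_one hx'⟩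
        rwa [D.rel_inf] at this
      ideal_inf := by
        intro x hx hx'
        refine ⟨hx', ?_⟩
        change SymmetricAlgebra.algHom k D.V x ∈ D.rel
        rw [← D.ideal_inf]
        refine ⟨?_, algHom_mem_two hx'⟩
        have h := TwoSidedIdeal.span_le (I := TwoSidedIdeal.comap (SymmetricAlgebra.algHom k D.V)
          (Ideal.span (D.rel : Set (SymmetricAlgebra k D.V))).toTwoSided) |>.2
          (fun y hy => by
            rw [SetLike.mem_coe, TwoSidedIdeal.mem_comap, Ideal.mem_toTwoSided]
            exact Ideal.subset_span hy.2) hx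
        rwa [TwoSidedIdeal.mem_comap, Ideal.mem_toTwoSided] at h }
  map {D E} f :=
    { toLinearMap := f.toLinearMap
      map_rel := fun x hx => by
        have hr : (LinearMap.range (ι k : D.V →ₗ[k] TensorAlgebra k D.V)).map
            (tmap f.toLinearMap).toLinearMap ≤
              LinearMap.range (ι k : E.V →ₗ[k] TensorAlgebra k E.V) := by
          rintro _ ⟨_, ⟨v, rfl⟩, rfl⟩
          exact ⟨f.toLinearMap v, by simp⟩
        refine ⟨?_, ?_⟩
        · have h : tmap f.toLinearMap x ∈ Submodule.map (tmap f.toLinearMap).toLinearMap _ :=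
            ⟨x, hx.1, rfl⟩
          rw [Submodule.map_sup, Submodule.map_sup, Submodule.map_one, Submodule.map_pow] at h
          exact sup_le_sup (sup_le_sup le_rfl hr) (pow_le_pow_left' hr 2) h
        · change SymmetricAlgebra.algHom k E.V (tmap f.toLinearMap x) ∈ E.rel
          rw [← symMap_algHom]
          exact f.map_rel _ hx.2 }
  map_id _ := rfl
  map_comp _ _ := rfl

/-! ### The Koszul dual coalgebra and the Koszul dual Lie coalgebra -/

/-- The space of quadratic relations `qR ⊆ Sym²(V)`, the projection of `R`. -/
def CommQLC.quadRel (D : CommQLC k) : Submodule k (SymmetricAlgebra k D.V) :=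
  D.rel.map (symProj k D.V 2)

/-- The space of quadratic relations `qR ⊆ V^{⊗2}`, the projection of `R`. -/
def AssocQLC.quadRel (D : AssocQLC k) : Submodule k (TensorAlgebra k D.V) :=
  D.rel.map (gproj (tdeg k D.V) 2)

/-- The subspace of `T^c(sV)` of elements whose component in `(sV)^{⊗2}` lies in `s²qR`. -/
def AssocQLC.cogenRel (D : AssocQLC k) : Submodule k (TensorAlgebra k D.V) :=
  D.quadRel.comap (gproj (tdeg k D.V) 2)

/-- The Koszul dual coalgebra of a QLC datum, as a subspace of `T^c(sV)`: the universal (largest)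
graded subcoalgebra `C` such that the composite `C → T^c(sV) → (sV)^{⊗2}/s²qR` is zero. -/
def AssocQLC.koszulSub (D : AssocQLC k) : Submodule k (tensorCoalg k D.V).carrier :=
  largestSub (tensorCoalg k D.V).deg (Coalgebra.comul (R := k)) D.cogenRel

lemma AssocQLC.isGrSub_koszulSub (D : AssocQLC k) :
    IsGrSub (tensorCoalg k D.V).deg (Coalgebra.comul (R := k)) D.koszulSub :=
  isGrSub_largestSub _ _ _

/-- The image `s²qR` of the quadratic relations in the weight two part of `L^c(sV)`, under the
identification of that weight two part (a quotient of `V ⊗ V`) with `Sym²(V)`. -/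
def CommQLC.lieRel (D : CommQLC k) : Submodule k (cofreeLie k D.V).carrier :=
  (tdeg k D.V 2 ⊓ D.quadRel.comap (SymmetricAlgebra.algHom k D.V).toLinearMap).map
    (cofreeLieProj k D.V).toLinearMap

/-- The subspace of `L^c(sV)` of elements whose weight two component lies in `s²qR`. -/
def CommQLC.cogenRel (D : CommQLC k) : Submodule k (cofreeLie k D.V).carrier :=
  D.lieRel.comap (gproj (cofreeLie k D.V).deg 2)

/-- The Koszul dual Lie coalgebra of a commutative QLC datum, as a subspace of `L^c(sV)`: the
universal (largest) graded Lie subcoalgebra `G` such that the composite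
`G → L^c(sV) → Lie^c(2)(sV)/s²qR` is zero. -/
def CommQLC.koszulSub (D : CommQLC k) : Submodule k (cofreeLie k D.V).carrier :=
  largestSub (cofreeLie k D.V).deg (cofreeLie k D.V).cobr D.cogenRel

lemma CommQLC.isGrSub_koszulSub (D : CommQLC k) :
    IsGrSub (cofreeLie k D.V).deg (cofreeLie k D.V).cobr D.koszulSub :=
  isGrSub_largestSub _ _ _

lemma AssocQLC.map_koszulSub {D E : AssocQLC k} (f : D ⟶ E) :
    ∀ x ∈ D.koszulSub, (tensorCoalgMap f.toLinearMap).toCoalgHom x ∈ E.koszulSub := by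
  refine map_largestSub_le (tensorCoalg k D.V).deg (ℬ := (tensorCoalg k E.V).deg)
    (f := (tensorCoalgMap f.toLinearMap).toCoalgHom.toLinearMap)
    (tensorCoalgMap f.toLinearMap).map_deg (GrCoalg.map_comul (tensorCoalgMap f.toLinearMap)) ?_
  rintro x ⟨r, hr, hx⟩
  refine ⟨tmap f.toLinearMap r, f.map_rel r hr, ?_⟩
  exact (gproj_map (tdeg k D.V) (f := (tmap f.toLinearMap).toLinearMap) (tmap_mem _) 2 r).trans
    ((congrArg (tmap f.toLinearMap) hx).trans (gproj_map (tdeg k D.V)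
      (f := (tmap f.toLinearMap).toLinearMap) (tmap_mem _) 2 x).symm)

lemma CommQLC.map_koszulSub {D E : CommQLC k} (f : D ⟶ E) :
    ∀ x ∈ D.koszulSub, (cofreeLieMap f.toLinearMap).toLinearMap x ∈ E.koszulSub := by
  refine map_largestSub_le (cofreeLie k D.V).deg (ℬ := (cofreeLie k E.V).deg)
    (f := (cofreeLieMap f.toLinearMap).toLinearMap)
    (cofreeLieMap f.toLinearMap).map_deg (cofreeLieMap f.toLinearMap).map_cobr ?_
  rintro x ⟨y, ⟨hy, r, hr, hry⟩, hx⟩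
  refine ⟨tmap f.toLinearMap y, ⟨tmap_mem _ _ _ hy, symMap f.toLinearMap r, f.map_rel r hr, ?_⟩,
    ?_⟩
  · rw [symProj_symMap, hry]
    exact symMap_algHom _ _
  · refine Eq.trans ?_ (gproj_map (cofreeLie k D.V).deg (cofreeLieMap f.toLinearMap).map_deg
      2 x).symm
    exact congrArg (cofreeLieMap f.toLinearMap).toLinearMap hx

/-- The Koszul dual coalgebra `(qA)^¡` of an associative QLC datum, as a functor. -/
def koszulCoalg (k : Type u) [Field k] : AssocQLC k ⥤ GrCoalg k where
  obj D := (tensorCoalg k D.V).sub D.koszulSub D.isGrSub_koszulSub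
  map {D E} f := GrCoalg.subHom (tensorCoalgMap f.toLinearMap) D.isGrSub_koszulSub
    E.isGrSub_koszulSub (AssocQLC.map_koszulSub f)
  map_id D := by
    refine GrCoalg.hom_ext fun x => Subtype.ext ?_
    exact AlgHom.congr_fun tmap_id (x : D.koszulSub).1
  map_comp {D E F} f g := by
    refine GrCoalg.hom_ext fun x => Subtype.ext ?_
    exact AlgHom.congr_fun (tmap_comp f.toLinearMap g.toLinearMap) (x : D.koszulSub).1

/-- The inclusion `(qA)^¡ ⟶ T^c(sV)`. -/
def AssocQLC.koszulIncl (D : AssocQLC k) : (koszulCoalg k).obj D ⟶ tensorCoalg k D.V :=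
  (tensorCoalg k D.V).incl D.koszulSub D.isGrSub_koszulSub

/-- The Koszul dual Lie coalgebra `(qA)^¡` of a commutative QLC datum, as a functor. -/
def koszulLie (k : Type u) [Field k] : CommQLC k ⥤ GrLieCoalg k where
  obj D := (cofreeLie k D.V).sub D.koszulSub D.isGrSub_koszulSub
  map {D E} f := GrLieCoalg.subHom (cofreeLieMap f.toLinearMap) D.isGrSub_koszulSub
    E.isGrSub_koszulSub (CommQLC.map_koszulSub f)
  map_id D := by
    refine GrLieCoalg.hom_ext fun x => Subtype.ext ?_
    obtain ⟨y, hy⟩ := (decomposables k D.V).mkQ_surjective (x : D.koszulSub).1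
    refine Eq.trans (congrArg (cofreeLieMap LinearMap.id).toLinearMap hy.symm) ?_
    refine Eq.trans ?_ hy
    exact congrArg (decomposables k D.V).mkQ (AlgHom.congr_fun tmap_id y)
  map_comp {D E F} f g := by
    refine GrLieCoalg.hom_ext fun x => Subtype.ext ?_
    obtain ⟨y, hy⟩ := (decomposables k D.V).mkQ_surjective (x : D.koszulSub).1
    refine Eq.trans (congrArg (cofreeLieMap (g.toLinearMap ∘ₗ f.toLinearMap)).toLinearMap
      hy.symm) ?_
    refine Eq.trans ?_ (congrArg (fun z => (cofreeLieMap g.toLinearMap).toLinearMap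
      ((cofreeLieMap f.toLinearMap).toLinearMap z)) hy)
    exact congrArg (decomposables k F.V).mkQ
      (AlgHom.congr_fun (tmap_comp f.toLinearMap g.toLinearMap) y)

/-- The inclusion `(qA)^¡ ⟶ L^c(sV)`. -/
def CommQLC.koszulIncl (D : CommQLC k) : (koszulLie k).obj D ⟶ cofreeLie k D.V :=
  (cofreeLie k D.V).incl D.koszulSub D.isGrSub_koszulSub

end Data


/-! ### The universal coenveloping coalgebra -/

section Small

variable {k : Type u} [Field k] {M N : Type u} [AddCommGroup M] [Module k M]
  [AddCommGroup N] [Module k N]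

/-- A subspace of countable dimension. -/
def IsSmall (S : Submodule k M) : Prop := ∃ s : Set M, s.Countable ∧ Submodule.span k s = S

lemma IsSmall.sup {S T : Submodule k M} (hS : IsSmall S) (hT : IsSmall T) : IsSmall (S ⊔ T) := by
  obtain ⟨s, hs, rfl⟩ := hS
  obtain ⟨t, ht, rfl⟩ := hT
  exact ⟨s ∪ t, hs.union ht, Submodule.span_union s t⟩

lemma IsSmall.iSup {S : ℕ → Submodule k M} (hS : ∀ n, IsSmall (S n)) : IsSmall (⨆ n, S n) := by
  choose s hs hs' using hS
  refine ⟨⋃ n, s n, Set.countable_iUnion hs, ?_⟩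
  rw [Submodule.span_iUnion]
  simp only [hs']

lemma IsSmall.map {S : Submodule k M} (hS : IsSmall S) (f : M →ₗ[k] N) : IsSmall (S.map f) := by
  obtain ⟨s, hs, rfl⟩ := hS
  exact ⟨f '' s, hs.image f, Submodule.span_image f⟩

lemma isSmall_span_singleton (x : M) : IsSmall (Submodule.span k {x}) :=
  ⟨{x}, Set.countable_singleton x, rfl⟩

lemma IsSmall.exists_surjective {S : Submodule k M} (hS : IsSmall S) :
    ∃ p : (ℕ →₀ k) →ₗ[k] S, Function.Surjective p := by
  obtain ⟨s, hs, rfl⟩ := hS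
  obtain ⟨f, hf⟩ := (hs.insert 0).exists_eq_range (Set.insert_nonempty 0 s)
  have h : LinearMap.range (Finsupp.linearCombination k f) = Submodule.span k s := by
    rw [Finsupp.range_linearCombination, ← hf, Submodule.span_insert_zero]
  refine ⟨(Finsupp.linearCombination k f).codRestrict _ fun x => h ▸ ⟨x, rfl⟩, ?_⟩
  rintro ⟨y, hy⟩
  obtain ⟨x, hx⟩ := (h ▸ hy : y ∈ LinearMap.range (Finsupp.linearCombination k f))
  exact ⟨x, Subtype.ext hx⟩

variable (𝒜 : ℤ → Submodule k M) [DirectSum.Decomposition 𝒜]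

lemma exists_small_step (δ : M →ₗ[k] M ⊗[k] M) (S : Submodule k M) (hS : IsSmall S) :
    ∃ T : Submodule k M, IsSmall T ∧ S ≤ T ∧ (∀ n, ∀ x ∈ S, gproj 𝒜 n x ∈ T) ∧
      ∀ x ∈ S, δ x ∈ LinearMap.range (TensorProduct.map T.subtype T.subtype) := by
  obtain ⟨s, hs, rfl⟩ := hS
  have h : ∀ x : M, ∃ t : Set M, t.Countable ∧ δ x ∈ LinearMap.range
      (TensorProduct.map (Submodule.span k t).subtype (Submodule.span k t).subtype) := by
    intro x
    obtain ⟨M', N', hM, hN, h⟩ :=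
      TensorProduct.exists_finite_submodule_of_setFinite {δ x} (Set.finite_singleton _)
    rw [Module.Finite.iff_fg] at hM hN
    obtain ⟨t, ht⟩ := hM.sup hN
    refine ⟨t, t.countable_toSet, ?_⟩
    rw [ht]
    exact TensorProduct.range_mapIncl_mono le_sup_left le_sup_right (h rfl)
  choose t ht ht' using h
  set U : Set M := (s ∪ ⋃ n : ℤ, gproj 𝒜 n '' s) ∪ ⋃ x ∈ s, t x with hU
  refine ⟨Submodule.span k U, ⟨U, ?_, rfl⟩, Submodule.span_mono ?_, ?_, ?_⟩
  · exact (hs.union (Set.countable_iUnion fun n => hs.image _)).union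
      (hs.biUnion fun x _ => ht x)
  · exact fun x hx => Or.inl (Or.inl hx)
  · intro n
    have : Submodule.span k s ≤ (Submodule.span k U).comap (gproj 𝒜 n) := by
      refine Submodule.span_le.2 fun x hx => Submodule.subset_span (Or.inl (Or.inr ?_))
      exact Set.mem_iUnion.2 ⟨n, x, hx, rfl⟩
    exact fun x hx => this hx
  · have : Submodule.span k s ≤ (LinearMap.range (TensorProduct.map
        (Submodule.span k U).subtype (Submodule.span k U).subtype)).comap δ := by
      refine Submodule.span_le.2 fun x hx => ?_
      refine range_map_subtype_mono (Submodule.span_mono ?_) (ht' x)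
      exact fun y hy => Or.inr (Set.mem_biUnion hx hy)
    exact fun x hx => this hx

/-- Every subspace of countable dimension lies in a graded subcoalgebra of countable dimension. -/
lemma exists_small_sub (δ : M →ₗ[k] M ⊗[k] M) (S : Submodule k M) (hS : IsSmall S) :
    ∃ T : Submodule k M, IsSmall T ∧ S ≤ T ∧ IsGrSub 𝒜 δ T := by
  choose! T h1 h2 h3 h4 using exists_small_step 𝒜 δ
  have hs : ∀ n : ℕ, IsSmall (T^[n] S) := by
    intro n
    induction n with
    | zero => exact hS
    | succ n ih => rw [Function.iterate_succ_apply']; exact h1 _ ih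
  have hle : ∀ n : ℕ, T (T^[n] S) ≤ ⨆ n, T^[n] S := by
    intro n
    rw [← Function.iterate_succ_apply' T]
    exact le_iSup (fun n => T^[n] S) (n + 1)
  refine ⟨⨆ n, T^[n] S, IsSmall.iSup hs, le_iSup (fun n => T^[n] S) 0, ?_, ?_⟩
  · intro n
    have : (⨆ n, T^[n] S) ≤ (⨆ n, T^[n] S).comap (gproj 𝒜 n) :=
      iSup_le fun m x hx => hle m (h3 _ (hs m) n x hx)
    exact fun x hx => this hx
  · have : (⨆ n, T^[n] S) ≤ (LinearMap.range (TensorProduct.map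
        (⨆ n, T^[n] S).subtype (⨆ n, T^[n] S).subtype)).comap δ :=
      iSup_le fun m x hx => range_map_subtype_mono (hle m) (h4 _ (hs m) x hx)
    exact fun x hx => this hx

lemma isGrSub_top (δ : M →ₗ[k] M ⊗[k] M) : IsGrSub 𝒜 δ ⊤ := by
  refine ⟨fun _ _ _ => trivial, fun x _ => ?_⟩
  exact TensorProduct.map_surjective (fun y => ⟨⟨y, trivial⟩, rfl⟩)
    (fun y => ⟨⟨y, trivial⟩, rfl⟩) (δ x)

end Small

section Transport

variable {k : Type u} [Field k]

lemma coassoc_of_map {M N : Type u} [AddCommGroup M] [Module k M] [AddCommGroup N] [Module k N]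
    [Coalgebra k M] {Δ : N →ₗ[k] N ⊗[k] N} {f : M →ₗ[k] N}
    (h : ∀ x, Δ (f x) = TensorProduct.map f f (Coalgebra.comul (R := k) x)) (x : M) :
    TensorProduct.assoc k N N N (Δ.rTensor N (Δ (f x))) = Δ.lTensor N (Δ (f x)) := by
  have h' : Δ ∘ₗ f = TensorProduct.map f f ∘ₗ Coalgebra.comul := LinearMap.ext h
  have e1 : ∀ t, Δ.rTensor N (TensorProduct.map f f t) = TensorProduct.map (TensorProduct.map f f)
      f ((Coalgebra.comul (R := k)).rTensor M t) := by
    intro t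
    simp only [LinearMap.rTensor, ← LinearMap.comp_apply, ← TensorProduct.map_comp, h',
      LinearMap.id_comp, LinearMap.comp_id]
  have e2 : ∀ t, Δ.lTensor N (TensorProduct.map f f t) = TensorProduct.map f
      (TensorProduct.map f f) ((Coalgebra.comul (R := k)).lTensor M t) := by
    intro t
    simp only [LinearMap.lTensor, ← LinearMap.comp_apply, ← TensorProduct.map_comp, h',
      LinearMap.id_comp, LinearMap.comp_id]
  rw [h, e1, e2, ← Coalgebra.coassoc_apply, TensorProduct.map_map_assoc]

lemma rTensor_counit_of_map {M N : Type u} [AddCommGroup M] [Module k M] [AddCommGroup N]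
    [Module k N] [Coalgebra k M] {Δ : N →ₗ[k] N ⊗[k] N} {ε : N →ₗ[k] k} {f : M →ₗ[k] N}
    (h : ∀ x, Δ (f x) = TensorProduct.map f f (Coalgebra.comul (R := k) x))
    (hε : ∀ x, ε (f x) = Coalgebra.counit (R := k) x) (x : M) :
    ε.rTensor N (Δ (f x)) = 1 ⊗ₜ f x := by
  have hε' : ε ∘ₗ f = Coalgebra.counit := LinearMap.ext hε
  have e : ∀ t, ε.rTensor N (TensorProduct.map f f t) = TensorProduct.map LinearMap.id f
      ((Coalgebra.counit (R := k)).rTensor M t) := by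
    intro t
    simp only [LinearMap.rTensor, ← LinearMap.comp_apply, ← TensorProduct.map_comp, hε',
      LinearMap.id_comp, LinearMap.comp_id]
  rw [h, e, Coalgebra.rTensor_counit_comul]
  simp

lemma lTensor_counit_of_map {M N : Type u} [AddCommGroup M] [Module k M] [AddCommGroup N]
    [Module k N] [Coalgebra k M] {Δ : N →ₗ[k] N ⊗[k] N} {ε : N →ₗ[k] k} {f : M →ₗ[k] N}
    (h : ∀ x, Δ (f x) = TensorProduct.map f f (Coalgebra.comul (R := k) x))
    (hε : ∀ x, ε (f x) = Coalgebra.counit (R := k) x) (x : M) :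
    ε.lTensor N (Δ (f x)) = f x ⊗ₜ 1 := by
  have hε' : ε ∘ₗ f = Coalgebra.counit := LinearMap.ext hε
  have e : ∀ t, ε.lTensor N (TensorProduct.map f f t) = TensorProduct.map f LinearMap.id
      ((Coalgebra.counit (R := k)).lTensor M t) := by
    intro t
    simp only [LinearMap.lTensor, ← LinearMap.comp_apply, ← TensorProduct.map_comp, hε',
      LinearMap.id_comp, LinearMap.comp_id]
  rw [h, e, Coalgebra.lTensor_counit_comul]
  simp

/-- Transport of the structure of a graded coalgebra along a linear equivalence. -/
def GrCoalg.transport (C : GrCoalg k) {T : Type u} [AddCommGroup T] [Module k T]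
    (f : T ≃ₗ[k] C.carrier) : GrCoalg k :=
  have hf : ∀ n, ∀ x ∈ (C.deg n).comap f.toLinearMap, f x ∈ C.deg n := fun _ _ hx => hx
  have hf' : ∀ n, ∀ x ∈ C.deg n, f.symm.toLinearMap x ∈ (C.deg n).comap f.toLinearMap :=
    fun n x hx => by
      change f (f.symm x) ∈ C.deg n
      rwa [LinearEquiv.apply_symm_apply]
  letI : DirectSum.Decomposition (fun n => (C.deg n).comap f.toLinearMap) :=
    (isInternal_of_proj _ (fun n => f.symm.toLinearMap ∘ₗ gproj C.deg n ∘ₗ f.toLinearMap)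
      (fun i x hx => by
        change f.symm (gproj C.deg i (f x)) = x
        rw [gproj_same C.deg (hf i x hx)]
        exact f.symm_apply_apply x)
      (fun i j hij x hx => by
        change f.symm (gproj C.deg i (f x)) = 0
        rw [gproj_ne C.deg (hf j x hx) hij.symm, map_zero])
      (fun x => by
        have : f x ∈ (⨆ i, (C.deg i).comap f.toLinearMap).comap f.symm.toLinearMap :=
          mem_of_gproj_mem C.deg fun n => Submodule.mem_iSup_of_mem n
            (hf' n _ (gproj_mem C.deg n _))
        have h : f.symm (f x) ∈ ⨆ i, (C.deg i).comap f.toLinearMap := this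
        rwa [f.symm_apply_apply] at h)).chooseDecomposition
  let Δ : T →ₗ[k] T ⊗[k] T :=
    TensorProduct.map f.symm.toLinearMap f.symm.toLinearMap ∘ₗ Coalgebra.comul ∘ₗ f.toLinearMap
  let ε : T →ₗ[k] k := Coalgebra.counit ∘ₗ f.toLinearMap
  have hΔ : ∀ x, Δ (f.symm.toLinearMap x) = TensorProduct.map f.symm.toLinearMap
      f.symm.toLinearMap (Coalgebra.comul (R := k) x) := fun x =>
    congrArg (fun y => TensorProduct.map f.symm.toLinearMap f.symm.toLinearMap
      (Coalgebra.comul (R := k) y)) (f.apply_symm_apply x)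
  have hε : ∀ x, ε (f.symm.toLinearMap x) = Coalgebra.counit (R := k) x := fun x =>
    congrArg (Coalgebra.counit (R := k)) (f.apply_symm_apply x)
  letI : Coalgebra k T :=
    { comul := Δ
      counit := ε
      coassoc := LinearMap.ext fun x => by
        obtain ⟨x, rfl⟩ := f.symm.surjective x
        exact coassoc_of_map hΔ x
      rTensor_counit_comp_comul := LinearMap.ext fun x => by
        obtain ⟨x, rfl⟩ := f.symm.surjective x
        exact rTensor_counit_of_map hΔ hε x
      lTensor_counit_comp_comul := LinearMap.ext fun x => by
        obtain ⟨x, rfl⟩ := f.symm.surjective x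
        exact lTensor_counit_of_map hΔ hε x }
  { carrier := T
    deg := fun n => (C.deg n).comap f.toLinearMap
    comul_mem := fun n x hx => map_mem_tensDeg hf' hf' (C.comul_mem n _ hx)
    counit_eq_zero := fun n hn x hx => C.counit_eq_zero n hn _ hx }

/-- The transported graded coalgebra is isomorphic to the original one. -/
def GrCoalg.transportIso (C : GrCoalg k) {T : Type u} [AddCommGroup T] [Module k T]
    (f : T ≃ₗ[k] C.carrier) : C.transport f ≅ C where
  hom := GrCoalg.Hom.mk (C := C.transport f)
    { toLinearMap := f.toLinearMap
      counit_comp := rfl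
      map_comp_comul := LinearMap.ext fun (x : T) => by
        have hs : f.toLinearMap ∘ₗ f.symm.toLinearMap = LinearMap.id := by ext; simp
        have e : ∀ t : C.carrier ⊗[k] C.carrier, TensorProduct.map f.toLinearMap f.toLinearMap
            (TensorProduct.map f.symm.toLinearMap f.symm.toLinearMap t) = t := by
          intro t
          simp only [← LinearMap.comp_apply, ← TensorProduct.map_comp, hs, TensorProduct.map_id,
            LinearMap.id_apply]
        exact e _ }
    (fun _ _ hx => hx)
  inv := GrCoalg.Hom.mk (D := C.transport f)
    { toLinearMap := f.symm.toLinearMap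
      counit_comp := LinearMap.ext fun x => congrArg Coalgebra.counit (f.apply_symm_apply x)
      map_comp_comul := LinearMap.ext fun x => (congrArg (fun y => TensorProduct.map
          f.symm.toLinearMap f.symm.toLinearMap (Coalgebra.comul y))
          (f.apply_symm_apply x)).symm }
    (fun n x hx => by
      change f (f.symm x) ∈ C.deg n
      rwa [LinearEquiv.apply_symm_apply])
  hom_inv_id := GrCoalg.hom_ext fun (x : T) => f.symm_apply_apply x
  inv_hom_id := GrCoalg.hom_ext fun x => f.apply_symm_apply x

/-- A morphism of graded coalgebras with values in a graded subcoalgebra. -/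
def GrCoalg.corestrict {C D : GrCoalg k} (f : C ⟶ D) {T : Submodule k D.carrier}
    (hT : IsGrSub D.deg Coalgebra.comul T) (h : ∀ x, f.toCoalgHom x ∈ T) : C ⟶ D.sub T hT :=
  GrCoalg.Hom.mk (D := D.sub T hT)
    { toLinearMap := f.toCoalgHom.toLinearMap.codRestrict T h
      counit_comp := f.toCoalgHom.counit_comp
      map_comp_comul := LinearMap.ext fun x => map_subtype_injective T (by
        have e : ∀ t : C.carrier ⊗[k] C.carrier, TensorProduct.map T.subtype T.subtype
            (TensorProduct.map (f.toCoalgHom.toLinearMap.codRestrict T h)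
              (f.toCoalgHom.toLinearMap.codRestrict T h) t) =
            TensorProduct.map f.toCoalgHom.toLinearMap f.toCoalgHom.toLinearMap t := by
          intro t
          simp only [← LinearMap.comp_apply, ← TensorProduct.map_comp]
          rfl
        refine (e _).trans ?_
        exact (GrCoalg.map_comul f x).symm.trans
          (map_subMap hT.map_mem ⟨f.toCoalgHom x, h x⟩).symm) }
    (fun n x hx => f.map_deg n x hx)

end Transport


section Colimit

variable {k : Type u} [Field k] {I : Type u} (X : I → GrCoalg k)
  (r : ∀ i j, (X i ⟶ X j) → Prop)

open Classical in
/-- The relations that identify `x` with `a x`, for the transition maps `a`. -/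
def colimRel : Submodule k (Π₀ i, (X i).carrier) :=
  Submodule.span k {w | ∃ i j, ∃ a : X i ⟶ X j, ∃ x, r i j a ∧
    DFinsupp.single j (a.toCoalgHom x) - DFinsupp.single i x = w}

/-- The underlying space of a colimit of graded coalgebras. -/
abbrev ColimSpace : Type u := (Π₀ i, (X i).carrier) ⧸ colimRel X r

open Classical in
/-- The structure maps of the colimit. -/
def leg (i : I) : (X i).carrier →ₗ[k] ColimSpace X r :=
  (colimRel X r).mkQ ∘ₗ DFinsupp.lsingle (R := k) (M := fun i => (X i).carrier) i

variable {X r}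

lemma leg_apply {i j : I} (a : X i ⟶ X j) (h : r i j a) (x : (X i).carrier) :
    leg X r j (a.toCoalgHom x) = leg X r i x := by
  classical
  rw [← sub_eq_zero]
  change (colimRel X r).mkQ _ - (colimRel X r).mkQ _ = 0
  rw [← map_sub, Submodule.mkQ_apply, Submodule.Quotient.mk_eq_zero]
  refine Submodule.subset_span ⟨i, j, a, x, h, ?_⟩
  congr

lemma colim_ext {P : Type u} [AddCommGroup P] [Module k P] {f g : ColimSpace X r →ₗ[k] P}
    (h : ∀ i x, f (leg X r i x) = g (leg X r i x)) : f = g := by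
  classical
  refine Submodule.linearMap_qext _ (DFinsupp.lhom_ext' fun i => LinearMap.ext fun x => ?_)
  have := h i x
  unfold leg at this
  simp only [LinearMap.comp_apply] at this ⊢
  exact this

open Classical in
/-- The universal property of the colimit. -/
def colimDesc {P : Type u} [AddCommGroup P] [Module k P] (f : ∀ i, (X i).carrier →ₗ[k] P)
    (hf : ∀ i j (a : X i ⟶ X j) x, r i j a → f j (a.toCoalgHom x) = f i x) :
    ColimSpace X r →ₗ[k] P :=
  (colimRel X r).liftQ (DFinsupp.lsum ℕ f) (Submodule.span_le.2 (by
    rintro _ ⟨i, j, a, x, h, rfl⟩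
    simp [hf i j a x h]))

@[simp] lemma colimDesc_leg {P : Type u} [AddCommGroup P] [Module k P]
    (f : ∀ i, (X i).carrier →ₗ[k] P)
    (hf : ∀ i j (a : X i ⟶ X j) x, r i j a → f j (a.toCoalgHom x) = f i x) (i : I)
    (x : (X i).carrier) : colimDesc (r := r) f hf (leg X r i x) = f i x := by
  classical
  change DFinsupp.lsum ℕ f (DFinsupp.single i x) = _
  simp

lemma colim_induction {p : ColimSpace X r → Prop} (h0 : p 0) (hadd : ∀ x y, p x → p y → p (x + y))
    (h : ∀ i x, p (leg X r i x)) (x : ColimSpace X r) : p x := by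
  classical
  obtain ⟨w, rfl⟩ := (colimRel X r).mkQ_surjective x
  induction w using DFinsupp.induction with
  | h0 => simpa using h0
  | ha i b f _ _ hf =>
    rw [map_add]
    exact hadd _ _ (h i b) hf

variable (X r) in
lemma colimComul_aux (i j : I) (a : X i ⟶ X j) (x : (X i).carrier) (h : r i j a) :
    (TensorProduct.map (leg X r j) (leg X r j) ∘ₗ Coalgebra.comul) (a.toCoalgHom x) =
      (TensorProduct.map (leg X r i) (leg X r i) ∘ₗ Coalgebra.comul) x := by
  have e : leg X r j ∘ₗ a.toCoalgHom.toLinearMap = leg X r i := LinearMap.ext (leg_apply a h)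
  simp only [LinearMap.comp_apply]
  rw [GrCoalg.map_comul, ← LinearMap.comp_apply, ← TensorProduct.map_comp, e]

variable (X r) in
/-- The grading of the colimit. -/
def colimDeg (n : ℤ) : Submodule k (ColimSpace X r) := ⨆ i, ((X i).deg n).map (leg X r i)

variable (X r) in
lemma colimDeg_mem (i : I) (n : ℤ) (x : (X i).carrier) (hx : x ∈ (X i).deg n) :
    leg X r i x ∈ colimDeg X r n :=
  Submodule.mem_iSup_of_mem i ⟨x, hx, rfl⟩

variable (X r) in
/-- The colimit of a system of graded coalgebras. -/
def colimCoalg : GrCoalg k :=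
  let Δ : ColimSpace X r →ₗ[k] ColimSpace X r ⊗[k] ColimSpace X r :=
    colimDesc (fun i => TensorProduct.map (leg X r i) (leg X r i) ∘ₗ Coalgebra.comul)
      (colimComul_aux X r)
  let ε : ColimSpace X r →ₗ[k] k :=
    colimDesc (fun i => Coalgebra.counit) (fun i j a x h =>
      LinearMap.congr_fun a.toCoalgHom.counit_comp x)
  have hΔ : ∀ i x, Δ (leg X r i x) = TensorProduct.map (leg X r i) (leg X r i)
      (Coalgebra.comul (R := k) x) := fun i x => colimDesc_leg _ _ i x
  have hε : ∀ i x, ε (leg X r i x) = Coalgebra.counit (R := k) x :=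
    fun i x => colimDesc_leg _ _ i x
  letI : Coalgebra k (ColimSpace X r) :=
    { comul := Δ
      counit := ε
      coassoc := colim_ext fun i x => coassoc_of_map (hΔ i) x
      rTensor_counit_comp_comul := colim_ext fun i x => rTensor_counit_of_map (hΔ i) (hε i) x
      lTensor_counit_comp_comul := colim_ext fun i x => lTensor_counit_of_map (hΔ i) (hε i) x }
  let 𝒜 : ℤ → Submodule k (ColimSpace X r) := colimDeg X r
  have h𝒜 : ∀ i n, ∀ x ∈ (X i).deg n, leg X r i x ∈ 𝒜 n := colimDeg_mem X r
  let p : ℤ → ColimSpace X r →ₗ[k] ColimSpace X r := fun n =>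
    colimDesc (fun i => leg X r i ∘ₗ gproj (X i).deg n) (fun i j a x h => by
      simp only [LinearMap.comp_apply]
      rw [← leg_apply a h]
      exact congrArg _ (gproj_map (X i).deg (f := a.toCoalgHom.toLinearMap) a.map_deg n x))
  have hp : ∀ n i x, p n (leg X r i x) = leg X r i (gproj (X i).deg n x) :=
    fun n i x => colimDesc_leg _ _ i x
  letI : DirectSum.Decomposition 𝒜 :=
    (isInternal_of_proj 𝒜 p
      (fun n x hx => by
        have : 𝒜 n ≤ LinearMap.eqLocus (p n) LinearMap.id := iSup_le fun i => by
          rintro _ ⟨y, hy, rfl⟩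
          change p n (leg X r i y) = leg X r i y
          rw [hp, gproj_same (X i).deg hy]
        exact this hx)
      (fun m n hmn x hx => by
        have : 𝒜 n ≤ LinearMap.ker (p m) := iSup_le fun i => by
          rintro _ ⟨y, hy, rfl⟩
          change p m (leg X r i y) = 0
          rw [hp, gproj_ne (X i).deg hy hmn.symm, map_zero]
        exact this hx)
      (colim_induction (Submodule.zero_mem _) (fun _ _ => Submodule.add_mem _) fun i x => by
        have : x ∈ (⨆ n, 𝒜 n).comap (leg X r i) := mem_of_gproj_mem (X i).deg fun n =>
          Submodule.mem_iSup_of_mem n (h𝒜 i n _ (gproj_mem (X i).deg n x))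
        exact this)).chooseDecomposition
  { carrier := ColimSpace X r
    deg := 𝒜
    comul_mem := fun n x hx => by
      have : 𝒜 n ≤ (tensDeg 𝒜 𝒜 n).comap Δ := iSup_le fun i => by
        rintro _ ⟨y, hy, rfl⟩
        change Δ (leg X r i y) ∈ tensDeg 𝒜 𝒜 n
        rw [hΔ]
        exact map_mem_tensDeg (h𝒜 i) (h𝒜 i) ((X i).comul_mem n y hy)
      exact this hx
    counit_eq_zero := fun n hn x hx => by
      have : 𝒜 n ≤ LinearMap.ker ε := iSup_le fun i => by
        rintro _ ⟨y, hy, rfl⟩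
        change ε (leg X r i y) = 0
        rw [hε]
        exact (X i).counit_eq_zero n hn y hy
      exact this hx }

variable (X r) in
/-- The structure maps of the colimit, as morphisms of graded coalgebras. -/
def legHom (i : I) : X i ⟶ colimCoalg X r :=
  let l : (X i).carrier →ₗ[k] (colimCoalg X r).carrier := leg X r i
  have h1 : (colimCoalg X r).coalgebra.counit ∘ₗ l = Coalgebra.counit :=
    LinearMap.ext fun x => colimDesc_leg (r := r) _ (fun _ _ a x _ =>
      LinearMap.congr_fun a.toCoalgHom.counit_comp x) i x
  have h2 : (colimCoalg X r).coalgebra.comul ∘ₗ l =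
      TensorProduct.map l l ∘ₗ Coalgebra.comul :=
    LinearMap.ext fun x => colimDesc_leg (r := r)
      (fun i => TensorProduct.map (leg X r i) (leg X r i) ∘ₗ Coalgebra.comul)
      (colimComul_aux X r) i x
  GrCoalg.Hom.mk (D := colimCoalg X r)
    (CoalgHom.mk (R := k) (A := (X i).carrier) (B := (colimCoalg X r).carrier) l h1 h2.symm)
    (fun n x hx => colimDeg_mem X r i n x hx)

/-- A cocone of morphisms of graded Lie coalgebras descends to the colimit. -/
def lieDesc {G : GrLieCoalg k} (f : ∀ i, (lieFunctor k).obj (X i) ⟶ G)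
    (hf : ∀ i j (a : X i ⟶ X j), r i j a → (lieFunctor k).map a ≫ f j = f i) :
    (lieFunctor k).obj (colimCoalg X r) ⟶ G :=
  let g : ColimSpace X r →ₗ[k] G.carrier := colimDesc (fun i => (f i).toLinearMap)
    (fun i j a x h => by rw [← hf i j a h]; rfl)
  have hg : ∀ i x, g (leg X r i x) = (f i).toLinearMap x := fun i x => colimDesc_leg _ _ i x
  GrLieCoalg.Hom.mk (G := (lieFunctor k).obj (colimCoalg X r)) g
    (fun n x hx => by
      have : colimDeg X r n ≤ (G.deg n).comap g := iSup_le fun i => by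
        rintro _ ⟨y, hy, rfl⟩
        change g (leg X r i y) ∈ G.deg n
        rw [hg]
        exact (f i).map_deg n y hy
      exact this hx)
    (fun x => by
      have : G.cobr ∘ₗ g =
          TensorProduct.map g g ∘ₗ ((lieFunctor k).obj (colimCoalg X r)).cobr := by
        refine colim_ext fun i x => ?_
        have h1 := ((lieFunctor k).map (legHom X r i)).map_cobr x
        have h2 := (f i).map_cobr x
        refine ((congrArg G.cobr (hg i x)).trans h2).trans ?_
        refine Eq.trans ?_ (congrArg (TensorProduct.map g g) h1).symm
        have e : g ∘ₗ leg X r i = (f i).toLinearMap := LinearMap.ext (hg i)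
        have e' := TensorProduct.map_comp g g (leg X r i) (leg X r i)
        rw [e] at e'
        exact LinearMap.congr_fun e' _
      exact LinearMap.congr_fun this x)

lemma lieDesc_legHom {G : GrLieCoalg k} (f : ∀ i, (lieFunctor k).obj (X i) ⟶ G)
    (hf : ∀ i j (a : X i ⟶ X j), r i j a → (lieFunctor k).map a ≫ f j = f i) (i : I) :
    (lieFunctor k).map (legHom X r i) ≫ lieDesc f hf = f i :=
  GrLieCoalg.hom_ext fun x => colimDesc_leg (r := r) (fun i => (f i).toLinearMap)
    (fun i j a x h => by rw [← hf i j a h]; rfl) i x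

end Colimit


section Coenveloping

variable {k : Type u} [Field k] (G : GrLieCoalg k)

/-- Graded coalgebras over `G` on quotients of `k^(ℕ)`, a set of representatives of the graded
coalgebras `C` of countable dimension with a morphism `𝓛ie^c(C) ⟶ G`. -/
structure SmallIdx : Type u where
  K : Submodule k (ℕ →₀ k)
  [coalgebra : Coalgebra k ((ℕ →₀ k) ⧸ K)]
  deg : ℤ → Submodule k ((ℕ →₀ k) ⧸ K)
  [decomposition : DirectSum.Decomposition deg]
  comul_mem : ∀ n, ∀ x ∈ deg n, Coalgebra.comul (R := k) x ∈ tensDeg deg deg n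
  counit_eq_zero : ∀ n, n ≠ 0 → ∀ x ∈ deg n, Coalgebra.counit (R := k) x = 0
  hom : (lieFunctor k).obj ⟨(ℕ →₀ k) ⧸ K, deg, comul_mem, counit_eq_zero⟩ ⟶ G

attribute [instance] SmallIdx.coalgebra SmallIdx.decomposition

variable {G}

/-- The graded coalgebra of an index. -/
def SmallIdx.obj (i : SmallIdx G) : GrCoalg k :=
  ⟨(ℕ →₀ k) ⧸ i.K, i.deg, i.comul_mem, i.counit_eq_zero⟩

/-- The structure morphism of an index. -/
def SmallIdx.str (i : SmallIdx G) : (lieFunctor k).obj i.obj ⟶ G := i.hom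

/-- A graded coalgebra of countable dimension. -/
def GrCoalg.IsSmall (B : GrCoalg k) : Prop :=
  ∃ p : (ℕ →₀ k) →ₗ[k] B.carrier, Function.Surjective p

lemma exists_idx {B : GrCoalg k} (hB : B.IsSmall) (f : (lieFunctor k).obj B ⟶ G) :
    ∃ i : SmallIdx G, ∃ e : i.obj ≅ B, (lieFunctor k).map e.hom ≫ f = i.str := by
  obtain ⟨p, hp⟩ := hB
  let q := p.quotKerEquivOfSurjective hp
  let C := B.transport q
  let hom : (lieFunctor k).obj C ⟶ G := (lieFunctor k).map (B.transportIso q).hom ≫ f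
  exact ⟨@SmallIdx.mk k _ G (LinearMap.ker p) C.coalgebra C.deg C.decomposition C.comul_mem
    C.counit_eq_zero hom, B.transportIso q, rfl⟩

variable (G) in
/-- The transition maps: morphisms over `G`. -/
def overRel (i j : SmallIdx G) (a : i.obj ⟶ j.obj) : Prop :=
  (lieFunctor k).map a ≫ j.str = i.str

variable (G) in
/-- The universal coenveloping coalgebra of `G`, as a colimit. -/
def coenv : GrCoalg k := colimCoalg SmallIdx.obj (overRel G)

variable (G) in
/-- The couniversal morphism. -/
def coenvCounit : (lieFunctor k).obj (coenv G) ⟶ G :=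
  lieDesc SmallIdx.str fun _ _ _ h => h

/-- The structure maps of the colimit. -/
def idxLeg (i : SmallIdx G) : i.obj ⟶ coenv G := legHom SmallIdx.obj (overRel G) i

/-- The canonical morphism from an object of countable dimension. -/
def smallLeg {B : GrCoalg k} (hB : B.IsSmall) (f : (lieFunctor k).obj B ⟶ G) : B ⟶ coenv G :=
  (exists_idx hB f).choose_spec.choose.inv ≫
    idxLeg (exists_idx hB f).choose

lemma legHom_nat {i j : SmallIdx G} (a : i.obj ⟶ j.obj)
    (h : (lieFunctor k).map a ≫ j.str = i.str) :
    a ≫ idxLeg j = idxLeg i :=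
  GrCoalg.hom_ext fun x => leg_apply (r := overRel G) a h x

lemma smallLeg_eq {B : GrCoalg k} (hB : B.IsSmall) (f : (lieFunctor k).obj B ⟶ G) :
    ∃ i : SmallIdx G, ∃ e : i.obj ≅ B, (lieFunctor k).map e.hom ≫ f = i.str ∧
      smallLeg hB f = e.inv ≫ idxLeg i :=
  ⟨_, _, (exists_idx hB f).choose_spec.choose_spec, rfl⟩

lemma smallLeg_w {B : GrCoalg k} (hB : B.IsSmall) (f : (lieFunctor k).obj B ⟶ G) :
    (lieFunctor k).map (smallLeg hB f) ≫ coenvCounit G = f := by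
  obtain ⟨i, e, h, h'⟩ := smallLeg_eq hB f
  have h2 : (lieFunctor k).map (idxLeg i) ≫ coenvCounit G = i.str :=
    lieDesc_legHom _ _ i
  rw [h', Functor.map_comp, Category.assoc, h2, ← h, ← Category.assoc, ← Functor.map_comp]
  simp

lemma smallLeg_nat {B B' : GrCoalg k} (hB : B.IsSmall) (hB' : B'.IsSmall)
    (f : (lieFunctor k).obj B ⟶ G) (f' : (lieFunctor k).obj B' ⟶ G) (u : B ⟶ B')
    (hu : (lieFunctor k).map u ≫ f' = f) : u ≫ smallLeg hB' f' = smallLeg hB f := by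
  obtain ⟨i, e, h, h1⟩ := smallLeg_eq hB f
  obtain ⟨i', e', h', h1'⟩ := smallLeg_eq hB' f'
  have key := legHom_nat (e.hom ≫ u ≫ e'.inv) (i := i) (j := i') (by
    rw [← h, ← h', ← hu]
    simp only [Functor.map_comp, Category.assoc]
    rw [← Functor.map_comp_assoc _ e'.inv, e'.inv_hom_id]
    simp)
  rw [h1, h1', ← key]
  simp

lemma SmallIdx.isSmall (i : SmallIdx G) : i.obj.IsSmall := ⟨i.K.mkQ, i.K.mkQ_surjective⟩

lemma smallLeg_idx (i : SmallIdx G) :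
    smallLeg i.isSmall i.str = idxLeg i := by
  obtain ⟨j, e, h, h1⟩ := smallLeg_eq i.isSmall i.str
  rw [h1, ← legHom_nat e.hom h]
  simp

lemma coenv_ext {D : GrCoalg k} {f g : coenv G ⟶ D}
    (h : ∀ i, idxLeg i ≫ f = idxLeg i ≫ g) :
    f = g := by
  have : (f.toCoalgHom.toLinearMap : ColimSpace _ (overRel G) →ₗ[k] D.carrier) =
      g.toCoalgHom.toLinearMap := colim_ext fun i x =>
    congrArg (fun t : SmallIdx.obj i ⟶ D => t.toCoalgHom x) (h i)
  exact GrCoalg.hom_ext fun x => LinearMap.congr_fun this x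

lemma isSmall_sub {C : GrCoalg k} {S : Submodule k C.carrier} (h : QLC.IsSmall S)
    (hS : IsGrSub C.deg Coalgebra.comul S) : (C.sub S hS).IsSmall := h.exists_surjective

/-- The canonical morphism on a subcoalgebra of countable dimension. -/
def subLeg {C : GrCoalg k} (f : (lieFunctor k).obj C ⟶ G) {S : Submodule k C.carrier}
    (h : QLC.IsSmall S) (hS : IsGrSub C.deg Coalgebra.comul S) : C.sub S hS ⟶ coenv G :=
  smallLeg (isSmall_sub h hS) ((lieFunctor k).map (C.incl S hS) ≫ f)

lemma subLeg_le {C : GrCoalg k} (f : (lieFunctor k).obj C ⟶ G) {S T : Submodule k C.carrier}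
    (h : QLC.IsSmall S) (hS : IsGrSub C.deg Coalgebra.comul S) (h' : QLC.IsSmall T)
    (hT : IsGrSub C.deg Coalgebra.comul T) (hST : S ≤ T) (x : C.carrier) (hx : x ∈ S) :
    (subLeg f h hS).toCoalgHom (⟨x, hx⟩ : S) = (subLeg f h' hT).toCoalgHom (⟨x, hST hx⟩ : T) := by
  let u : C.sub S hS ⟶ C.sub T hT := GrCoalg.subHom (𝟙 C) hS hT fun x hx => hST hx
  have := smallLeg_nat (isSmall_sub h hS) (isSmall_sub h' hT)
    ((lieFunctor k).map (C.incl S hS) ≫ f) ((lieFunctor k).map (C.incl T hT) ≫ f) u rfl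
  exact (congrArg (fun t : C.sub S hS ⟶ coenv G => t.toCoalgHom (⟨x, hx⟩ : S)) this).symm

lemma exists_lift {C : GrCoalg k} (f : (lieFunctor k).obj C ⟶ G) :
    ∃ h : C ⟶ coenv G, (lieFunctor k).map h ≫ coenvCounit G = f ∧
      ∀ (S : Submodule k C.carrier) (h' : QLC.IsSmall S) (hS : IsGrSub C.deg Coalgebra.comul S),
        C.incl S hS ≫ h = subLeg f h' hS := by
  have hex : ∀ S : Submodule k C.carrier, QLC.IsSmall S → ∃ T : Submodule k C.carrier,
      QLC.IsSmall T ∧ S ≤ T ∧ IsGrSub C.deg Coalgebra.comul T :=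
    fun S hS => exists_small_sub C.deg _ S hS
  have hx : ∀ x : C.carrier, ∃ T : Submodule k C.carrier,
      QLC.IsSmall T ∧ x ∈ T ∧ IsGrSub C.deg Coalgebra.comul T := by
    intro x
    obtain ⟨T, h1, h2, h3⟩ := hex _ (isSmall_span_singleton x)
    exact ⟨T, h1, h2 (Submodule.mem_span_singleton_self x), h3⟩
  choose T h1 h2 h3 using hx
  let h0 : C.carrier → (coenv G).carrier := fun x =>
    (subLeg f (h1 x) (h3 x)).toCoalgHom (⟨x, h2 x⟩ : T x)
  have key : ∀ (S : Submodule k C.carrier) (h' : QLC.IsSmall S)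
      (hS : IsGrSub C.deg Coalgebra.comul S) (x : C.carrier) (hx : x ∈ S),
      h0 x = (subLeg f h' hS).toCoalgHom (⟨x, hx⟩ : S) := by
    intro S h' hS x hx
    obtain ⟨U, u1, u2, u3⟩ := hex _ ((h1 x).sup h')
    exact (subLeg_le f (h1 x) (h3 x) u1 u3 (le_sup_left.trans u2) x (h2 x)).trans
      (subLeg_le f h' hS u1 u3 (le_sup_right.trans u2) x hx).symm
  let hl : C.carrier →ₗ[k] (coenv G).carrier :=
    { toFun := h0
      map_add' := fun x y => by
        obtain ⟨U, u1, u2, u3⟩ := hex _ ((h1 x).sup (h1 y))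
        have hx : x ∈ U := u2 (Submodule.mem_sup_left (h2 x))
        have hy : y ∈ U := u2 (Submodule.mem_sup_right (h2 y))
        rw [key U u1 u3 x hx, key U u1 u3 y hy, key U u1 u3 _ (U.add_mem hx hy)]
        exact (subLeg f u1 u3).toCoalgHom.toLinearMap.map_add (⟨x, hx⟩ : U) (⟨y, hy⟩ : U)
      map_smul' := fun c x => by
        rw [key _ (h1 x) (h3 x) _ ((T x).smul_mem c (h2 x))]
        exact (subLeg f (h1 x) (h3 x)).toCoalgHom.toLinearMap.map_smul c (⟨x, h2 x⟩ : T x) }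
  have hle : ∀ (S : Submodule k C.carrier) (h' : QLC.IsSmall S)
      (hS : IsGrSub C.deg Coalgebra.comul S),
      hl ∘ₗ (C.incl S hS).toCoalgHom.toLinearMap = (subLeg f h' hS).toCoalgHom.toLinearMap :=
    fun S h' hS => LinearMap.ext fun (x : S) => key S h' hS x.1 x.2
  let h : C ⟶ coenv G := GrCoalg.Hom.mk
    { toLinearMap := hl
      counit_comp := LinearMap.ext fun x =>
        LinearMap.congr_fun (subLeg f (h1 x) (h3 x)).toCoalgHom.counit_comp (⟨x, h2 x⟩ : T x)
      map_comp_comul := LinearMap.ext fun x => by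
        have e1 := GrCoalg.map_comul (subLeg f (h1 x) (h3 x)) (⟨x, h2 x⟩ : T x)
        have e2 := GrCoalg.map_comul (C.incl (T x) (h3 x)) (⟨x, h2 x⟩ : T x)
        rw [← hle _ (h1 x) (h3 x), TensorProduct.map_comp] at e1
        refine Eq.trans ?_ e1.symm
        exact congrArg (TensorProduct.map hl hl) e2 }
    (fun n x hx => (subLeg f (h1 x) (h3 x)).map_deg n (⟨x, h2 x⟩ : T x) hx)
  refine ⟨h, GrLieCoalg.hom_ext fun x => ?_, fun S h' hS => GrCoalg.hom_ext fun (x : S) =>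
    key S h' hS x.1 x.2⟩
  have := smallLeg_w (isSmall_sub (h1 x) (h3 x)) ((lieFunctor k).map (C.incl _ (h3 x)) ≫ f)
  exact congrArg (fun t : (lieFunctor k).obj (C.sub (T x) (h3 x)) ⟶ G =>
    t.toLinearMap (⟨x, h2 x⟩ : T x)) this

/-- A morphism from an object of countable dimension factors through a subcoalgebra of countable
dimension. -/
lemma exists_factor {B C : GrCoalg k} (hB : B.IsSmall) (u : B ⟶ C) :
    ∃ (S : Submodule k C.carrier) (_ : QLC.IsSmall S) (hS : IsGrSub C.deg Coalgebra.comul S)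
      (v : B ⟶ C.sub S hS), u = v ≫ C.incl S hS := by
  obtain ⟨p, hp⟩ := hB
  have hs : QLC.IsSmall (LinearMap.range (u.toCoalgHom.toLinearMap ∘ₗ p)) := by
    refine ⟨Set.range fun n : ℕ => u.toCoalgHom (p (Finsupp.single n 1)),
      Set.countable_range _, ?_⟩
    rw [LinearMap.range_eq_map, ← (Finsupp.basisSingleOne (R := k) (ι := ℕ)).span_eq,
      Submodule.map_span, ← Set.range_comp]
    rfl
  obtain ⟨S, h1, h2, h3⟩ := exists_small_sub C.deg Coalgebra.comul _ hs
  refine ⟨S, h1, h3, GrCoalg.corestrict u h3 fun x => h2 ?_, rfl⟩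
  obtain ⟨y, rfl⟩ := hp x
  exact ⟨y, rfl⟩

lemma smallLeg_unique {B : GrCoalg k} (hB : B.IsSmall) (u : B ⟶ coenv G) :
    u = smallLeg hB ((lieFunctor k).map u ≫ coenvCounit G) := by
  obtain ⟨h, hw, hh⟩ := exists_lift (coenvCounit G)
  have hid : h = 𝟙 (coenv G) := by
    refine coenv_ext fun i => ?_
    obtain ⟨S, s1, s2, v, hv⟩ := exists_factor i.isSmall (idxLeg i)
    have h2 : (lieFunctor k).map (idxLeg i) ≫ coenvCounit G = i.str :=
      lieDesc_legHom _ _ i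
    rw [Category.comp_id]
    rw [hv] at h2
    conv_lhs => rw [hv]
    rw [Category.assoc, hh S s1 s2, ← smallLeg_idx]
    refine smallLeg_nat _ _ _ _ _ ?_
    rw [← h2, Functor.map_comp, Category.assoc]
  subst hid
  obtain ⟨S, s1, s2, v, hv⟩ := exists_factor hB u
  have h3 := hh S s1 s2
  rw [Category.comp_id] at h3
  conv_lhs => rw [hv, h3]
  refine smallLeg_nat _ _ _ _ _ ?_
  rw [← Category.assoc, ← Functor.map_comp, ← hv]

lemma coenv_hom_ext {C : GrCoalg k} {u v : C ⟶ coenv G}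
    (h : (lieFunctor k).map u ≫ coenvCounit G = (lieFunctor k).map v ≫ coenvCounit G) :
    u = v := by
  refine GrCoalg.hom_ext fun x => ?_
  obtain ⟨T, t1, t2, t3⟩ := exists_small_sub C.deg Coalgebra.comul _ (isSmall_span_singleton x)
  have hB := isSmall_sub t1 t3
  have : C.incl T t3 ≫ u = C.incl T t3 ≫ v := by
    rw [smallLeg_unique hB (C.incl T t3 ≫ u), smallLeg_unique hB (C.incl T t3 ≫ v)]
    simp only [Functor.map_comp, Category.assoc, h]
  exact congrArg (fun t : C.sub T t3 ⟶ coenv G => t.toCoalgHom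
    (⟨x, t2 (Submodule.mem_span_singleton_self x)⟩ : T)) this

instance (k : Type u) [Field k] : (lieFunctor k).IsLeftAdjoint := by
  have : ∀ G : GrLieCoalg k, Limits.HasTerminal (CostructuredArrow (lieFunctor k) G) := by
    intro G
    refine Limits.IsTerminal.hasTerminal (X := CostructuredArrow.mk (coenvCounit G)) ?_
    refine Limits.IsTerminal.ofUniqueHom
      (fun B => CostructuredArrow.homMk (exists_lift B.hom).choose
        (exists_lift B.hom).choose_spec.1) (fun B m => ?_)
    refine CostructuredArrow.ext _ _ (coenv_hom_ext ?_)
    exact (CostructuredArrow.w m).trans (exists_lift B.hom).choose_spec.1.symm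
  exact isLeftAdjoint_of_costructuredArrowTerminals _

/-- The universal coenveloping coalgebra functor `U^c`, the right adjoint of `𝓛ie^c`. -/
def univCoenv (k : Type u) [Field k] : GrLieCoalg k ⥤ GrCoalg k := (lieFunctor k).rightAdjoint

/-- The adjunction between `𝓛ie^c` and `U^c`. -/
def univCoenvAdj (k : Type u) [Field k] : lieFunctor k ⊣ univCoenv k :=
  Adjunction.ofIsLeftAdjoint (lieFunctor k)

end Coenveloping

end

end QLC

/-! By adjunction, `U^c((qA)^¡)` represents the functor sending a graded coalgebra `C` to the set of
morphisms `𝓛ie^c(C) ⟶ (qA)^¡`. The proof shows that `(qA^+)^¡` represents the same functor, with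
universal element the restriction of `π`; the Yoneda lemma then gives the isomorphism, its
naturality and its compatibility with the counit. The explicit construction of `U^c` plays no role.

Without relations the claim is that every morphism `f : 𝓛ie^c(C) ⟶ L^c(sV)` equals `π ∘ 𝓛ie^c(h)`
for a unique coalgebra morphism `h : C ⟶ T^c(sV)` (`exists_lift_cofreeLie`,
`lift_cofreeLie_unique`). Composing `f` with the projection to the cogenerators gives a linear map
`φ : C → V`, and the weight `n` part of `h` is `φ^{⊗n} ∘ Δ^{(n-1)}`. No conilpotency of `C` is
needed: degree equals weight in `T^c(sV)`, the map `φ` lives in degree one, and so only weight `n`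
contributes in degree `n`. The maps `π ∘ h` and `f` agree in degree one, and `cofreeLie_hom_ext`
concludes that they are equal, because the cobracket of `L^c(sV)` is injective in weights at least
two.

This injectivity (`mem_decomposables_of_cobr`) is where characteristic zero enters. The dual of the
Dynkin operator splits off one letter at a time with the cobracket, so it kills every element whose
cobracket vanishes in `L^c(sV)`. On words it is also the convolution of the weight operator with the
antipode of the signed shuffle algebra. Modulo shuffles of nonempty words only the term with trivial
antipode factor remains, so the operator acts on weight `n` as multiplication by `n`.

With relations, the decomposables of weight two are spanned by `ab - ba` and die in `Sym²(V)`, so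
the two quadratic conditions correspond under `π` (`CommQLC.proj_mem_cogenRel`). Both Koszul duals
are largest subobjects satisfying these conditions. Hence `π` carries one into the other, and the
lift of a morphism into `(qA)^¡` has its image in `(qA^+)^¡`; the universal property restricts
(`koszulProj_bijective`). -/

namespace QLC
noncomputable section

/-! ### Antipode identities in the signed shuffle algebra. -/

section Dynkin

variable {k : Type u} [Field k] {V : Type u} [AddCommGroup V] [Module k V]

open TensorAlgebra (ι)

/-- The sign of the antipode of the signed shuffle algebra on words of length `m`. -/
def antipodeSign (k : Type u) [Field k] (m : ℕ) : k := ∏ i ∈ Finset.range m, (-1 : k) ^ (i + 1)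

lemma antipodeSign_succ (m : ℕ) :
    antipodeSign k (m + 1) = (-1 : k) ^ (m + 1) * antipodeSign k m := by
  rw [antipodeSign, Finset.prod_range_succ, mul_comm]; rfl

/-- The convolution `w ↦ ∑ c(|u|) u ⧢ S(v)` over the deconcatenations `w = uv`, for `S` the antipode
of the signed shuffle algebra. -/
def shuffleConv (c : ℕ → k) (l : List V) : TensorAlgebra k V :=
  ∑ i ∈ Finset.range (l.length + 1),
    (c i * antipodeSign k (l.length - i)) • shuffle k (l.take i) (l.drop i).reverse

/-- The left factor starts with the first letter `a` of the word and the reversed right factor with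
its last letter `b`, so the first-letter recursion of the shuffle strips one or the other. The bound
on `i` keeps the right factor nonempty. -/
lemma shuffle_cons_append (a b : V) (l₁ l₂ : List V) (h : a :: l₁ = l₂ ++ [b]) (i : ℕ)
    (hi : i + 1 ≤ l₁.length) :
    shuffle k ((a :: l₁).take (i + 1)) ((a :: l₁).drop (i + 1)).reverse =
      ι k a * shuffle k (l₁.take i) (l₁.drop i).reverse +
        (-1 : k) ^ (i + 1) • (ι k b * shuffle k (l₂.take (i + 1)) (l₂.drop (i + 1)).reverse) := by
  have hlen : l₁.length = l₂.length := by simpa using congrArg List.length h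
  have e1 : (l₁.drop i).reverse = b :: (l₂.drop (i + 1)).reverse := by
    have : l₁.drop i = (l₂ ++ [b]).drop (i + 1) := by rw [← h]; rfl
    rw [this, List.drop_append_of_le_length (by omega)]
    simp
  have e2 : l₂.take (i + 1) = a :: l₁.take i := by
    have : (l₂ ++ [b]).take (i + 1) = a :: l₁.take i := by rw [← h]; rfl
    rwa [List.take_append_of_le_length (by omega)] at this
  rw [List.take_succ_cons, List.drop_succ_cons, e1, shuffle_cons, e2, List.length_take,
    min_eq_left (by omega)]

/-- Sum the preceding expansion over all cuts. Stripping `a` shortens the left factor, which shifts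
the coefficients; stripping `b` leaves them alone. This is the recursion that the Dynkin operator
will be seen to satisfy. -/
lemma shuffleConv_cons (c : ℕ → k) (a b : V) (l₁ l₂ : List V) (h : a :: l₁ = l₂ ++ [b]) :
    shuffleConv c (a :: l₁) = ι k a * shuffleConv (fun i => c (i + 1)) l₁ +
      (-1 : k) ^ (l₁.length + 1) • (ι k b * shuffleConv c l₂) := by
  have hlen : l₂.length = l₁.length := by simpa using (congrArg List.length h).symm
  have h0 : shuffle k [] (a :: l₁).reverse = ι k b * shuffle k [] l₂.reverse := by
    rw [h]; simp
  -- One more letter on the right multiplies the antipode sign by `-1` to the new length. Together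
  -- with the shuffle sign `(-1) ^ i` the exponent becomes independent of `i`, so the sign leaves
  -- the sum.
  have hs : ∀ i ≤ l₁.length, antipodeSign k (l₁.length + 1 - i) * (-1) ^ i =
      (-1) ^ (l₁.length + 1) * antipodeSign k (l₁.length - i) := by
    intro i hi
    rw [Nat.sub_add_comm hi, antipodeSign_succ, ← Nat.sub_add_comm hi, mul_right_comm, ← pow_add,
      Nat.sub_add_cancel (by omega)]
  -- The cut with empty right factor only begins with `a` and matches the last term of the first
  -- sum; the cut with empty left factor only begins with `b` and matches the first term of the
  -- second.
  have e₁ : shuffleConv (fun i => c (i + 1)) l₁ = _ := Finset.sum_range_succ _ l₁.length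
  have e₂ : shuffleConv c l₂ = _ := Finset.sum_range_succ' _ l₂.length
  rw [e₁, e₂, hlen, shuffleConv, Finset.sum_range_succ' _ (a :: l₁).length, List.length_cons,
    Finset.sum_range_succ]
  have e : ∀ i ∈ Finset.range l₁.length, (c (i + 1) * antipodeSign k (l₁.length + 1 - (i + 1))) •
      shuffle k ((a :: l₁).take (i + 1)) ((a :: l₁).drop (i + 1)).reverse =
      ι k a * ((c (i + 1) * antipodeSign k (l₁.length - i)) •
        shuffle k (l₁.take i) (l₁.drop i).reverse) +
      (-1 : k) ^ (l₁.length + 1) • (ι k b * ((c (i + 1) * antipodeSign k (l₁.length - (i + 1))) •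
        shuffle k (l₂.take (i + 1)) (l₂.drop (i + 1)).reverse)) := by
    intro i hi
    rw [Finset.mem_range] at hi
    rw [shuffle_cons_append a b l₁ l₂ h i hi, smul_add, mul_smul_comm, mul_smul_comm, smul_smul,
      smul_smul, Nat.add_sub_add_right]
    congr 2
    have := hs (i + 1) hi
    rw [Nat.add_sub_add_right] at this
    linear_combination c (i + 1) * this
  rw [Finset.sum_congr rfl e, Finset.sum_add_distrib]
  have h1 := hs 0 (Nat.zero_le _)
  simp only [pow_zero, mul_one, Nat.sub_zero] at h1
  simp only [List.take_zero, List.drop_zero, h0, mul_add, smul_add, Finset.mul_sum,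
    Finset.smul_sum, mul_smul_comm, smul_smul, Nat.sub_self, List.take_succ_cons,
    List.take_length, List.drop_succ_cons, List.drop_length, List.reverse_nil,
    shuffle_nil_right, word_cons, Nat.sub_zero, h1]
  rw [mul_left_comm ((-1 : k) ^ (l₁.length + 1)) (c 0)]
  abel

/-- The antipode identity of the signed shuffle algebra. -/
lemma shuffleConv_one (l : List V) (hl : l ≠ []) : shuffleConv (fun _ => (1 : k)) l = 0 := by
  induction hn : l.length using Nat.strong_induction_on generalizing l with
  | _ n ih =>
    obtain ⟨a, l₁, rfl⟩ := List.exists_cons_of_ne_nil hl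
    obtain ⟨l₂, b, h⟩ := List.eq_nil_or_concat' (a :: l₁) |>.resolve_left hl
    have hlen : l₂.length = l₁.length := by simpa using (congrArg List.length h).symm
    -- Constant coefficients are unaffected by the shift, so both summands vanish by induction,
    -- except for a single letter, where they are `a` and `-a`.
    rw [shuffleConv_cons _ a b l₁ l₂ h]
    by_cases h1 : l₁ = []
    · subst h1
      have h2 : l₂ = [] := List.length_eq_zero_iff.1 hlen
      subst h2
      obtain rfl : a = b := by simpa using h
      simp
    · have h2 : l₂ ≠ [] := by
        rw [← List.length_pos_iff, hlen]; exact List.length_pos_iff.2 h1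
      have hlt : l₁.length < n := by rw [← hn]; simp
      rw [ih _ hlt l₁ h1 rfl, ih _ hlt l₂ h2 hlen]
      simp

/-- The shift turns the coefficient `i` into `i + 1`, and the extra constant contributes nothing by
the antipode identity on the nonempty word `l₁`. -/
lemma shuffleConv_id_cons (a b : V) (l₁ l₂ : List V) (h : a :: l₁ = l₂ ++ [b]) (h1 : l₁ ≠ []) :
    shuffleConv (fun i => (i : k)) (a :: l₁) = ι k a * shuffleConv (fun i => (i : k)) l₁ +
      (-1 : k) ^ (l₁.length + 1) • (ι k b * shuffleConv (fun i => (i : k)) l₂) := by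
  have : shuffleConv (fun i => ((i + 1 : ℕ) : k)) l₁ =
      shuffleConv (fun i => (i : k)) l₁ + shuffleConv (fun _ => (1 : k)) l₁ := by
    simp only [shuffleConv, ← Finset.sum_add_distrib, ← add_smul, ← add_mul, Nat.cast_add,
      Nat.cast_one]
  rw [shuffleConv_cons _ a b l₁ l₂ h, this, shuffleConv_one l₁ h1, add_zero]

/-- Proper cuts give shuffles of nonempty words, the cut with empty left factor has coefficient `0`,
and the cut with empty right factor is the word times its length. -/
lemma shuffleConv_id_sub_mem (l : List V) :
    shuffleConv (fun i => (i : k)) l - (l.length : k) • word k l ∈ decomposables k V := by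
  rw [shuffleConv, Finset.sum_range_succ]
  simp only [Nat.sub_self, List.take_length, List.drop_length, List.reverse_nil, shuffle_nil_right]
  rw [show antipodeSign k 0 = 1 from rfl, mul_one, add_sub_cancel_right]
  refine Submodule.sum_mem _ fun i hi => ?_
  rw [Finset.mem_range] at hi
  rcases Nat.eq_zero_or_pos i with rfl | h0
  · simp
  · refine Submodule.smul_mem _ _ (shuffle_mem_decomposables ?_ ?_)
    · rw [← List.length_pos_iff, List.length_take]; omega
    · rw [← List.length_pos_iff, List.length_reverse, List.length_drop]; omega

/-! ### The dual Dynkin operator and injectivity of the cobracket. -/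

/-- The cobracket `Δ - τ ∘ Δ` of the tensor coalgebra. -/
def tensorCobr (k : Type u) [Field k] (V : Type u) [AddCommGroup V] [Module k V] :
    TensorAlgebra k V →ₗ[k] TensorAlgebra k V ⊗[k] TensorAlgebra k V :=
  deconcat k V - gswap (tdeg k V) ∘ₗ deconcat k V

/-- The dual of the Dynkin operator, on words of length `n + 1`. -/
def dynkin (k : Type u) [Field k] (V : Type u) [AddCommGroup V] [Module k V] :
    ℕ → TensorAlgebra k V →ₗ[k] TensorAlgebra k V
  | 0 => gproj (tdeg k V) 1
  | n + 1 => LinearMap.mul' k _ ∘ₗ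
      TensorProduct.map (gproj (tdeg k V) 1) (dynkin k V n) ∘ₗ tensorCobr k V

/-- Two maps that vanish on `D` factor through `M ⧸ D`, so their tensor product factors through `(M
⧸ D) ⊗ (M ⧸ D)`. This is how vanishing of the cobracket in the quotient `L^c(sV)` is used upstairs
in `T^c(sV)`. -/
lemma map_eq_zero_of_factor {M N P : Type u} [AddCommGroup M] [Module k M] [AddCommGroup N]
    [Module k N] [AddCommGroup P] [Module k P] {D : Submodule k M} {f : M →ₗ[k] N}
    {g : M →ₗ[k] P} (hf : ∀ x ∈ D, f x = 0) (hg : ∀ x ∈ D, g x = 0) {t : M ⊗[k] M}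
    (ht : TensorProduct.map D.mkQ D.mkQ t = 0) : TensorProduct.map f g t = 0 := by
  have : TensorProduct.map f g = TensorProduct.map (D.liftQ f hf) (D.liftQ g hg) ∘ₗ
      TensorProduct.map D.mkQ D.mkQ := by
    rw [← TensorProduct.map_comp]
    exact congrArg₂ _ (D.liftQ_mkQ f hf).symm (D.liftQ_mkQ g hg).symm
  rw [this, LinearMap.comp_apply, ht, map_zero]

lemma gproj_one_decomposables (x : TensorAlgebra k V) (hx : x ∈ decomposables k V) :
    gproj (tdeg k V) 1 x = 0 := by
  refine (Submodule.span_le (p := LinearMap.ker (gproj (tdeg k V) 1))).2 ?_ hx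
  rintro _ (rfl | ⟨u, v, hu, hv, rfl⟩)
  · exact gproj_ne (tdeg k V) (word_mem ([] : List V)) (by simp)
  · refine gproj_ne (tdeg k V) (shuffle_mem u v) ?_
    have := List.length_pos_iff.2 hu
    have := List.length_pos_iff.2 hv
    omega

/-- Induction, since the cobracket of a decomposable vanishes in the quotient
(`cobr_decomposables`): the operator is well defined on `L^c(sV)`. -/
lemma dynkin_decomposables (n : ℕ) (x : TensorAlgebra k V) (hx : x ∈ decomposables k V) :
    dynkin k V n x = 0 := by
  induction n generalizing x with
  | zero => exact gproj_one_decomposables x hx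
  | succ n ih =>
    simp only [dynkin, LinearMap.comp_apply]
    have h : TensorProduct.map (decomposables k V).mkQ (decomposables k V).mkQ
        (tensorCobr k V x) = 0 := cobr_decomposables x hx
    rw [map_eq_zero_of_factor gproj_one_decomposables ih h, map_zero]

lemma gproj_one_word (c : V) : gproj (tdeg k V) 1 (word k [c]) = ι k c :=
  (gproj_same (tdeg k V) (word_mem [c])).trans (by simp)

/-- Both sides obey the recursion of `shuffleConv_id_cons`: strip the first letter, or strip the
last letter with a sign. -/
lemma dynkin_word (n : ℕ) (l : List V) (hl : l.length = n + 1) :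
    dynkin k V n (word k l) = shuffleConv (fun i => (i : k)) l := by
  induction n generalizing l with
  | zero =>
    obtain ⟨a, rfl⟩ := List.length_eq_one_iff.1 hl
    simp only [dynkin]
    rw [gproj_one_word]
    simp [shuffleConv, Finset.sum_range_succ, antipodeSign]
  | succ n ih =>
    have hne : l ≠ [] := by rw [← List.length_pos_iff]; omega
    obtain ⟨a, l₁, rfl⟩ := List.exists_cons_of_ne_nil hne
    obtain ⟨l₂, b, h⟩ := List.eq_nil_or_concat' (a :: l₁) |>.resolve_left hne
    have hlen : l₂.length = l₁.length := by simpa using (congrArg List.length h).symm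
    have hl1 : l₁.length = n + 1 := by simpa using hl
    have hl2 : l₂.length = n + 1 := hlen.trans hl1
    have h1 : l₁ ≠ [] := by rw [← List.length_pos_iff]; omega
    rw [shuffleConv_id_cons a b l₁ l₂ h h1, ← ih l₁ hl1, ← ih l₂ hl2]
    have p0 : ∀ w : List V, w.length ≠ 1 → gproj (tdeg k V) 1 (word k w) = 0 := fun w hw =>
      gproj_ne (tdeg k V) (word_mem w) (by exact_mod_cast hw)
    simp only [dynkin, LinearMap.comp_apply, tensorCobr, LinearMap.sub_apply, map_sub,
      deconcat_word, map_sum]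
    -- The projection to weight one leaves from `Δ` only the cut after the first letter, and from `τ
    -- ∘ Δ` only the cut before the last letter.
    rw [Finset.sum_eq_single 1, Finset.sum_eq_single (n + 1)]
    · have d1 : (a :: l₁).drop (n + 1) = [b] := by
        rw [h, ← hl2]; simp
      have d2 : (a :: l₁).take (n + 1) = l₂ := by
        rw [h, ← hl2]; simp
      rw [d1, d2, gswap_tmul (tdeg k V) (word_mem l₂) (word_mem [b])]
      -- The last letter, of degree one, moves past the `n + 1` letters of `l₂`; with the minus sign
      -- of the cobracket this is the sign in the recursion.
      have hk : ksign k (l₂.length : ℤ) (([b] : List V).length : ℤ) = (-1) ^ (n + 1) := by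
        unfold ksign
        rw [hl2, ← Nat.cast_mul, uzpow_natCast]
        simp
      rw [hk, hl1, sub_eq_add_neg]
      simp only [List.take_succ_cons, List.take_zero, List.drop_succ_cons, List.drop_zero,
        TensorProduct.map_tmul, map_smul, gproj_one_word, LinearMap.mul'_apply]
      rw [pow_succ _ (n + 1)]
      simp
    · intro i hi hne'
      rw [Finset.mem_range] at hi
      rw [gswap_tmul (tdeg k V) (word_mem _) (word_mem _), map_smul, TensorProduct.map_tmul,
        p0 ((a :: l₁).drop i)]
      · simp
      · rw [List.length_drop, hl]; omega
    · intro hn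
      exact absurd (Finset.mem_range.2 (by omega)) hn
    · intro i hi hne'
      rw [Finset.mem_range] at hi
      rw [TensorProduct.map_tmul, p0 ((a :: l₁).take i)]
      · simp
      · rw [List.length_take]; omega
    · intro hn
      exact absurd (Finset.mem_range.2 (by omega)) hn

/-- On indecomposables of weight `n + 1` the operator is multiplication by `n + 1`: the dual of the
Dynkin–Specht–Wever theorem. -/
lemma dynkin_sub_mem (n : ℕ) (x : TensorAlgebra k V) (hx : x ∈ tdeg k V ((n : ℤ) + 1)) :
    dynkin k V n x - ((n : k) + 1) • x ∈ decomposables k V := by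
  have : tdeg k V ((n : ℤ) + 1) ≤
      (decomposables k V).comap (dynkin k V n - ((n : k) + 1) • LinearMap.id) := by
    refine Submodule.span_le.2 ?_
    rintro _ ⟨l, hl, rfl⟩
    have hl' : l.length = n + 1 := by omega
    have h := shuffleConv_id_sub_mem (k := k) l
    rw [← dynkin_word n l hl', hl', Nat.cast_add, Nat.cast_one] at h
    exact h
  exact this hx

/-- In characteristic zero, the cobracket of the cofree Lie coalgebra is injective in weights at
least two. -/
lemma mem_decomposables_of_cobr [CharZero k] {n : ℤ} (hn : 2 ≤ n) {x : TensorAlgebra k V}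
    (hx : x ∈ tdeg k V n)
    (h : TensorProduct.map (decomposables k V).mkQ (decomposables k V).mkQ
      (tensorCobr k V x) = 0) : x ∈ decomposables k V := by
  -- The operator of index `m + 1` acts on weight `m + 2`. An index of the form `m + 1` is needed so
  -- that at least one cobracket is applied.
  obtain ⟨m, rfl⟩ : ∃ m : ℕ, n = ((m + 1 : ℕ) : ℤ) + 1 := ⟨(n - 2).toNat, by omega⟩
  have h1 := dynkin_sub_mem (m + 1) x hx
  have h2 : dynkin k V (m + 1) x = 0 := by
    simp only [dynkin, LinearMap.comp_apply]
    rw [map_eq_zero_of_factor gproj_one_decomposables (dynkin_decomposables m) h, map_zero]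
  rw [h2, zero_sub, neg_mem_iff] at h1
  -- What remains is that `m + 2` times `x` is decomposable, and `m + 2` is invertible in
  -- characteristic zero.
  exact (Submodule.smul_mem_iff _ (Nat.cast_add_one_ne_zero (m + 1))).1 h1

end Dynkin


/-! ### Uniqueness of graded morphisms to the tensor coalgebra. -/

section CofreeProperty

variable {k : Type u} [Field k] {V : Type u} [AddCommGroup V] [Module k V]

open TensorAlgebra (ι)

lemma eq_zero_of_mem_tdeg_neg {n : ℤ} (hn : n < 0) {x : TensorAlgebra k V}
    (hx : x ∈ tdeg k V n) : x = 0 := by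
  refine LinearMap.eqOn_span (f := LinearMap.id) (g := 0) ?_ hx
  rintro _ ⟨l, hl, rfl⟩
  omega

lemma eq_algebraMapInv_smul_one {x : TensorAlgebra k V} (hx : x ∈ tdeg k V 0) :
    x = TensorAlgebra.algebraMapInv (R := k) x • 1 := by
  refine LinearMap.eqOn_span (f := LinearMap.id)
    (g := LinearMap.smulRight TensorAlgebra.algebraMapInv.toLinearMap 1) ?_ hx
  rintro _ ⟨l, hl, rfl⟩
  obtain rfl : l = [] := List.length_eq_zero_iff.1 (by omega)
  simp

lemma exists_ι_of_mem_tdeg_one {x : TensorAlgebra k V} (hx : x ∈ tdeg k V 1) :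
    ∃ v, x = ι k v := by
  have : tdeg k V 1 ≤ LinearMap.range (ι k) := by
    refine Submodule.span_le.2 ?_
    rintro _ ⟨l, hl, rfl⟩
    obtain ⟨a, rfl⟩ := List.length_eq_one_iff.1 (by omega : l.length = 1)
    exact ⟨a, by simp⟩
  obtain ⟨v, hv⟩ := this hx
  exact ⟨v, hv.symm⟩

/-- A tensor of positive weight is recovered from its deconcatenations after the first letter. -/
lemma mul_gproj_one_deconcat {n : ℤ} (hn : 1 ≤ n) {x : TensorAlgebra k V}
    (hx : x ∈ tdeg k V n) : LinearMap.mul' k _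
      (TensorProduct.map (gproj (tdeg k V) 1) LinearMap.id (deconcat k V x)) = x := by
  refine LinearMap.eqOn_span (f := LinearMap.mul' k _ ∘ₗ
    TensorProduct.map (gproj (tdeg k V) 1) LinearMap.id ∘ₗ deconcat k V) (g := LinearMap.id) ?_ hx
  rintro _ ⟨l, hl, rfl⟩
  obtain ⟨a, l, rfl⟩ := List.exists_cons_of_ne_nil (l := l) (by rintro rfl; simp at hl; omega)
  simp only [LinearMap.comp_apply, deconcat_word, map_sum, TensorProduct.map_tmul]
  rw [Finset.sum_eq_single 1]
  · simp only [List.take_succ_cons, List.take_zero, gproj_one_word]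
    simp
  · intro i hi hne
    rw [Finset.mem_range] at hi
    rw [gproj_ne (tdeg k V) (word_mem _)]
    · simp
    · rw [List.length_take]; omega
  · intro h
    exact absurd (Finset.mem_range.2 (by simp)) h

variable {C : GrCoalg k}

/-- Two graded comultiplicative maps to the tensor coalgebra that agree in degree one agree. -/
lemma tensorCoalg_map_ext {g g' : C.carrier →ₗ[k] TensorAlgebra k V}
    (hd : ∀ n, ∀ x ∈ C.deg n, g x ∈ tdeg k V n) (hd' : ∀ n, ∀ x ∈ C.deg n, g' x ∈ tdeg k V n)
    (hΔ : ∀ x, deconcat k V (g x) = TensorProduct.map g g (Coalgebra.comul (R := k) x))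
    (hΔ' : ∀ x, deconcat k V (g' x) = TensorProduct.map g' g' (Coalgebra.comul (R := k) x))
    (hε : ∀ x, TensorAlgebra.algebraMapInv (g x) = Coalgebra.counit (R := k) x)
    (hε' : ∀ x, TensorAlgebra.algebraMapInv (g' x) = Coalgebra.counit (R := k) x)
    (h1 : ∀ x ∈ C.deg 1, g x = g' x) : g = g' := by
  have key : ∀ n : ℕ, ∀ x ∈ C.deg n, g x = g' x := by
    intro n
    induction n with
    | zero =>
      intro x hx
      -- Weight zero is spanned by the unit, and the counit reads off the coefficient.
      rw [eq_algebraMapInv_smul_one (hd _ x hx), eq_algebraMapInv_smul_one (hd' _ x hx), hε, hε']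
    | succ n ih =>
      intro x hx
      -- A tensor is its first letter times the rest, and comultiplicativity moves this
      -- decomposition into `C`. Only left factors of degree one count, and then the right factor
      -- has degree `n`, where the induction hypothesis applies.
      rw [← mul_gproj_one_deconcat (by omega) (hd _ x hx),
        ← mul_gproj_one_deconcat (by omega) (hd' _ x hx), hΔ, hΔ']
      refine congrArg (LinearMap.mul' k _) ((tensDeg_le (Q := LinearMap.eqLocus
        (TensorProduct.map (gproj (tdeg k V) 1) LinearMap.id ∘ₗ TensorProduct.map g g)
        (TensorProduct.map (gproj (tdeg k V) 1) LinearMap.id ∘ₗ TensorProduct.map g' g')) ?_)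
          (C.comul_mem _ x hx))
      intro i j a b ha hb hij
      simp only [LinearMap.mem_eqLocus, LinearMap.comp_apply, TensorProduct.map_tmul,
        LinearMap.id_apply]
      by_cases hi : i = 1
      · subst hi
        obtain rfl : j = n := by push_cast at hij; omega
        rw [h1 a ha, ih b hb]
      · rw [gproj_ne (tdeg k V) (hd _ a ha) hi, gproj_ne (tdeg k V) (hd' _ a ha) hi,
          TensorProduct.zero_tmul, TensorProduct.zero_tmul]
  refine ext_hom C.deg fun n x hx => ?_
  rcases lt_or_ge n 0 with hn | hn
  · rw [eq_zero_of_mem_tdeg_neg hn (hd n x hx), eq_zero_of_mem_tdeg_neg hn (hd' n x hx)]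
  · lift n to ℕ using hn
    exact key n x hx

/-! ### Construction of the coalgebra morphism with given cogenerator component. -/

/-- The weight `n` part `φ^{⊗n} ∘ Δ^{(n-1)}` of the map to the tensor coalgebra induced by `φ`. -/
def tensorLiftAux (φ : C.carrier →ₗ[k] V) : ℕ → C.carrier →ₗ[k] TensorAlgebra k V
  | 0 => LinearMap.smulRight (Coalgebra.counit (R := k)) 1
  | n + 1 => LinearMap.mul' k _ ∘ₗ TensorProduct.map (ι k ∘ₗ φ) (tensorLiftAux φ n) ∘ₗ
      Coalgebra.comul

lemma tensorLiftAux_mem (φ : C.carrier →ₗ[k] V) (n : ℕ) (x : C.carrier) :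
    tensorLiftAux φ n x ∈ tdeg k V n := by
  induction n generalizing x with
  | zero => exact Submodule.smul_mem _ _ (word_mem ([] : List V))
  | succ n ih =>
    simp only [tensorLiftAux, LinearMap.comp_apply]
    generalize Coalgebra.comul (R := k) x = t
    induction t using TensorProduct.induction_on with
    | zero => simp
    | tmul a b => simpa using letter_mem (φ a) (ih b)
    | add s t hs ht => rw [map_add, map_add]; exact Submodule.add_mem _ hs ht

/-- All `n` factors of the iterated coproduct must have degree one to survive `φ`, which forces
total degree `n`. This takes the place of conilpotency: a homogeneous element has only one weight
component in its image, so no infinite sum occurs. -/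
lemma tensorLiftAux_eq_zero {φ : C.carrier →ₗ[k] V} (hφ : ∀ n ≠ 1, ∀ x ∈ C.deg n, φ x = 0)
    (n : ℕ) {m : ℤ} (hm : m ≠ n) {x : C.carrier} (hx : x ∈ C.deg m) :
    tensorLiftAux φ n x = 0 := by
  induction n generalizing m x with
  | zero => simp [tensorLiftAux, C.counit_eq_zero m (by simpa using hm) x hx]
  | succ n ih =>
    have : tensDeg C.deg C.deg m ≤
        LinearMap.ker (TensorProduct.map (ι k ∘ₗ φ) (tensorLiftAux φ n)) := by
      refine tensDeg_le fun i j a b ha hb hij => ?_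
      rw [LinearMap.mem_ker, TensorProduct.map_tmul]
      by_cases hi : i = 1
      · rw [ih (m := j) (by push_cast at hm; omega) hb, TensorProduct.tmul_zero]
      · rw [LinearMap.comp_apply, hφ i hi a ha, map_zero, TensorProduct.zero_tmul]
    simp only [tensorLiftAux, LinearMap.comp_apply]
    rw [LinearMap.mem_ker.1 (this (C.comul_mem m x hx)), map_zero]

/-- The left counit axiom, in the form suited to the weight zero part of the lift, which is the
counit times the unit. The next lemma is its mirror image. -/
lemma map_counit_comul {P Q : Type u} [AddCommGroup P] [Module k P] [AddCommGroup Q] [Module k Q]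
    (p : P) (g : C.carrier →ₗ[k] Q) (x : C.carrier) :
    TensorProduct.map (LinearMap.smulRight (Coalgebra.counit (R := k) (A := C.carrier)) p) g
      (Coalgebra.comul (R := k) x) = p ⊗ₜ g x := by
  have : TensorProduct.map (LinearMap.smulRight (Coalgebra.counit (R := k) (A := C.carrier)) p) g =
      TensorProduct.map (LinearMap.toSpanSingleton k P p) g ∘ₗ
        (Coalgebra.counit (R := k)).rTensor C.carrier := by
    refine TensorProduct.ext' fun a b => ?_
    simp
  rw [this, LinearMap.comp_apply, Coalgebra.rTensor_counit_comul]
  simp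

lemma map_comul_counit {P Q : Type u} [AddCommGroup P] [Module k P] [AddCommGroup Q] [Module k Q]
    (p : P) (g : C.carrier →ₗ[k] Q) (x : C.carrier) :
    TensorProduct.map g (LinearMap.smulRight (Coalgebra.counit (R := k) (A := C.carrier)) p)
      (Coalgebra.comul (R := k) x) = g x ⊗ₜ p := by
  have : TensorProduct.map g (LinearMap.smulRight (Coalgebra.counit (R := k) (A := C.carrier)) p) =
      TensorProduct.map g (LinearMap.toSpanSingleton k P p) ∘ₗ
        (Coalgebra.counit (R := k)).lTensor C.carrier := by
    refine TensorProduct.ext' fun a b => ?_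
    simp
  rw [this, LinearMap.comp_apply, Coalgebra.lTensor_counit_comul]
  simp

lemma tensorLiftAux_one (φ : C.carrier →ₗ[k] V) (x : C.carrier) :
    tensorLiftAux φ 1 x = ι k (φ x) := by
  simp only [tensorLiftAux, LinearMap.comp_apply, map_comul_counit]
  simp

/-- Cutting a word of `n` letters `φ(x₁) ⋯ φ(xₙ)` after `p` letters amounts, by coassociativity, to
applying `Δ` once and iterating it in both factors. -/
lemma deconcat_tensorLiftAux (φ : C.carrier →ₗ[k] V) (n : ℕ) (x : C.carrier) :
    deconcat k V (tensorLiftAux φ n x) = ∑ p ∈ Finset.HasAntidiagonal.antidiagonal n,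
      TensorProduct.map (tensorLiftAux φ p.1) (tensorLiftAux φ p.2)
        (Coalgebra.comul (R := k) x) := by
  induction n generalizing x with
  | zero =>
    simp only [Finset.Nat.antidiagonal_zero, Finset.sum_singleton, tensorLiftAux, map_counit_comul]
    simp
  | succ n ih =>
    have ih' : deconcat k V ∘ₗ tensorLiftAux φ n = ∑ p ∈ Finset.HasAntidiagonal.antidiagonal n,
        TensorProduct.map (tensorLiftAux φ p.1) (tensorLiftAux φ p.2) ∘ₗ
          Coalgebra.comul (R := k) := LinearMap.ext fun x => by
      simpa only [LinearMap.sum_apply, LinearMap.comp_apply] using ih x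
    -- `L` prepends the letter `φ(v)` to the left tensor factor.
    let L : C.carrier ⊗[k] (TensorAlgebra k V ⊗[k] TensorAlgebra k V) →ₗ[k]
        TensorAlgebra k V ⊗[k] TensorAlgebra k V :=
      (LinearMap.mul' k (TensorAlgebra k V)).rTensor (TensorAlgebra k V) ∘ₗ
        (TensorProduct.assoc k _ _ _).symm.toLinearMap ∘ₗ (ι k ∘ₗ φ).rTensor _
    have hL : ∀ v t, L (v ⊗ₜ t) = (letter k (φ v)).rTensor _ t := by
      intro v t
      induction t using TensorProduct.induction_on with
      | zero => simp
      | tmul a b => simp [L]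
      | add s t hs ht => rw [TensorProduct.tmul_add, map_add, map_add, hs, ht]
    -- The recursion for deconcatenation: the empty left factor, plus the cuts of the remaining word
    -- with the letter prepended on the left.
    have e : ∀ t, deconcat k V (LinearMap.mul' k _
        (TensorProduct.map (ι k ∘ₗ φ) (tensorLiftAux φ n) t)) =
        1 ⊗ₜ LinearMap.mul' k _ (TensorProduct.map (ι k ∘ₗ φ) (tensorLiftAux φ n) t) +
          L ((deconcat k V ∘ₗ tensorLiftAux φ n).lTensor _ t) := by
      intro t
      induction t using TensorProduct.induction_on with
      | zero => simp
      | tmul a b =>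
        simp only [TensorProduct.map_tmul, LinearMap.comp_apply, LinearMap.mul'_apply,
          deconcat_ι_mul, LinearMap.lTensor_tmul, hL]
      | add s t hs ht =>
        simp only [map_add, hs, ht, TensorProduct.tmul_add]
        abel
    -- Coassociativity is used here: prepending the letter to a left factor of weight `i` after
    -- comultiplying on the right equals comultiplying on the left, which is the recursion for
    -- weight `i + 1`.
    have e' : ∀ i j, L ((TensorProduct.map (tensorLiftAux φ i) (tensorLiftAux φ j) ∘ₗ
        Coalgebra.comul (R := k)).lTensor _ (Coalgebra.comul (R := k) x)) =
        TensorProduct.map (tensorLiftAux φ (i + 1)) (tensorLiftAux φ j)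
          (Coalgebra.comul (R := k) x) := by
      intro i j
      have h1 : TensorProduct.map (tensorLiftAux φ (i + 1)) (tensorLiftAux φ j) =
          TensorProduct.map (LinearMap.mul' k _ ∘ₗ
            TensorProduct.map (ι k ∘ₗ φ) (tensorLiftAux φ i)) (tensorLiftAux φ j) ∘ₗ
              (Coalgebra.comul (R := k)).rTensor C.carrier := by
        rw [LinearMap.rTensor, ← TensorProduct.map_comp, LinearMap.comp_id]
        rfl
      have h2 : L ∘ₗ (TensorProduct.map (tensorLiftAux φ i) (tensorLiftAux φ j)).lTensor _ =
          TensorProduct.map (LinearMap.mul' k _ ∘ₗ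
            TensorProduct.map (ι k ∘ₗ φ) (tensorLiftAux φ i)) (tensorLiftAux φ j) ∘ₗ
              (TensorProduct.assoc k _ _ _).symm.toLinearMap := by
        refine TensorProduct.ext_threefold' fun a b c => ?_
        simp [hL]
      rw [h1, LinearMap.lTensor_comp]
      refine (LinearMap.congr_fun h2 _).trans ?_
      exact congrArg _ (Coalgebra.coassoc_symm_apply x)
    -- The term of the antidiagonal whose left weight is zero.
    have e0 := map_counit_comul (1 : TensorAlgebra k V) (tensorLiftAux φ (n + 1)) x
    rw [Finset.Nat.sum_antidiagonal_succ]
    refine (e _).trans (congrArg₂ _ e0.symm ?_)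
    rw [ih', ← LinearMap.coe_lTensorHom, map_sum, LinearMap.sum_apply, map_sum]
    exact Finset.sum_congr rfl fun p _ => e' p.1 p.2

/-- The map to the tensor coalgebra induced by a linear map `φ : C → V`. -/
def tensorLiftMap (φ : C.carrier →ₗ[k] V) : C.carrier →ₗ[k] TensorAlgebra k V :=
  DirectSum.toModule k ℤ _ (fun n => tensorLiftAux φ n.toNat ∘ₗ (C.deg n).subtype) ∘ₗ
    (DirectSum.decomposeLinearEquiv C.deg).toLinearMap

lemma tensorLiftMap_apply (φ : C.carrier →ₗ[k] V) {n : ℤ} {x : C.carrier} (hx : x ∈ C.deg n) :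
    tensorLiftMap φ x = tensorLiftAux φ n.toNat x := by
  lift x to C.deg n using hx
  simp only [tensorLiftMap, LinearMap.comp_apply, LinearEquiv.coe_coe,
    DirectSum.decomposeLinearEquiv_apply, DirectSum.decompose_coe]
  rw [← DirectSum.lof_eq_of k, DirectSum.toModule_lof]
  rfl

lemma tensorLiftMap_mem {φ : C.carrier →ₗ[k] V} (hφ : ∀ n ≠ 1, ∀ x ∈ C.deg n, φ x = 0) (n : ℤ)
    (x : C.carrier) (hx : x ∈ C.deg n) : tensorLiftMap φ x ∈ tdeg k V n := by
  rw [tensorLiftMap_apply φ hx]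
  rcases lt_or_ge n 0 with hn | hn
  · rw [tensorLiftAux_eq_zero hφ _ (by omega) hx]
    exact Submodule.zero_mem _
  · lift n to ℕ using hn
    exact tensorLiftAux_mem φ n x

lemma tensorLiftMap_counit (φ : C.carrier →ₗ[k] V) (x : C.carrier) :
    TensorAlgebra.algebraMapInv (tensorLiftMap φ x) = Coalgebra.counit (R := k) x := by
  have : TensorAlgebra.algebraMapInv.toLinearMap ∘ₗ tensorLiftMap φ =
      Coalgebra.counit (R := k) := by
    refine ext_hom C.deg fun n x hx => ?_
    rw [LinearMap.comp_apply, tensorLiftMap_apply φ hx, AlgHom.toLinearMap_apply]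
    -- The case `0` also covers negative degrees, where the weight zero formula still returns the
    -- counit. In the other case the value begins with a letter and the augmentation kills it.
    rcases h : n.toNat with _ | m
    · simp [tensorLiftAux]
    · rw [C.counit_eq_zero n (by omega) x hx]
      simp only [tensorLiftAux, LinearMap.comp_apply]
      generalize Coalgebra.comul (R := k) x = t
      induction t using TensorProduct.induction_on with
      | zero => simp
      | tmul a b => simpa using Or.inl (counit_letter (φ a) 1)
      | add s t hs ht => rw [map_add, map_add, map_add, hs, ht, add_zero]
  exact LinearMap.congr_fun this x

/-- On a tensor of bidegree `(i, j)` the sum over all weights `(p, q)` reduces to the term `(i, j)`,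
since each weight sees only its own degree. -/
lemma tensorLiftMap_comul {φ : C.carrier →ₗ[k] V} (hφ : ∀ n ≠ 1, ∀ x ∈ C.deg n, φ x = 0)
    (x : C.carrier) : deconcat k V (tensorLiftMap φ x) =
      TensorProduct.map (tensorLiftMap φ) (tensorLiftMap φ) (Coalgebra.comul (R := k) x) := by
  have : deconcat k V ∘ₗ tensorLiftMap φ =
      TensorProduct.map (tensorLiftMap φ) (tensorLiftMap φ) ∘ₗ Coalgebra.comul (R := k) := by
    refine ext_hom C.deg fun n x hx => ?_
    rw [LinearMap.comp_apply, LinearMap.comp_apply, tensorLiftMap_apply φ hx,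
      deconcat_tensorLiftAux, ← LinearMap.sum_apply]
    refine (tensDeg_le (Q := LinearMap.eqLocus _ _) ?_) (C.comul_mem n x hx)
    intro i j a b ha hb hij
    rw [LinearMap.mem_eqLocus, LinearMap.sum_apply, TensorProduct.map_tmul]
    have h0 : ∀ (p q : ℕ), (i ≠ p ∨ j ≠ q) →
        TensorProduct.map (tensorLiftAux φ p) (tensorLiftAux φ q) (a ⊗ₜ b) = 0 := by
      rintro p q (h | h)
      · rw [TensorProduct.map_tmul, tensorLiftAux_eq_zero hφ p h ha, TensorProduct.zero_tmul]
      · rw [TensorProduct.map_tmul, tensorLiftAux_eq_zero hφ q h hb, TensorProduct.tmul_zero]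
    -- `C` may have negative degrees. A negative degree matches no weight, so every summand
    -- vanishes, and so does the lift on that factor.
    by_cases hneg : i < 0 ∨ j < 0
    · rw [Finset.sum_eq_zero fun p _ => h0 p.1 p.2 (by omega)]
      rcases hneg with h | h
      · rw [eq_zero_of_mem_tdeg_neg h (tensorLiftMap_mem hφ i a ha), TensorProduct.zero_tmul]
      · rw [eq_zero_of_mem_tdeg_neg h (tensorLiftMap_mem hφ j b hb), TensorProduct.tmul_zero]
    · rw [Finset.sum_eq_single (i.toNat, j.toNat), TensorProduct.map_tmul,
        tensorLiftMap_apply φ ha, tensorLiftMap_apply φ hb]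
      · rintro ⟨p, q⟩ _ hne
        refine h0 p q ?_
        rw [Ne, Prod.mk.injEq] at hne
        omega
      · intro h
        exact absurd (Finset.HasAntidiagonal.mem_antidiagonal.2
          (by change i.toNat + j.toNat = n.toNat; omega)) h
  exact LinearMap.congr_fun this x

/-- The morphism to the cofree graded coalgebra induced by a linear map concentrated in degree
one. -/
def tensorLift (φ : C.carrier →ₗ[k] V) (hφ : ∀ n ≠ 1, ∀ x ∈ C.deg n, φ x = 0) :
    C ⟶ tensorCoalg k V :=
  GrCoalg.Hom.mk (D := tensorCoalg k V)
    { toLinearMap := tensorLiftMap φ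
      counit_comp := LinearMap.ext (tensorLiftMap_counit φ)
      map_comp_comul := LinearMap.ext fun x => (tensorLiftMap_comul hφ x).symm }
    (tensorLiftMap_mem hφ)

lemma tensorCoalg_hom_ext {g g' : C ⟶ tensorCoalg k V}
    (h : ∀ x ∈ C.deg 1, g.toCoalgHom x = g'.toCoalgHom x) : g = g' := by
  have := tensorCoalg_map_ext (g := g.toCoalgHom.toLinearMap) (g' := g'.toCoalgHom.toLinearMap)
    g.map_deg g'.map_deg (GrCoalg.map_comul g) (GrCoalg.map_comul g')
    (LinearMap.congr_fun g.toCoalgHom.counit_comp) (LinearMap.congr_fun g'.toCoalgHom.counit_comp) h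
  exact GrCoalg.hom_ext (LinearMap.congr_fun this)

/-! ### The universal property of `T^c(sV)` over `L^c(sV)`. -/

/-- Weight zero is spanned by the unit, which counts among the decomposables. Positivity of the
degrees is what allows induction against source Lie coalgebras that have arbitrary degrees. -/
lemma cofreeLie_deg_nonpos {n : ℤ} (hn : n ≤ 0) {y : (cofreeLie k V).carrier}
    (hy : y ∈ (cofreeLie k V).deg n) : y = 0 := by
  obtain ⟨x, hx, rfl⟩ := hy
  refine (Submodule.Quotient.mk_eq_zero (decomposables k V)).2 ?_
  rcases hn.lt_or_eq with h | rfl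
  · rw [eq_zero_of_mem_tdeg_neg h hx]; exact Submodule.zero_mem _
  · rw [eq_algebraMapInv_smul_one hx]
    exact Submodule.smul_mem _ _ one_mem_decomposables

lemma cofreeLie_cobr_injective [CharZero k] {n : ℤ} (hn : 2 ≤ n) {y : (cofreeLie k V).carrier}
    (hy : y ∈ (cofreeLie k V).deg n) (h : (cofreeLie k V).cobr y = 0) : y = 0 := by
  obtain ⟨x, hx, rfl⟩ := hy
  exact (Submodule.Quotient.mk_eq_zero (decomposables k V)).2 (mem_decomposables_of_cobr hn hx h)

/-- Morphisms to the cofree graded Lie coalgebra are determined by their degree one part. -/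
lemma cofreeLie_hom_ext [CharZero k] {H : GrLieCoalg k} {g g' : H ⟶ cofreeLie k V}
    (h1 : ∀ x ∈ H.deg 1, g.toLinearMap x = g'.toLinearMap x) : g = g' := by
  -- The bound `n ≤ m`, rather than equality, makes this a strong induction that includes the
  -- negative degrees.
  have key : ∀ m : ℕ, ∀ n : ℤ, n ≤ m → ∀ x ∈ H.deg n, g.toLinearMap x = g'.toLinearMap x := by
    intro m
    induction m with
    | zero =>
      intro n hn x hx
      rw [cofreeLie_deg_nonpos hn (g.map_deg n x hx), cofreeLie_deg_nonpos hn (g'.map_deg n x hx)]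
    | succ m ih =>
      intro n hn x hx
      rcases hn.lt_or_eq with hlt | rfl
      · exact ih n (by push_cast at hlt; omega) x hx
      rcases Nat.eq_zero_or_pos m with rfl | hm
      · exact h1 x (by simpa using hx)
      rw [← sub_eq_zero]
      -- From weight two on it suffices to compare cobrackets, and these are determined by the
      -- values in other degrees.
      refine cofreeLie_cobr_injective (n := (m + 1 : ℕ)) (by push_cast; omega)
        (Submodule.sub_mem _ (g.map_deg _ x hx) (g'.map_deg _ x hx)) ?_
      rw [map_sub, sub_eq_zero, g.map_cobr, g'.map_cobr]
      refine (tensDeg_le (Q := LinearMap.eqLocus _ _) ?_) (H.cobr_mem _ x hx)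
      intro i j a b ha hb hij
      rw [LinearMap.mem_eqLocus, TensorProduct.map_tmul, TensorProduct.map_tmul]
      -- Factors of nonpositive degree map to zero under both morphisms. Otherwise `i` and `j` are
      -- both positive with sum `m + 1`, hence at most `m`, and the induction hypothesis covers
      -- them.
      by_cases hi : i ≤ 0
      · rw [cofreeLie_deg_nonpos hi (g.map_deg _ a ha),
          cofreeLie_deg_nonpos hi (g'.map_deg _ a ha), TensorProduct.zero_tmul,
          TensorProduct.zero_tmul]
      by_cases hj : j ≤ 0
      · rw [cofreeLie_deg_nonpos hj (g.map_deg _ b hb),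
          cofreeLie_deg_nonpos hj (g'.map_deg _ b hb), TensorProduct.tmul_zero,
          TensorProduct.tmul_zero]
      push_cast at hij
      rw [ih i (by omega) a ha, ih j (by omega) b hb]
  refine GrLieCoalg.hom_ext (LinearMap.congr_fun (ext_hom H.deg fun n x hx => ?_))
  exact key n.toNat n (by omega) x hx

/-- The projection of the cofree graded Lie coalgebra onto its cogenerators. -/
def cofreeLieCogen (k : Type u) [Field k] (V : Type u) [AddCommGroup V] [Module k V] :
    (cofreeLie k V).carrier →ₗ[k] V :=
  TensorAlgebra.ιInv ∘ₗ (decomposables k V).liftQ (gproj (tdeg k V) 1) gproj_one_decomposables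

lemma cofreeLieCogen_proj (x : TensorAlgebra k V) :
    cofreeLieCogen k V ((cofreeLieProj k V).toLinearMap x) =
      TensorAlgebra.ιInv (gproj (tdeg k V) 1 x) := rfl

/-- The tensor coalgebra, with the projection to the cofree graded Lie coalgebra, is its universal
coenveloping coalgebra. -/
lemma exists_lift_cofreeLie [CharZero k] (f : (lieFunctor k).obj C ⟶ cofreeLie k V) :
    ∃ h : C ⟶ tensorCoalg k V, (lieFunctor k).map h ≫ cofreeLieProj k V = f := by
  -- The cogenerator component of `f`. It is supported in degree one because `f` preserves degrees.
  let φ : C.carrier →ₗ[k] V := cofreeLieCogen k V ∘ₗ f.toLinearMap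
  have hφ : ∀ n ≠ 1, ∀ x ∈ C.deg n, φ x = 0 := by
    intro n hn x hx
    obtain ⟨y, hy, hxy⟩ := f.map_deg n x hx
    have e : φ x = cofreeLieCogen k V ((cofreeLieProj k V).toLinearMap y) :=
      congrArg (cofreeLieCogen k V) hxy.symm
    exact e.trans ((cofreeLieCogen_proj y).trans
      ((congrArg _ (gproj_ne (tdeg k V) hy hn)).trans (map_zero _)))
  -- A comparison in degree one suffices. There the class `f x` is represented by a single letter
  -- `v`, and `φ x = v`.
  refine ⟨tensorLift φ hφ, cofreeLie_hom_ext fun x hx => ?_⟩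
  obtain ⟨y, hy, hxy⟩ := f.map_deg 1 x hx
  obtain ⟨v, rfl⟩ := exists_ι_of_mem_tdeg_one hy
  have e : φ x = cofreeLieCogen k V ((cofreeLieProj k V).toLinearMap (ι k v)) :=
    congrArg (cofreeLieCogen k V) hxy.symm
  rw [cofreeLieCogen_proj, gproj_same (tdeg k V) hy, TensorAlgebra.ι_leftInverse v] at e
  refine Eq.trans ?_ hxy
  refine congrArg (decomposables k V).mkQ ?_
  refine (tensorLiftMap_apply φ hx).trans ((tensorLiftAux_one φ x).trans ?_)
  rw [e]

/-- The values of the two lifts differ by decomposables, which have no weight one component; so the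
lifts agree in degree one, which determines them. -/
lemma lift_cofreeLie_unique {h h' : C ⟶ tensorCoalg k V}
    (e : (lieFunctor k).map h ≫ cofreeLieProj k V = (lieFunctor k).map h' ≫ cofreeLieProj k V) :
    h = h' := by
  refine tensorCoalg_hom_ext fun x hx => ?_
  have hq : (decomposables k V).mkQ (h.toCoalgHom x) = (decomposables k V).mkQ (h'.toCoalgHom x) :=
    congrArg (fun t : (lieFunctor k).obj C ⟶ cofreeLie k V => t.toLinearMap x) e
  have hm := gproj_one_decomposables _ ((Submodule.Quotient.eq (decomposables k V)).1 hq)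
  replace hm := sub_eq_zero.1 ((map_sub (gproj (tdeg k V) 1) _ _).symm.trans hm)
  exact (gproj_same (tdeg k V) (h.map_deg 1 x hx)).symm.trans
    (hm.trans (gproj_same (tdeg k V) (h'.map_deg 1 x hx)))

end CofreeProperty


/-! ### Comparison of the commutative and associative quadratic relations. -/

section KoszulDuality

variable {k : Type u} [Field k] {V : Type u} [AddCommGroup V] [Module k V]

open TensorAlgebra (ι)

lemma lift_monomial_word (l : List V) :
    SymmetricAlgebra.lift ((Polynomial.monomial 1).restrictScalars k ∘ₗ SymmetricAlgebra.ι k V)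
      (SymmetricAlgebra.algHom k V (word k l)) =
      Polynomial.monomial l.length (SymmetricAlgebra.algHom k V (word k l)) := by
  induction l with
  | nil => simp
  | cons v l ih =>
    rw [word_cons, map_mul, map_mul, ih, algHom_ι, SymmetricAlgebra.lift_ι_apply,
      LinearMap.comp_apply, LinearMap.restrictScalars_apply, Polynomial.monomial_mul_monomial,
      List.length_cons, add_comm]

/-- The weight on `Sym(V)` is read off from a polynomial variable and that on `T(V)` from word
length; `lift_monomial_word` matches them on words. -/
lemma symProj_algHom (n : ℕ) (x : TensorAlgebra k V) :
    symProj k V n (SymmetricAlgebra.algHom k V x) =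
      SymmetricAlgebra.algHom k V (gproj (tdeg k V) n x) := by
  have : symProj k V n ∘ₗ (SymmetricAlgebra.algHom k V).toLinearMap =
      (SymmetricAlgebra.algHom k V).toLinearMap ∘ₗ gproj (tdeg k V) n := by
    refine ext_word fun l => ?_
    have h : symProj k V n (SymmetricAlgebra.algHom k V (word k l)) = _ :=
      congrArg (fun p => Polynomial.coeff p n) (lift_monomial_word l)
    simp only [LinearMap.comp_apply, AlgHom.toLinearMap_apply]
    rw [h, Polynomial.coeff_monomial]
    split_ifs with hl
    · subst hl
      rw [gproj_same (tdeg k V) (word_mem l)]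
    · rw [gproj_ne (tdeg k V) (word_mem l) (by exact_mod_cast hl), map_zero]
  exact LinearMap.congr_fun this x

/-- In weight two the decomposables come from shuffles of two letters. As these have degree one, the
shuffle is `ab - ba`, which is zero in the symmetric algebra. Hence weight two of `L^c(sV)` maps to
`Sym²(V)`. -/
lemma algHom_gproj_two_decomposables (x : TensorAlgebra k V) (hx : x ∈ decomposables k V) :
    SymmetricAlgebra.algHom k V (gproj (tdeg k V) 2 x) = 0 := by
  refine (Submodule.span_le (p := LinearMap.ker
    ((SymmetricAlgebra.algHom k V).toLinearMap ∘ₗ gproj (tdeg k V) 2))).2 ?_ hx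
  rintro _ (rfl | ⟨u, v, hu, hv, rfl⟩)
  · change SymmetricAlgebra.algHom k V (gproj (tdeg k V) 2 1) = 0
    have h1 : gproj (tdeg k V) 2 1 = 0 :=
      gproj_ne (tdeg k V) (word_mem ([] : List V)) (by simp)
    rw [h1, map_zero]
  · change SymmetricAlgebra.algHom k V (gproj (tdeg k V) 2 (shuffle k u v)) = 0
    by_cases h : (u.length : ℤ) + v.length = 2
    · have := List.length_pos_iff.2 hu
      have := List.length_pos_iff.2 hv
      obtain ⟨a, rfl⟩ := List.length_eq_one_iff.1 (by omega : u.length = 1)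
      obtain ⟨b, rfl⟩ := List.length_eq_one_iff.1 (by omega : v.length = 1)
      have hs := shuffle_mem (k := k) [a] [b]
      rw [h] at hs
      rw [gproj_same (tdeg k V) hs]
      simp [shuffle_cons, mul_comm]
    · rw [gproj_ne (tdeg k V) (shuffle_mem u v) h, map_zero]

lemma tdeg_two_le : tdeg k V 2 ≤ LinearMap.range (ι k : V →ₗ[k] TensorAlgebra k V) ^ 2 := by
  refine Submodule.span_le.2 ?_
  rintro _ ⟨l, hl, rfl⟩
  have h := word_mem_pow (k := k) l
  rwa [show l.length = 2 by omega] at h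

lemma exists_algHom_eq {r : SymmetricAlgebra k V}
    (hr : r ∈ 1 ⊔ LinearMap.range (SymmetricAlgebra.ι k V) ⊔
      LinearMap.range (SymmetricAlgebra.ι k V) ^ 2) :
    ∃ t ∈ 1 ⊔ LinearMap.range (ι k : V →ₗ[k] TensorAlgebra k V) ⊔
      LinearMap.range (ι k : V →ₗ[k] TensorAlgebra k V) ^ 2,
      SymmetricAlgebra.algHom k V t = r := by
  have h : (LinearMap.range (ι k : V →ₗ[k] TensorAlgebra k V)).map
      (SymmetricAlgebra.algHom k V).toLinearMap = LinearMap.range (SymmetricAlgebra.ι k V) := by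
    rw [← LinearMap.range_comp]; rfl
  rw [← h, ← Submodule.map_pow, ← Submodule.map_one (SymmetricAlgebra.algHom k V),
    ← Submodule.map_sup, ← Submodule.map_sup] at hr
  exact hr

/-- The quadratic relations of the associative datum are the preimage of the commutative ones. -/
lemma CommQLC.mem_quadRel_toAssoc (D : CommQLC k) {y : TensorAlgebra k D.V}
    (hy : y ∈ tdeg k D.V 2) : y ∈ ((CommQLC.toAssoc k).obj D).quadRel ↔
      SymmetricAlgebra.algHom k D.V y ∈ D.quadRel := by
  constructor
  · rintro ⟨r, ⟨_, hr⟩, rfl⟩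
    exact ⟨_, hr, symProj_algHom 2 r⟩
  · rintro ⟨r, hr, hry⟩
    obtain ⟨t, ht, rfl⟩ := exists_algHom_eq (D.rel_le hr)
    have hle : tdeg k D.V 2 ≤ 1 ⊔ LinearMap.range (ι k : D.V →ₗ[k] TensorAlgebra k D.V) ⊔
      LinearMap.range (ι k : D.V →ₗ[k] TensorAlgebra k D.V) ^ 2 := tdeg_two_le.trans le_sup_right
    have ht2 : gproj (tdeg k D.V) 2 t ∈ tdeg k D.V 2 := gproj_mem _ _ _
    -- Replace the quadratic part of a lift `t` of the relation by `y`. Both have the same image in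
    -- `Sym²(V)`, so the result still lifts the relation.
    refine ⟨t - gproj (tdeg k D.V) 2 t + y, ⟨?_, ?_⟩, ?_⟩
    · exact Submodule.add_mem _ (Submodule.sub_mem _ ht (hle ht2)) (hle hy)
    · have e : symProj k D.V 2 (SymmetricAlgebra.algHom k D.V t) =
          SymmetricAlgebra.algHom k D.V (gproj (tdeg k D.V) 2 t) := symProj_algHom 2 t
      change SymmetricAlgebra.algHom k D.V _ ∈ D.rel
      rwa [map_add, map_sub, ← hry, e, sub_add_cancel]
    · change gproj (tdeg k D.V) 2 _ = y
      rw [map_add, map_sub, gproj_same (tdeg k D.V) ht2, gproj_same (tdeg k D.V) hy, sub_self,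
        zero_add]

/-- Both conditions say that the image in `Sym²(V)` of the weight two component of `x` lies in `qR`.
On the Lie side this does not depend on the representative, because decomposables die in `Sym²(V)`.
-/
lemma CommQLC.proj_mem_cogenRel (D : CommQLC k) (x : TensorAlgebra k D.V) :
    (cofreeLieProj k D.V).toLinearMap x ∈ D.cogenRel ↔
      x ∈ ((CommQLC.toAssoc k).obj D).cogenRel := by
  have hx2 : gproj (tdeg k D.V) 2 x ∈ tdeg k D.V 2 := gproj_mem _ _ _
  have e : gproj (cofreeLie k D.V).deg 2 ((cofreeLieProj k D.V).toLinearMap x) =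
      (cofreeLieProj k D.V).toLinearMap (gproj (tdeg k D.V) 2 x) :=
    gproj_map (tdeg k D.V) (cofreeLieProj k D.V).map_deg 2 x
  have h1 : x ∈ ((CommQLC.toAssoc k).obj D).cogenRel ↔
      SymmetricAlgebra.algHom k D.V (gproj (tdeg k D.V) 2 x) ∈ D.quadRel :=
    D.mem_quadRel_toAssoc hx2
  rw [h1, CommQLC.cogenRel, Submodule.mem_comap, e]
  constructor
  · rintro ⟨(y : TensorAlgebra k D.V), ⟨hy, hyr⟩, hyx⟩
    have hd : gproj (tdeg k D.V) 2 x - y ∈ decomposables k D.V :=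
      (Submodule.Quotient.eq (decomposables k D.V)).1 hyx.symm
    have h0 := algHom_gproj_two_decomposables _ hd
    rw [gproj_same (tdeg k D.V) (Submodule.sub_mem _ hx2 hy), map_sub, sub_eq_zero] at h0
    rw [h0]
    exact hyr
  · intro h
    exact ⟨_, ⟨hx2, h⟩, rfl⟩

/-! ### Restricting the universal property to the Koszul duals. -/

/-- A graded subcoalgebra is a graded Lie subcoalgebra. -/
lemma IsGrSub.lie {C : GrCoalg k} {S : Submodule k C.carrier}
    (hS : IsGrSub C.deg (Coalgebra.comul (R := k)) S) :
    IsGrSub ((lieFunctor k).obj C).deg ((lieFunctor k).obj C).cobr S :=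
  -- The cobracket of the subcoalgebra itself supplies the preimage in `S ⊗ S`.
  ⟨hS.homogeneous, fun x hx => ⟨_, (((lieFunctor k).map (C.incl S hS)).map_cobr
    (⟨x, hx⟩ : S)).symm⟩⟩

/-- A morphism of graded Lie coalgebras with values in a graded Lie subcoalgebra. -/
def GrLieCoalg.corestrict {H G : GrLieCoalg k} (f : H ⟶ G) {T : Submodule k G.carrier}
    (hT : IsGrSub G.deg G.cobr T) (h : ∀ x, f.toLinearMap x ∈ T) : H ⟶ G.sub T hT :=
  GrLieCoalg.Hom.mk (H := G.sub T hT) (f.toLinearMap.codRestrict T h)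
    (fun n x hx => f.map_deg n x hx)
    (fun x => map_subtype_injective T (by
      have e : ∀ t : H.carrier ⊗[k] H.carrier, TensorProduct.map T.subtype T.subtype
          (TensorProduct.map (f.toLinearMap.codRestrict T h) (f.toLinearMap.codRestrict T h) t) =
          TensorProduct.map f.toLinearMap f.toLinearMap t := by
        intro t
        simp only [← LinearMap.comp_apply, ← TensorProduct.map_comp]
        rfl
      refine (map_subMap hT.map_mem ⟨f.toLinearMap x, h x⟩).trans ?_
      exact (f.map_cobr x).trans (e _).symm))

instance GrLieCoalg.mono_incl (G : GrLieCoalg k) (T : Submodule k G.carrier)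
    (hT : IsGrSub G.deg G.cobr T) : Mono (G.incl T hT) :=
  ⟨fun _ _ h => GrLieCoalg.hom_ext fun x => Subtype.ext
    (congrArg (fun t => GrLieCoalg.Hom.toLinearMap t x) h)⟩

instance GrCoalg.mono_incl (D : GrCoalg k) (T : Submodule k D.carrier)
    (hT : IsGrSub D.deg Coalgebra.comul T) : Mono (D.incl T hT) :=
  ⟨fun _ _ h => GrCoalg.hom_ext fun x => Subtype.ext
    (congrArg (fun t => CoalgHom.toLinearMap (GrCoalg.Hom.toCoalgHom t) x) h)⟩

instance CommQLC.mono_koszulIncl (D : CommQLC k) : Mono D.koszulIncl :=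
  GrLieCoalg.mono_incl _ _ _

/-- The inclusion of the Koszul dual coalgebra of a commutative datum into `T^c(sV)`. -/
def CommQLC.koszulCoalgIncl (D : CommQLC k) :
    (koszulCoalg k).obj ((CommQLC.toAssoc k).obj D) ⟶ tensorCoalg k D.V :=
  ((CommQLC.toAssoc k).obj D).koszulIncl

instance CommQLC.mono_koszulCoalgIncl (D : CommQLC k) : Mono D.koszulCoalgIncl :=
  GrCoalg.mono_incl _ _ _

/-- The image under `π` of the Koszul dual coalgebra is a graded Lie subcoalgebra satisfying the
quadratic condition, so maximality of `(qA)^¡` applies. -/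
lemma CommQLC.proj_mem_koszulSub (D : CommQLC k) {x : TensorAlgebra k D.V}
    (hx : x ∈ ((CommQLC.toAssoc k).obj D).koszulSub) :
    (cofreeLieProj k D.V).toLinearMap x ∈ D.koszulSub := by
  have hS : IsGrSub (tensorCoalg k D.V).deg (Coalgebra.comul (R := k))
    ((CommQLC.toAssoc k).obj D).koszulSub := ((CommQLC.toAssoc k).obj D).isGrSub_koszulSub
  refine le_largestSub (cofreeLie k D.V).deg
    (hS.lie.map _ (cofreeLieProj k D.V).map_deg (cofreeLieProj k D.V).map_cobr) ?_ ⟨x, hx, rfl⟩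
  rintro _ ⟨y, hy, rfl⟩
  exact (D.proj_mem_cogenRel y).2 (largestSub_le (tensorCoalg k D.V).deg _ _ hy)

/-- The image of `h` is a graded subcoalgebra of `T^c(sV)`, and the quadratic condition on it can be
tested after `π`; maximality of `(qA^+)^¡` applies. The full image of a coalgebra is needed here,
not a single element. -/
lemma CommQLC.mem_koszulSub_of_proj (D : CommQLC k) {C : GrCoalg k} (h : C ⟶ tensorCoalg k D.V)
    (hh : ∀ x, (cofreeLieProj k D.V).toLinearMap (h.toCoalgHom x) ∈ D.koszulSub) (x : C.carrier) :
    h.toCoalgHom x ∈ ((CommQLC.toAssoc k).obj D).koszulSub := by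
  refine le_largestSub (tensorCoalg k D.V).deg
    (S := Submodule.map h.toCoalgHom.toLinearMap ⊤)
    (IsGrSub.map C.deg h.map_deg (GrCoalg.map_comul h) (isGrSub_top C.deg _)) ?_ ⟨x, trivial, rfl⟩
  rintro _ ⟨y, _, rfl⟩
  exact (D.proj_mem_cogenRel _).1 (largestSub_le _ _ _ (hh y))

/-- The morphism from the Koszul dual coalgebra to the Koszul dual Lie coalgebra induced by the
projection `T^c(sV) ⟶ L^c(sV)`. -/
def koszulProj (D : CommQLC k) :
    (lieFunctor k).obj ((koszulCoalg k).obj ((CommQLC.toAssoc k).obj D)) ⟶ (koszulLie k).obj D :=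
  GrLieCoalg.corestrict
    ((lieFunctor k).map D.koszulCoalgIncl ≫ cofreeLieProj k D.V)
    D.isGrSub_koszulSub fun x => D.proj_mem_koszulSub (Subtype.property x)

lemma koszulProj_incl (D : CommQLC k) : koszulProj D ≫ D.koszulIncl =
    (lieFunctor k).map D.koszulCoalgIncl ≫ cofreeLieProj k D.V := rfl

/-- Both composites send `x` to the class of its image under `T(V) → T(W)`, so they agree by
definition. -/
lemma koszulProj_naturality {D E : CommQLC k} (f : D ⟶ E) :
    (lieFunctor k).map ((koszulCoalg k).map ((CommQLC.toAssoc k).map f)) ≫ koszulProj E =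
      koszulProj D ≫ (koszulLie k).map f := rfl

/-- The Koszul dual coalgebra has the universal property of the universal coenveloping coalgebra
of the Koszul dual Lie coalgebra. -/
lemma koszulProj_bijective [CharZero k] (D : CommQLC k) (C : GrCoalg k) :
    Function.Bijective fun g : C ⟶ (koszulCoalg k).obj ((CommQLC.toAssoc k).obj D) =>
      (lieFunctor k).map g ≫ koszulProj D := by
  constructor
  -- Injectivity: after the inclusions this is uniqueness of lifts through `π`, and the inclusion
  -- into `T^c(sV)` is a monomorphism.
  · intro g g' h
    have h' := congrArg (· ≫ D.koszulIncl) h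
    simp only [Category.assoc, koszulProj_incl] at h'
    rw [← Functor.map_comp_assoc, ← Functor.map_comp_assoc] at h'
    exact (cancel_mono D.koszulCoalgIncl).1 (lift_cofreeLie_unique h')
  · intro f
    -- Surjectivity: lift to `T^c(sV)` while ignoring the relations. The projection of the lift has
    -- values in `(qA)^¡`, so the lift corestricts.
    obtain ⟨h, hh⟩ := exists_lift_cofreeLie (f ≫ D.koszulIncl)
    have hmem : ∀ x, (cofreeLieProj k D.V).toLinearMap (h.toCoalgHom x) ∈ D.koszulSub := by
      intro x
      have e : (cofreeLieProj k D.V).toLinearMap (h.toCoalgHom x) =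
          D.koszulIncl.toLinearMap (f.toLinearMap x) :=
        congrArg (fun t : (lieFunctor k).obj C ⟶ cofreeLie k D.V => t.toLinearMap x) hh
      rw [e]
      exact Subtype.property (p := (· ∈ D.koszulSub)) (f.toLinearMap x)
    refine ⟨GrCoalg.corestrict h ((CommQLC.toAssoc k).obj D).isGrSub_koszulSub
      (D.mem_koszulSub_of_proj h hmem), ?_⟩
    rw [← cancel_mono D.koszulIncl, ← hh]
    rfl

/-! ### The comparison with the universal coenveloping coalgebra. -/

/-- The comparison morphism from the Koszul dual coalgebra to the universal coenveloping coalgebra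
of the Koszul dual Lie coalgebra. -/
def koszulComparison (D : CommQLC k) : (koszulCoalg k).obj ((CommQLC.toAssoc k).obj D) ⟶
    (univCoenv k).obj ((koszulLie k).obj D) :=
  (univCoenvAdj k).homEquiv _ _ (koszulProj D)

lemma koszulComparison_counit (D : CommQLC k) : (lieFunctor k).map (koszulComparison D) ≫
    (univCoenvAdj k).counit.app ((koszulLie k).obj D) = koszulProj D :=
  ((univCoenvAdj k).homEquiv_counit _ _ _).symm.trans (Equiv.symm_apply_apply _ _)

/-- Yoneda: postcomposition with the comparison is the universal property of `koszulProj` followed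
by the adjunction bijection, and both are bijective. -/
instance [CharZero k] (D : CommQLC k) : IsIso (koszulComparison D) := by
  refine isIso_of_yoneda_map_bijective _ fun C => ?_
  have : (fun g : C ⟶ (koszulCoalg k).obj ((CommQLC.toAssoc k).obj D) =>
      g ≫ koszulComparison D) = (univCoenvAdj k).homEquiv _ _ ∘ fun g =>
        (lieFunctor k).map g ≫ koszulProj D :=
    funext fun g => ((univCoenvAdj k).homEquiv_naturality_left g (koszulProj D)).symm
  rw [this]
  exact (Equiv.bijective _).comp (koszulProj_bijective D C)

/-- Transposing along the adjunction turns this square into `koszulProj_naturality`. -/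
lemma koszulComparison_naturality {D E : CommQLC k} (f : D ⟶ E) :
    (koszulCoalg k).map ((CommQLC.toAssoc k).map f) ≫ koszulComparison E =
      koszulComparison D ≫ (univCoenv k).map ((koszulLie k).map f) := by
  rw [koszulComparison, koszulComparison, ← Adjunction.homEquiv_naturality_left,
    koszulProj_naturality, Adjunction.homEquiv_naturality_right]

/-- The comparison morphisms as a natural isomorphism. -/
def koszulComparisonIso (k : Type u) [Field k] [CharZero k] :
    CommQLC.toAssoc k ⋙ koszulCoalg k ≅ koszulLie k ⋙ univCoenv k :=
  NatIso.ofComponents (fun D => asIso (koszulComparison D)) koszulComparison_naturality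

end KoszulDuality

end
end QLC

theorem theorem5p6 (k : Type u) [Field k] [CharZero k] :
    ∃ α : QLC.koszulLie k ⋙ QLC.univCoenv k ≅ QLC.CommQLC.toAssoc k ⋙ QLC.koszulCoalg k,
      ∀ D : QLC.CommQLC k,
        (QLC.lieFunctor k).map
            (α.hom.app D ≫ ((QLC.CommQLC.toAssoc k).obj D).koszulIncl) ≫
              QLC.cofreeLieProj k D.V =
          (QLC.univCoenvAdj k).counit.app ((QLC.koszulLie k).obj D) ≫ D.koszulIncl := by
  -- The adjunction naturally produces a morphism into `U^c`, so `α` is the inverse of the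
  -- comparison.
  refine ⟨(QLC.koszulComparisonIso k).symm, fun D => ?_⟩
  have hinv : (QLC.koszulComparisonIso k).symm.hom.app D = inv (QLC.koszulComparison D) := rfl
  rw [hinv]
  change (QLC.lieFunctor k).map (inv (QLC.koszulComparison D) ≫ D.koszulCoalgIncl) ≫
    QLC.cofreeLieProj k D.V = _
  -- The map `π` on the Koszul dual coalgebra is `koszulProj` followed by the inclusion, and
  -- `koszulProj` is the comparison followed by the counit; the comparison cancels against its
  -- inverse.
  rw [Functor.map_comp, Category.assoc, ← QLC.koszulProj_incl,
    ← QLC.koszulComparison_counit, Functor.map_inv, Category.assoc, IsIso.inv_hom_id_assoc]
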